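/- **Theorem 5.2 ($m$-times repeated first binary Darboux transformation).** *Setting.* All functions are real-valued functions of $(x,t)$, $x\in\mathbb R$, $t\in T$ with $T\subseteq\mathbb R$ open, and solutions are $C^\infty$ in $(x,t)$; $\partial=\partial/\partial x$ and $\partial^{-1}=\int_{-\infty}^x\cdot\,dx$. Let $b_0=0$, $b_1=1$, $b_{k+1}=Lb_k$ for $k\ge1$, with $L=-\tfrac14\partial^2-u+\tfrac12\partial^{-1}u_x$, and $a_k=-\tfrac12 b_{k,x}$; here $b_k=b_k(u)$ are differential polynomials in $u$, and in $L$ the symbol $\partial^{-1}$ is the formal antiderivative without constant term (all the antiderivatives needed exist). For integers $n,N\ge 0$ and real constants $\alpha,\eta,\lambda_1,\dots,\lambda_N$, the $n$-th KdV equation with $N$ self-consistent sources is $$u_t=\partial\Big[-2b_{n+2}(u)-2\alpha\sum_{j=1}^N\phi_j^2\Big],\qquad \phi_{j,xx}+(\lambda_j+u)\phi_j=0,\quad j=1,\dots,N, \tag{1}$$ and its linear problem with parameter $\lambda\in\mathbb R$ is $$\psi_{xx}+(\lambda+u)\psi=0,\qquad \psi_t=Q^{(n,N)}\psi:=\sum_{i=0}^{n+1}\lambda^{n+1-i}(a_i+b_i\partial)\psi+\eta\psi+\alpha\sum_{j=1}^N\phi_j\,\partial^{-1}(\phi_j\psi),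 \tag{2}$$ where the integrals $\partial^{-1}(\phi_j\psi)$ are required to converge. We say that a product $gh$ *decays* at $x=-\infty$ if for all $p,q\ge0$ and every compact $K\subset T$ there is a function integrable on $(-\infty,0]$ that dominates $|\partial^pg\,\partial^qh|$ there for all $t\in K$. *Hypotheses.* Let $u,\phi_1,\dots,\phi_N$ solve (1), and for $i=1,\dots,m$ let $f_i$ solve (2) with $\lambda=\xi_i\in\mathbb R$. Assume that all the products $f_if_j$ and $f_i\phi_j$ decay at $x=-\infty$ and that $u$ and each of its $x$-derivatives is bounded on $(-\infty,0]$, uniformly for $t$ in compact subsets of $T$. Starting from $u[0]=u$ and $g[0]=g$ define the iterates of the first binary Darboux transformation by $$g[i]=g[i-1]-\frac{f_i[i-1]}{\partial^{-1}f_i[i-1]^2}\,\partial^{-1}\big(f_i[i-1]\,g[i-1]\big),\qquad u[i]=u[i-1]+2\partial^2\ln\big(\partial^{-1}f_i[i-1]^2\big),$$ for $g$ any of the $f_j$, $\phi_j$, or a solution $\psi$ of (2), and assume that each step is defined, i.e. $\partial^{-1}f_i[i-1]^2$ has no zero on $\mathbb R\times T$ for $i=1,\dots,m$. Put $W_1(g_1,\dots,g_k)=\det\big(\partial^{-1}(g_ig_j)\big)_{i,j\le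 k}$ and $W_2(g_1,\dots,g_k)=\det G$, where $G_{ij}=\partial^{-1}(g_ig_j)$ for $i<k$ and $G_{kj}=g_j$. *Conclusion.* On $\mathbb R\times T$ one has $W_1(f_1,\dots,f_m)>0$ and $$u[m]=u+2\partial^2\ln W_1(f_1,\dots,f_m),\qquad \phi_j[m]=\frac{W_2(f_1,\dots,f_m,\phi_j)}{W_1(f_1,\dots,f_m)},\quad j=1,\dots,N,$$ and $u[m],\phi_1[m],\dots,\phi_N[m]$ again solve (1), with the same $n,N,\alpha,\lambda_1,\dots,\lambda_N$. Moreover, for every $\lambda\in\mathbb R$ and every solution $\psi$ of (2) such that all products $f_i\psi$ and $\phi_j\psi$ decay at $x=-\infty$, $$\psi[m]=\frac{W_2(f_1,\dots,f_m,\psi)}{W_1(f_1,\dots,f_m)},$$ and $\psi[m]$ solves (2) with the same $\lambda,\eta,\alpha,n,N$ and with $u,\phi_1,\dots,\phi_N$ replaced by $u[m],\phi_1[m],\dots,\phi_N[m]$. -/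

import Mathlib

open scoped ContDiff

namespace KdV

/-! ### Differential polynomials and the coefficients of the KdV hierarchy -/

/-- Differential polynomials in one function `u`; the variable `X i` stands for `∂^i u`. -/
abbrev DiffPoly := MvPolynomial ℕ ℝ

/-- The total derivative `∂` with respect to `x`: the derivation with `∂ (∂^i u) = ∂^(i+1) u`. -/
noncomputable def D : Derivation ℝ DiffPoly DiffPoly :=
  MvPolynomial.mkDerivation ℝ fun i => MvPolynomial.X (i + 1)

open Classical in
/-- The formal inverse of `∂` on differential polynomials: the antiderivative of `p` without
constant term (and `0` when `p` is not a total derivative, a case that never arises below,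
see `D_formalInt_b`). -/
noncomputable def formalInt (p : DiffPoly) : DiffPoly :=
  if h : ∃ q : DiffPoly, D q = p ∧ MvPolynomial.constantCoeff q = 0 then h.choose else 0

/-- The recursion operator `L = -(1/4) ∂² - u + (1/2) ∂⁻¹ u_x`. -/
noncomputable def L (p : DiffPoly) : DiffPoly :=
  -(MvPolynomial.C (1 / 4) * D (D p)) - MvPolynomial.X 0 * p
    + MvPolynomial.C (1 / 2) * formalInt (MvPolynomial.X 1 * p)

/-- The coefficients `b_k`: `b_0 = 0`, `b_1 = 1`, `b_{k+1} = L b_k` for `k ≥ 1`. -/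
noncomputable def b : ℕ → DiffPoly
  | 0 => 0
  | 1 => 1
  | k + 2 => L (b (k + 1))

/-- The coefficients `a_k = -(1/2) ∂ b_k`. -/
noncomputable def a (k : ℕ) : DiffPoly := -(MvPolynomial.C (1 / 2) * D (b k))

/-! The formal antiderivatives in the recursion always exist. -/

/-- The operator `∂ L`. -/
noncomputable def M (p : DiffPoly) : DiffPoly :=
  -(MvPolynomial.C (1 / 4) * D (D (D p))) - MvPolynomial.X 0 * D p
    - MvPolynomial.C (1 / 2) * (MvPolynomial.X 1 * p)

theorem D_C_mul (r : ℝ) (p : DiffPoly) :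
    D (MvPolynomial.C r * p) = MvPolynomial.C r * D p := by
  rw [← MvPolynomial.smul_eq_C_mul, ← MvPolynomial.smul_eq_C_mul, Derivation.map_smul]

theorem D_mul (p q : DiffPoly) : D (p * q) = p * D q + q * D p := by
  rw [Derivation.leibniz, smul_eq_mul, smul_eq_mul]

theorem D_C (r : ℝ) : D (MvPolynomial.C r : DiffPoly) = 0 := by
  rw [MvPolynomial.C_eq_smul_one, Derivation.map_smul, Derivation.map_one_eq_zero, smul_zero]

theorem D_X (i : ℕ) : D (MvPolynomial.X i) = MvPolynomial.X (i + 1) := by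
  simp [D]

theorem formalInt_spec {p : DiffPoly} (h : ∃ q, D q = p) :
    D (formalInt p) = p ∧ MvPolynomial.constantCoeff (formalInt p) = 0 := by
  have h' : ∃ q : DiffPoly, D q = p ∧ MvPolynomial.constantCoeff q = 0 := by
    obtain ⟨q, hq⟩ := h
    refine ⟨q - MvPolynomial.C (MvPolynomial.constantCoeff q), ?_, by simp⟩
    rw [map_sub, hq]
    simp [D]
  rw [formalInt, dif_pos h']
  exact h'.choose_spec

theorem four_quarter :
    (MvPolynomial.C (1 / 4) : DiffPoly) * 4 = 1 := by
  rw [show (4 : DiffPoly) = MvPolynomial.C 4 from (map_ofNat MvPolynomial.C 4).symm, ← MvPolynomial.C_mul]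
  norm_num

theorem two_half :
    (MvPolynomial.C (1 / 2) : DiffPoly) * 2 = 1 := by
  rw [show (2 : DiffPoly) = MvPolynomial.C 2 from (map_ofNat MvPolynomial.C 2).symm, ← MvPolynomial.C_mul]
  norm_num

theorem exact_of_M {p : DiffPoly} (h : ∃ q, D q = M p) :
    ∃ q, D q = MvPolynomial.X 1 * p := by
  obtain ⟨q, hq⟩ := h
  refine ⟨MvPolynomial.C 2 * q + MvPolynomial.C (1 / 2) * D (D p)
    + MvPolynomial.C 2 * (MvPolynomial.X 0 * p), ?_⟩
  simp only [map_add, D_C, D_mul, D_X, hq, M]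
  have h2 : (MvPolynomial.C 2 : DiffPoly) = 2 := map_ofNat MvPolynomial.C 2
  have h1 := two_half
  have h4 := four_quarter
  have h5 : (MvPolynomial.C (1 / 2) : DiffPoly) = 2 * MvPolynomial.C (1 / 4) := by
    linear_combination (2 * MvPolynomial.C (1 / 4)) * h1 - MvPolynomial.C (1 / 2) * h4
  rw [h2]
  linear_combination (D (D (D p))) * h5 - MvPolynomial.X 1 * p * h1

theorem M_skew (p q : DiffPoly) : ∃ r, D r = p * M q + q * M p := by
  refine ⟨-(MvPolynomial.C (1 / 4) * (p * D (D q) + q * D (D p) - D p * D q))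
    - MvPolynomial.X 0 * (p * q), ?_⟩
  simp only [map_add, map_sub, map_neg, D_C, D_mul, D_X, M]
  linear_combination (MvPolynomial.X 1 * p * q) * two_half

theorem D_b_of_exact {k : ℕ} (h : ∃ q, D q = M (b (k + 1))) :
    D (b (k + 2)) = M (b (k + 1)) := by
  have h1 := (formalInt_spec (exact_of_M h)).1
  rw [b, L, map_add, map_sub, map_neg, D_C_mul, D_C_mul, D_mul, D_X, h1, M]
  linear_combination (MvPolynomial.X 1 * b (k + 1)) * two_half

theorem M_b_exact (k : ℕ) : ∃ q, D q = M (b (k + 1)) := by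
  induction k using Nat.strong_induction_on with
  | _ k ih =>
    have key : ∀ i, i ≤ k → ∃ q, D q = M (b (k + 1)) - b (i + 1) * M (b (k - i + 1)) := by
      intro i
      induction i with
      | zero => intro _; exact ⟨0, by simp [b]⟩
      | succ i hi =>
        intro hik
        obtain ⟨q, hq⟩ := hi (by omega)
        obtain ⟨r, hr⟩ := M_skew (b (i + 1)) (b (k - i + 1))
        have e1 := D_b_of_exact (ih i (by omega))
        have e2 := D_b_of_exact (ih (k - (i + 1)) (by omega))
        have e3 : k - (i + 1) + 2 = k - i + 1 := by omega
        rw [e3] at e2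
        refine ⟨q + r - b (i + 2) * b (k - i + 1), ?_⟩
        rw [map_sub, map_add, D_mul, hq, hr, e1, e2]
        ring
    obtain ⟨q, hq⟩ := key k le_rfl
    obtain ⟨r, hr⟩ := M_skew (b 1) (b (k + 1))
    rw [Nat.sub_self] at hq
    refine ⟨MvPolynomial.C (1 / 2) * (q + r), ?_⟩
    rw [D_C_mul, map_add, hq, hr]
    simp only [b]
    linear_combination (M (b (k + 1))) * two_half

/-- Every antiderivative in the recursion is a genuine one. -/
theorem D_formalInt_b (k : ℕ) :
    D (formalInt (MvPolynomial.X 1 * b (k + 1))) = MvPolynomial.X 1 * b (k + 1)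
      ∧ MvPolynomial.constantCoeff (formalInt (MvPolynomial.X 1 * b (k + 1))) = 0 :=
  formalInt_spec (exact_of_M (M_b_exact k))

/-- The recursion in differentiated form. -/
theorem D_b_succ (k : ℕ) :
    D (b (k + 2)) = -(MvPolynomial.C (1 / 4) * D (D (D (b (k + 1)))))
      - MvPolynomial.X 0 * D (b (k + 1))
      - MvPolynomial.C (1 / 2) * (MvPolynomial.X 1 * b (k + 1)) :=
  D_b_of_exact (M_b_exact k)

/-! ### Functions of `(t, x)`

A function `g` of time and space is written `g t x`. -/

/-- The value at `(t, x)` of the differential polynomial `p` in the function `u`. -/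
noncomputable def ev (p : DiffPoly) (u : ℝ → ℝ → ℝ) (t x : ℝ) : ℝ :=
  MvPolynomial.eval (fun i => iteratedDeriv i (u t) x) p

/-- `∂⁻¹ = ∫_{-∞}^x · dx`. -/
noncomputable def Dinv (g : ℝ → ℝ → ℝ) (t x : ℝ) : ℝ :=
  ∫ y in Set.Iic x, g t y

/-- `A^(n)(u, λ) ψ = ∑_{i=0}^{n+1} (a_i + b_i ∂) λ^(n+1-i) ψ`. -/
noncomputable def A (n : ℕ) (u : ℝ → ℝ → ℝ) (lam : ℝ) (ψ : ℝ → ℝ → ℝ) (t x : ℝ) : ℝ :=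
  ∑ i ∈ Finset.range (n + 2),
    (ev (a i) u t x * ψ t x + ev (b i) u t x * deriv (ψ t) x) * lam ^ (n + 1 - i)

/-- `Q^(n,N) ψ = A^(n) ψ + η ψ + α ∑_j φ_j ∂⁻¹ (φ_j ψ)`. -/
noncomputable def Q (n : ℕ) {N : ℕ} (α η : ℝ) (u : ℝ → ℝ → ℝ) (φ : Fin N → ℝ → ℝ → ℝ)
    (lam : ℝ) (ψ : ℝ → ℝ → ℝ) (t x : ℝ) : ℝ :=
  A n u lam ψ t x + η * ψ t x
    + α * ∑ j, φ j t x * Dinv (fun s y => φ j s y * ψ s y) t x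

/-- Joint smoothness on the strip of all `(t, x)` with `t ∈ T`. -/
def SmoothOnStrip (T : Set ℝ) (g : ℝ → ℝ → ℝ) : Prop :=
  ContDiffOn ℝ ∞ (fun p : ℝ × ℝ => g p.1 p.2) (T ×ˢ Set.univ)

/-- The Schrödinger equation `ψ_xx + (λ + u) ψ = 0` for `t ∈ T`. -/
def Schrodinger (T : Set ℝ) (u : ℝ → ℝ → ℝ) (lam : ℝ) (ψ : ℝ → ℝ → ℝ) : Prop :=
  ∀ t ∈ T, ∀ x, iteratedDeriv 2 (ψ t) x + (lam + u t x) * ψ t x = 0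

/-- `u, φ_1, …, φ_N` is a (smooth) solution, for `t ∈ T` and `x ∈ ℝ`, of the `n`-th KdV equation
with self-consistent sources:
`u_t = ∂ [-2 b_{n+2} - 2 α ∑ φ_j²]`, `φ_{j,xx} + (λ_j + u) φ_j = 0`. -/
structure IsSolution (n : ℕ) {N : ℕ} (α : ℝ) (lams : Fin N → ℝ) (T : Set ℝ)
    (u : ℝ → ℝ → ℝ) (φ : Fin N → ℝ → ℝ → ℝ) : Prop where
  smooth_u : SmoothOnStrip T u
  smooth_φ : ∀ j, SmoothOnStrip T (φ j)
  evolution : ∀ t ∈ T, ∀ x, deriv (fun s => u s x) t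
    = deriv (fun y => -2 * ev (b (n + 2)) u t y - 2 * α * ∑ j, φ j t y ^ 2) x
  spectral : ∀ j, Schrodinger T u (lams j) (φ j)

/-- `ψ` is a (smooth) solution, for `t ∈ T` and `x ∈ ℝ`, of the linear problem
`ψ_xx + (λ + u) ψ = 0`, `ψ_t = Q^(n,N) ψ`, the integrals in `Q^(n,N) ψ` being convergent. -/
structure IsLaxSolution (n : ℕ) {N : ℕ} (α η : ℝ) (T : Set ℝ)
    (u : ℝ → ℝ → ℝ) (φ : Fin N → ℝ → ℝ → ℝ) (lam : ℝ) (ψ : ℝ → ℝ → ℝ) : Prop where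
  smooth : SmoothOnStrip T ψ
  spectral : Schrodinger T u lam ψ
  integrable : ∀ j, ∀ t ∈ T, ∀ x,
    MeasureTheory.IntegrableOn (fun y => φ j t y * ψ t y) (Set.Iic x)
  evolution : ∀ t ∈ T, ∀ x, deriv (fun s => ψ s x) t = Q n α η u φ lam ψ t x

/-- The product `g h` decays as `x → -∞`: each `∂_x^p g ∂_x^q h` is integrable near `x = -∞`,
with an integrable majorant that is locally uniform in `t ∈ T`. -/
def ProductDecays (T : Set ℝ) (g h : ℝ → ℝ → ℝ) : Prop :=
  ∀ K ⊆ T, IsCompact K → ∀ p q : ℕ, ∃ G : ℝ → ℝ,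
    MeasureTheory.IntegrableOn G (Set.Iic 0) ∧
      ∀ t ∈ K, ∀ x ≤ 0, |iteratedDeriv p (g t) x * iteratedDeriv q (h t) x| ≤ G x

/-- `u` and its `x`-derivatives stay bounded as `x → -∞`, locally uniformly in `t ∈ T`. -/
def BoundedAtNegInfty (T : Set ℝ) (u : ℝ → ℝ → ℝ) : Prop :=
  ∀ K ⊆ T, IsCompact K → ∀ p : ℕ, ∃ C : ℝ, ∀ t ∈ K, ∀ x ≤ 0, |iteratedDeriv p (u t) x| ≤ C

/-! ### The first binary Darboux transformation and its iterates -/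

/-- `ψ ↦ ψ - f / ∂⁻¹(f²) · ∂⁻¹(f ψ)`. -/
noncomputable def binaryDT (f ψ : ℝ → ℝ → ℝ) (t x : ℝ) : ℝ :=
  ψ t x - f t x / Dinv (fun s y => f s y ^ 2) t x * Dinv (fun s y => f s y * ψ s y) t x

/-- `u ↦ u + 2 ∂² ln (∂⁻¹ f²)`. -/
noncomputable def binaryDTPotential (f u : ℝ → ℝ → ℝ) (t x : ℝ) : ℝ :=
  u t x + 2 * iteratedDeriv 2 (fun y => Real.log (Dinv (fun s z => f s z ^ 2) t y)) x

/-- `g[i]`, the result of applying to `g` the transformations with seeds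
`f_1, f_2[1], …, f_i[i-1]` one after the other. The seed `f_{i+1}` is `f i`. -/
noncomputable def iter (f : ℕ → ℝ → ℝ → ℝ) : ℕ → (ℝ → ℝ → ℝ) → ℝ → ℝ → ℝ
  | 0, g => g
  | i + 1, g => binaryDT (iter f i (f i)) (iter f i g)

/-- `u[i]`, the result of applying the same transformations to the potential `u`. -/
noncomputable def iterPotential (f : ℕ → ℝ → ℝ → ℝ) (u : ℝ → ℝ → ℝ) : ℕ → ℝ → ℝ → ℝ
  | 0 => u
  | i + 1 => binaryDTPotential (iter f i (f i)) (iterPotential f u i)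

/-- `W_1(g_1, …, g_k) = det (∂⁻¹(g_i g_j))`. -/
noncomputable def W1 {k : ℕ} (g : Fin k → ℝ → ℝ → ℝ) (t x : ℝ) : ℝ :=
  Matrix.det (Matrix.of fun i j : Fin k => Dinv (fun s y => g i s y * g j s y) t x)

/-- `W_2(g_1, …, g_{k+1}) = det G`, `G_{ij} = ∂⁻¹(g_i g_j)` for `i ≤ k`, and the last row of `G`
is `(g_1, …, g_{k+1})`. -/
noncomputable def W2 {k : ℕ} (g : Fin (k + 1) → ℝ → ℝ → ℝ) (t x : ℝ) : ℝ :=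
  Matrix.det (Matrix.of fun i j : Fin (k + 1) =>
    if i = Fin.last k then g j t x else Dinv (fun s y => g i s y * g j s y) t x)

/-- `W_1(f_1, …, f_m)`. -/
noncomputable def seedW1 (f : ℕ → ℝ → ℝ → ℝ) (m : ℕ) : ℝ → ℝ → ℝ :=
  W1 fun i : Fin m => f i

/-- `W_2(f_1, …, f_m, g)`. -/
noncomputable def seedW2 (f : ℕ → ℝ → ℝ → ℝ) (m : ℕ) (g : ℝ → ℝ → ℝ) : ℝ → ℝ → ℝ :=
  W2 (Fin.snoc (α := fun _ => ℝ → ℝ → ℝ) (fun i : Fin m => f i) g)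

end KdV

open scoped ContDiff

namespace KdV

/-! The proof is an induction on `m` that peels off the first transformation, not the last: by
`iter_succ_eq`, iterating with seeds `f_1, …, f_{m+1}` on `g` is iterating with the `m` seeds
`f_2[1], …, f_{m+1}[1]` on `g[1]`. It remains to see that one step preserves every hypothesis and
that the determinants factor. Write `f` for the first seed, `ξ` for its spectral value, `F = ∂⁻¹ f²`
and `w_g = ∂⁻¹(f g)`.

Determinants. The identity `∂⁻¹(g[1] h[1]) = ∂⁻¹(g h) - w_g w_h / F` (`Seed.om_bdt`) gives exactly
the entries of the Schur complement of the pivot `F` in the Gram matrix. Hence `W_1` and `W_2` are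
`F` times the same determinants of the transformed functions; `F > 0` gives positivity, and `ln W_1`
becomes a sum.

Local algebra. With `z = 1/λ`, the series `R = ∑ b_{k+1} z^k` is the only one with constant term 1
that satisfies `2 z R R'' - z R'² + 4 (1 + z u) R² = 4` (`disc_bSeries`, `disc_unique`). The
Wronskian identity `(ξ - λ) w_ψ = f ψ' - f' ψ` turns `ψ ↦ ψ[1]` into a linear map of `(ψ, ψ')` of
determinant 1, which carries `R` to a solution of the same equation for `u[1]`
(`gauge_disc_binary`). Reading off coefficients yields `b_{n+2}(u[1]) = b_{n+2}(u) - ∂(Ω(f, f) / F)`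
(`jet_b_binary_eq`) and the transformed local flow (`binary_evolution`), where `Ω` is a local
bilinear expression with `∂Ω(f, g) = f A_λ g + g A_ξ f`.

Nonlocal part. Differentiating under the integral gives `∂_t w_g = 2 η w_g + Ω(f, g) + α ∑ ∂⁻¹(φ_j
f) ∂⁻¹(φ_j g)` (`Seed.hasDerivAt_om_t`). With the local formulas, the product rule then gives the
linear problem for `g[1]` (`Seed.flow_bdt`) and the evolution of `u[1]` (`Seed.evolution_bdtPot`).

Analysis at `-∞`. An `L²` estimate bounds `f²` and `f'²` by a multiple of `F` (`sq_le_om`). So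
`f²/F`, `f f'/F`, `f'²/F` are bounded, and they form a system closed under `∂`; thus `u[1]` is
bounded with all its derivatives. Also `|g[1]| + |g[1]'| ≤ C (|g| + |g'|)`, so decay of products is
inherited. For `λ = ξ` the Wronskian carries no information about `w_g`; there `g` is a multiple of
`f` at each time. Joint smoothness of `F` is obtained by a bootstrap. -/

/-! ### The kernel of the total derivative -/

open MvPolynomial in
-- The commutator of two derivations is a derivation, so it is enough to compare both sides on the
-- variables.
theorem pderiv_D_succ (m : ℕ) (p : DiffPoly) :
    pderiv (m + 1) (D p) = D (pderiv (m + 1) p) + pderiv m p := by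
  have h : ⁅(pderiv (m + 1) : Derivation ℝ DiffPoly DiffPoly), D⁆ = pderiv m := by
    refine MvPolynomial.derivation_ext fun i => ?_
    rw [Derivation.commutator_apply, D_X]
    by_cases hi : i = m
    · subst hi
      rw [pderiv_X_self, pderiv_X_self, pderiv_X_of_ne (by omega), map_zero, sub_zero]
    · rw [pderiv_X_of_ne (by omega : i + 1 ≠ m + 1), pderiv_X_of_ne hi]
      by_cases hj : i = m + 1
      · subst hj; rw [pderiv_X_self, Derivation.map_one_eq_zero, sub_zero]
      · rw [pderiv_X_of_ne hj, map_zero, sub_zero]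
  rw [← h, Derivation.commutator_apply]; ring

open MvPolynomial in
/-- A differential polynomial with vanishing total derivative is constant. -/
theorem eq_C_of_D_eq_zero {p : DiffPoly} (h : D p = 0) : p = C (constantCoeff p) := by
  have h1 : ∀ m, pderiv m p = 0 := by
    obtain ⟨n, hn⟩ : ∃ n, ∀ i ∈ p.vars, i < n := by
      refine ⟨p.vars.sup id + 1, fun i hi => Nat.lt_succ_of_le (Finset.le_sup (f := id) hi)⟩
    -- Descending induction on the variable: no index `≥ n` occurs in `p`, and since `D p = 0` the
    -- commutator relation passes vanishing from index `m + 1` to `m`.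
    have h2 : ∀ j m, n ≤ m + j → pderiv m p = 0 := by
      intro j
      induction j with
      | zero =>
        intro m hm
        exact pderiv_eq_zero_of_notMem_vars fun hv => absurd (hn m hv) (by omega)
      | succ j ih =>
        intro m hm
        have h3 := pderiv_D_succ m p
        rw [h, ih (m + 1) (by omega), map_zero, map_zero, zero_add] at h3
        exact h3.symm
    exact fun m => h2 n m (by omega)
  ext s
  rw [coeff_C]
  split_ifs with hs
  · subst hs; rfl
  · obtain ⟨i, hi⟩ : ∃ i, s i ≠ 0 := by
      by_contra! hc
      exact hs (Finsupp.ext fun i => (hc i).symm)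
    -- The coefficient of `∂p/∂u_i` at `s - e_i` is the coefficient of `p` at `s` times `s i ≠ 0`.
    have h4 := coeff_pderiv (i := i) p (s - Finsupp.single i 1)
    rw [h1 i, coeff_zero] at h4
    have h5 : s - Finsupp.single i 1 + Finsupp.single i 1 = s := by
      ext j
      by_cases hj : i = j
      · subst hj; simp; omega
      · simp [hj]
    rw [h5] at h4
    simp only [Finsupp.coe_tsub, Pi.sub_apply, Finsupp.single_eq_same] at h4
    rcases mul_eq_zero.1 h4.symm with h6 | h6
    · exact h6
    · exact absurd h6 (by positivity)

theorem constantCoeff_D (p : DiffPoly) : MvPolynomial.constantCoeff (D p) = 0 := by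
  induction p using MvPolynomial.induction_on with
  | C r => rw [D_C, map_zero]
  | add p q hp hq => rw [map_add, map_add, hp, hq, add_zero]
  | mul_X p i hp => simp [D_X, hp]

/-- This is where the choice of antiderivatives without constant term enters; it fixes the constants
of integration in `disc_bSeries`. -/
theorem constantCoeff_b (k : ℕ) : MvPolynomial.constantCoeff (b (k + 2)) = 0 := by
  rw [b, L]
  simp [constantCoeff_D, (D_formalInt_b k).2]

/-! ### Power series over a differential algebra -/

section PowerSeries

variable {S : Type*} [CommRing S] [Algebra ℝ S] (d : Derivation ℝ S S)

/-- The coefficientwise extension of a derivation to power series. -/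
noncomputable def seriesD : Derivation ℝ (PowerSeries S) (PowerSeries S) :=
  Derivation.mk'
    { toFun := fun p => PowerSeries.mk fun k => d (PowerSeries.coeff k p)
      map_add' := fun p q => by ext k; simp
      map_smul' := fun r p => by ext k; simp }
    (fun p q => by
      ext k
      simp only [LinearMap.coe_mk, AddHom.coe_mk, PowerSeries.coeff_mk, PowerSeries.coeff_mul,
        map_sum, Derivation.leibniz, smul_eq_mul, map_add, Finset.sum_add_distrib]
      congr 1
      rw [← Finset.Nat.sum_antidiagonal_swap]
      simp)

theorem coeff_seriesD (k : ℕ) (p : PowerSeries S) :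
    PowerSeries.coeff k (seriesD d p) = d (PowerSeries.coeff k p) := by
  simp [seriesD]

theorem seriesD_C (s : S) : seriesD d (PowerSeries.C s) = PowerSeries.C (d s) := by
  ext k
  rw [coeff_seriesD, PowerSeries.coeff_C, PowerSeries.coeff_C]
  split_ifs <;> simp

theorem seriesD_map (g : PowerSeries ℝ) :
    seriesD d (PowerSeries.map (algebraMap ℝ S) g) = 0 := by
  ext k
  simp [coeff_seriesD]

theorem seriesD_X : seriesD d (PowerSeries.X) = 0 := by
  have := seriesD_map d PowerSeries.X
  rwa [PowerSeries.map_X] at this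

theorem D_mul' {A : Type*} [CommRing A] [Algebra ℝ A] (δ : Derivation ℝ A A) (p q : A) :
    δ (p * q) = p * δ q + q * δ p := by
  rw [Derivation.leibniz, smul_eq_mul, smul_eq_mul]

theorem D_two {A : Type*} [CommRing A] [Algebra ℝ A] (δ : Derivation ℝ A A) : δ 2 = 0 := by
  rw [← one_add_one_eq_two, map_add, Derivation.map_one_eq_zero, add_zero]

/-- The first integral of the third order equation of the resolvent, normalised by `z = 1 / λ`. -/
noncomputable def disc (u : S) (R : PowerSeries S) : PowerSeries S :=
  2 * PowerSeries.X * R * seriesD d (seriesD d R) - PowerSeries.X * seriesD d R ^ 2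
    + 4 * (PowerSeries.X * PowerSeries.C u + 1) * R ^ 2

theorem dvd_seriesD {k : ℕ} {p : PowerSeries S} (h : PowerSeries.X ^ k ∣ p) :
    PowerSeries.X ^ k ∣ seriesD d p := by
  rw [PowerSeries.X_pow_dvd_iff] at h ⊢
  intro m hm
  rw [coeff_seriesD, h m hm, map_zero]

/-- Apart from terms divisible by `X`, the difference of the two first integrals is `4 (P + R) (P -
R)`, and those terms are `X` times expressions linear in `P - R` and its derivatives. Since `4 (P +
R)` is a unit, divisibility of `P - R` by `X ^ k` improves to `X ^ (k + 1)`. -/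
theorem disc_unique (u : S) {P R : PowerSeries S} (hP : PowerSeries.constantCoeff P = 1)
    (hR : PowerSeries.constantCoeff R = 1) (h : disc d u P = disc d u R) : P = R := by
  have hunit : IsUnit (4 * (P + R)) := by
    rw [PowerSeries.isUnit_iff_constantCoeff]
    simp only [map_mul, map_add, hP, hR, map_ofNat]
    -- The constant term of `4 (P + R)` is 8, invertible in any real algebra.
    have : IsUnit (algebraMap ℝ S 8) := (IsUnit.mk0 (8 : ℝ) (by norm_num)).map (algebraMap ℝ S)
    rw [map_ofNat] at this
    convert this using 1
    norm_num
  have key : ∀ k : ℕ, (PowerSeries.X : PowerSeries S) ^ k ∣ P - R := by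
    intro k
    induction k with
    | zero => simp
    | succ k ih =>
      have h1 := dvd_seriesD d ih
      have h2 := dvd_seriesD d h1
      rw [map_sub] at h1
      rw [map_sub, map_sub] at h2
      have h3 : 4 * (P + R) * (P - R) = -(PowerSeries.X *
          ((P - R) * (2 * seriesD d (seriesD d P) + 4 * PowerSeries.C u * (P + R))
            + (seriesD d (seriesD d P) - seriesD d (seriesD d R)) * (2 * R)
            - (seriesD d P - seriesD d R) * (seriesD d P + seriesD d R))) := by
        unfold disc at h
        linear_combination h
      have h4 : (PowerSeries.X : PowerSeries S) ^ (k + 1) ∣ 4 * (P + R) * (P - R) := by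
        rw [h3, pow_succ', dvd_neg]
        refine mul_dvd_mul_left _ (dvd_sub (dvd_add ?_ ?_) ?_)
        · exact Dvd.dvd.mul_right ih _
        · exact Dvd.dvd.mul_right h2 _
        · exact Dvd.dvd.mul_right h1 _
      exact (hunit.dvd_mul_left).1 h4
  rw [← sub_eq_zero]
  ext k
  rw [(PowerSeries.X_pow_dvd_iff.1 (key (k + 1))) k (Nat.lt_succ_self k), map_zero]

end PowerSeries

/-! ### The generating series of the coefficients -/

/-- The generating series `∑ b_{i+1} z^i`. -/
noncomputable def bSeries : PowerSeries DiffPoly := PowerSeries.mk fun i => b (i + 1)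

/-- The factor `X` is the index shift of the recursion, and the coefficient of `X ^ 0` only says
that `b_1 = 1` is constant. -/
theorem seriesD_bSeries : seriesD D bSeries = PowerSeries.X *
    (-(PowerSeries.C (MvPolynomial.C (1 / 4)) * seriesD D (seriesD D (seriesD D bSeries)))
      - PowerSeries.C (MvPolynomial.X 0) * seriesD D bSeries
      - PowerSeries.C (MvPolynomial.C (1 / 2)) * (PowerSeries.C (MvPolynomial.X 1) * bSeries)) := by
  ext1 k
  cases k with
  | zero =>
    rw [coeff_seriesD, bSeries, PowerSeries.coeff_mk, PowerSeries.coeff_zero_X_mul, b,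
      Derivation.map_one_eq_zero]
  | succ k =>
    rw [coeff_seriesD, PowerSeries.coeff_succ_X_mul]
    simp only [map_sub, map_neg, PowerSeries.coeff_C_mul, coeff_seriesD, bSeries,
      PowerSeries.coeff_mk]
    exact D_b_succ k

/-- The derivative of the left side is `8 R` times the third order equation of `R`, hence zero, so
all coefficients are constants. Their values are found by setting `u` and all its derivatives to
zero, where `R` becomes 1. -/
theorem disc_bSeries : disc D (MvPolynomial.X 0) bSeries = 4 := by
  have h0 : seriesD D (disc D (MvPolynomial.X 0) bSeries) = 0 := by
    have h := seriesD_bSeries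
    have h4 : (PowerSeries.C (MvPolynomial.C (1 / 4)) : PowerSeries DiffPoly) * 4 = 1 := by
      rw [← map_ofNat (PowerSeries.C (R := DiffPoly)) 4, ← map_mul, four_quarter, map_one]
    have h2 : (PowerSeries.C (MvPolynomial.C (1 / 2)) : PowerSeries DiffPoly) * 2 = 1 := by
      rw [← map_ofNat (PowerSeries.C (R := DiffPoly)) 2, ← map_mul, two_half, map_one]
    have h3 : (4 : PowerSeries DiffPoly) = 2 * 2 := by norm_num
    rw [disc, h3]
    simp only [map_add, map_sub, mul_assoc, D_two, D_mul', pow_two, seriesD_X, seriesD_C,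
      Derivation.map_one_eq_zero, D_X, zero_add]
    linear_combination (8 * bSeries) * h
      - 2 * PowerSeries.X * bSeries * seriesD D (seriesD D (seriesD D bSeries)) * h4
      - 4 * PowerSeries.X * bSeries * bSeries * PowerSeries.C (MvPolynomial.X 1) * h2
  have h1 : ∀ k, MvPolynomial.constantCoeff
      (PowerSeries.coeff k (disc D (MvPolynomial.X 0) bSeries))
      = PowerSeries.coeff k (4 : PowerSeries ℝ) := by
    intro k
    rw [← PowerSeries.coeff_map]
    congr 1
    have hb : PowerSeries.map MvPolynomial.constantCoeff bSeries = 1 := by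
      ext k
      rw [PowerSeries.coeff_map, bSeries, PowerSeries.coeff_mk, PowerSeries.coeff_one]
      cases k with
      | zero => simp [b]
      | succ k => rw [constantCoeff_b]; simp
    have hd : ∀ p, PowerSeries.map MvPolynomial.constantCoeff (seriesD D p) = 0 := by
      intro p
      ext k
      rw [PowerSeries.coeff_map, coeff_seriesD, constantCoeff_D, map_zero]
    rw [disc]
    simp only [map_add, map_sub, map_mul, map_pow, hb, hd, PowerSeries.map_X, PowerSeries.map_C,
      MvPolynomial.constantCoeff_X, map_ofNat, map_zero, map_one]
    ring
  ext1 k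
  have h2 : D (PowerSeries.coeff k (disc D (MvPolynomial.X 0) bSeries)) = 0 := by
    rw [← coeff_seriesD, h0, map_zero]
  rw [eq_C_of_D_eq_zero h2, h1, ← map_ofNat (PowerSeries.C (R := ℝ)),
    ← map_ofNat (PowerSeries.C (R := DiffPoly)), PowerSeries.coeff_C, PowerSeries.coeff_C]
  split_ifs
  · exact map_ofNat _ 4
  · exact map_zero _

end KdV

namespace KdV

/-! ### The transformed resolvent -/

section Gauge

variable {A : Type*} [CommRing A] [Algebra ℝ A] (δ : Derivation ℝ A A)

/-- A unimodular gauge transformation `[[a, z β], [e, g]]` that intertwines the Schrödinger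
operators with potentials `u` and `v` preserves the first integral of the resolvent equation. -/
theorem gauge_disc {z u v R σ q a β γ e g : A} (hz : δ z = 0)
    (hR : δ R = 2 * q) (hq : z * δ q = σ - (1 + z * u) * R)
    (hσ : δ σ = -(2 * (1 + z * u) * q)) (ha : δ a = e + β * (1 + z * u)) (hβ : δ β = γ)
    (hg : g = a + z * γ) (he : δ e = γ - v * a + u * g) (hg' : δ g = -((1 + z * v) * β) - e)
    (hdet : a * g - z * β * e = 1) :
    2 * z * (a ^ 2 * R + 2 * z * a * β * q + z * β ^ 2 * σ)
        * δ (δ (a ^ 2 * R + 2 * z * a * β * q + z * β ^ 2 * σ))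
      - z * δ (a ^ 2 * R + 2 * z * a * β * q + z * β ^ 2 * σ) ^ 2
      + 4 * (z * v + 1) * (a ^ 2 * R + 2 * z * a * β * q + z * β ^ 2 * σ) ^ 2
      = 4 * (R * σ - z * q ^ 2) := by
  -- The triple `(R, q, σ)` transforms as a quadratic form: `h1` identifies the new `q`, and `h2`
  -- the new `σ`. The combination `R σ - z q²` is then multiplied by the square of the determinant,
  -- which is 1.
  have h1 : δ (a ^ 2 * R + 2 * z * a * β * q + z * β ^ 2 * σ) =
      2 * (a * e * R + (a * g + z * β * e) * q + β * g * σ) := by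
    simp only [map_add, D_mul', D_two, hz, ha, hβ, pow_two, hR, hσ]
    linear_combination 2 * a * β * hq - 2 * (a * q + β * σ) * hg
  have h2 : z * δ (a * e * R + (a * g + z * β * e) * q + β * g * σ) =
      (z * e ^ 2 * R + 2 * z * e * g * q + g ^ 2 * σ)
      - (1 + z * v) * (a ^ 2 * R + 2 * z * a * β * q + z * β ^ 2 * σ) := by
    simp only [map_add, D_mul', hz, ha, hβ, he, hg', hR, hσ]
    linear_combination (a * g + z * β * e) * hq - (a * R + g * σ + z * β * q + z * q * e) * hg
  rw [h1, D_mul', D_two]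
  linear_combination 4 * (a ^ 2 * R + 2 * z * a * β * q + z * β ^ 2 * σ) * h2
    + 4 * (R * σ - z * q ^ 2) * (a * g - z * β * e + 1) * hdet

/-- Here `z = 1/λ`, `x = ξ`, `y = 1/(1 - ξ z)` and `G = 1/∂⁻¹ f²`. Since `1/(ξ - λ) = -z y`, the
Wronskian form of `∂⁻¹(f ψ)` gives `ψ[1] = a ψ + z β ψ'` with `a = 1 - z y f f' G` and `β = y f² G`;
differentiating gives `ψ[1]' = e ψ + g ψ'`. These are the entries supplied to `gauge_disc`. -/
theorem gauge_disc_binary {z y x u f G R σ q : A} (hz : δ z = 0) (hy : δ y = 0)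
    (hk : y = 1 + x * (z * y)) (hf : δ (δ f) = -((x + u) * f)) (hG : δ G = -(f ^ 2 * G ^ 2))
    (hR : δ R = 2 * q) (hq : z * δ q = σ - (1 + z * u) * R)
    (hσ : δ σ = -(2 * (1 + z * u) * q)) {R' : A}
    (hR' : R' = (1 - z * y * f * δ f * G) ^ 2 * R
      + 2 * z * (1 - z * y * f * δ f * G) * (y * f ^ 2 * G) * q
      + z * (y * f ^ 2 * G) ^ 2 * σ) :
    2 * z * R' * δ (δ R') - z * δ R' ^ 2 + 4 * (z * (u + 2 * δ (f ^ 2 * G)) + 1) * R' ^ 2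
      = 4 * (R * σ - z * q ^ 2) := by
  subst hR'
  have hv : δ (f ^ 2 * G) = 2 * f * δ f * G - f ^ 4 * G ^ 2 := by
    simp only [D_mul', hG, pow_two]
    ring
  refine gauge_disc δ (γ := y * (2 * f * δ f * G - f ^ 4 * G ^ 2))
    (e := -(z * y * δ f * (δ f * G - f ^ 3 * G ^ 2)) - f ^ 2 * G)
    (g := 1 + z * y * f * (δ f * G - f ^ 3 * G ^ 2)) hz hR hq hσ ?_ ?_ ?_ ?_ ?_ ?_
  · simp only [map_sub, D_mul', hz, hy, hf, hG, Derivation.map_one_eq_zero]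
    linear_combination (-(f ^ 2 * G)) * hk
  · simp only [D_mul', hy, hG, pow_two]
    ring
  · ring
  · rw [hv]
    simp only [map_sub, map_neg, D_mul', hz, hy, hf, hG, pow_succ, pow_zero, one_mul]
    linear_combination (-(2 * f * δ f * G - f ^ 4 * G ^ 2)) * hk
  · rw [hv]
    simp only [map_add, map_sub, D_mul', hz, hy, hf, hG, pow_succ, pow_zero, one_mul,
      Derivation.map_one_eq_zero]
    linear_combination (f ^ 2 * G) * hk
  · ring

end Gauge
/-! ### Partial sums of the resolvent and its divided differences -/

/-- `B_n(λ) = ∑_{i ≤ n+1} b_i λ^(n+1-i)`. -/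
noncomputable def BP (lam : ℝ) : ℕ → DiffPoly
  | 0 => 1
  | n + 1 => MvPolynomial.C lam * BP lam n + b (n + 2)

/-- The divided difference of `B_n` at `λ, ξ`. -/
noncomputable def CP (lam xi : ℝ) : ℕ → DiffPoly
  | 0 => 0
  | n + 1 => MvPolynomial.C lam * CP lam xi n + BP xi n

/-- The divided difference of `B_n` at `λ, ξ, ξ`. -/
noncomputable def EP (lam xi : ℝ) : ℕ → DiffPoly
  | 0 => 0
  | n + 1 => MvPolynomial.C lam * EP lam xi n + CP xi xi n

theorem BP_sub (lam xi : ℝ) (n : ℕ) :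
    BP lam n - BP xi n = (MvPolynomial.C lam - MvPolynomial.C xi) * CP lam xi n := by
  induction n with
  | zero => simp [BP, CP]
  | succ n ih => rw [BP, BP, CP]; linear_combination MvPolynomial.C lam * ih

theorem CP_sub (lam xi : ℝ) (n : ℕ) :
    CP lam xi n - CP xi xi n = (MvPolynomial.C lam - MvPolynomial.C xi) * EP lam xi n := by
  induction n with
  | zero => simp [CP, EP]
  | succ n ih => rw [CP, CP, EP]; linear_combination MvPolynomial.C lam * ih

theorem M_add (p q : DiffPoly) : M (p + q) = M p + M q := by
  simp only [M, map_add]; ring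

theorem M_C_mul (r : ℝ) (p : DiffPoly) :
    M (MvPolynomial.C r * p) = MvPolynomial.C r * M p := by
  simp only [M, D_C_mul]; ring

theorem M_b (n : ℕ) : M (b (n + 1)) = D (b (n + 2)) := (D_b_of_exact (M_b_exact n)).symm

/-- `M = ∂ L` sends `b_k` to `∂ b_{k+1}`, so on a truncated sum it acts as `λ ∂` up to one boundary
term. For the divided differences `CP` and `EP` below, the boundary term is the preceding
difference. -/
theorem M_BP (lam : ℝ) (n : ℕ) :
    M (BP lam n) = MvPolynomial.C lam * D (BP lam n) + D (b (n + 2)) := by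
  induction n with
  | zero =>
    have := M_b 0
    rw [b] at this
    rw [BP, this, Derivation.map_one_eq_zero]; simp
  | succ n ih =>
    rw [BP, M_add, M_C_mul, ih, M_b, map_add, D_C_mul]

theorem M_CP (lam xi : ℝ) (n : ℕ) :
    M (CP lam xi n) = D (BP xi n) + MvPolynomial.C lam * D (CP lam xi n) := by
  induction n with
  | zero => simp [CP, BP, M, Derivation.map_one_eq_zero]
  | succ n ih =>
    rw [CP, M_add, M_C_mul, ih, M_BP, BP, map_add, map_add, D_C_mul, D_C_mul]; ring

theorem M_EP (lam xi : ℝ) (n : ℕ) :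
    M (EP lam xi n) = D (CP xi xi n) + MvPolynomial.C lam * D (EP lam xi n) := by
  induction n with
  | zero => simp [EP, CP, M]
  | succ n ih =>
    rw [EP, M_add, M_C_mul, ih, M_CP, CP, map_add, map_add, D_C_mul, D_C_mul]; ring

/-! ### Jets in a differential algebra -/

section Jet

variable {S : Type*} [CommRing S] [Algebra ℝ S] (d : Derivation ℝ S S)

/-- The value of a differential polynomial at an element of a differential algebra. -/
noncomputable def jet (u : S) : DiffPoly →ₐ[ℝ] S := MvPolynomial.aeval fun i => d^[i] u

theorem jet_X (u : S) (i : ℕ) : jet d u (MvPolynomial.X i) = d^[i] u := by simp [jet]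

theorem jet_C (u : S) (r : ℝ) : jet d u (MvPolynomial.C r) = algebraMap ℝ S r := by simp [jet]

theorem D_algebraMap (r : ℝ) : d (algebraMap ℝ S r) = 0 := d.map_algebraMap r

theorem jet_D (u : S) (p : DiffPoly) : jet d u (D p) = d (jet d u p) := by
  induction p using MvPolynomial.induction_on with
  | C r => rw [D_C, map_zero, jet_C, D_algebraMap]
  | add p q hp hq => simp only [map_add, hp, hq]
  | mul_X p i hp =>
    rw [D_mul, D_X, map_mul, D_mul', map_add, map_mul, map_mul, hp, jet_X, jet_X,
      Function.iterate_succ_apply']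

theorem map_jet_seriesD (u : S) (p : PowerSeries DiffPoly) :
    PowerSeries.map (jet d u : DiffPoly →+* S) (seriesD D p)
      = seriesD d (PowerSeries.map (jet d u : DiffPoly →+* S) p) := by
  ext k
  simp [coeff_seriesD, jet_D]

/-- The resolvent series of `u`. -/
noncomputable def resolvent (u : S) : PowerSeries S :=
  PowerSeries.map (jet d u : DiffPoly →+* S) bSeries

theorem coeff_resolvent (u : S) (k : ℕ) :
    PowerSeries.coeff k (resolvent d u) = jet d u (b (k + 1)) := by
  simp [resolvent, bSeries]

theorem constantCoeff_resolvent (u : S) : PowerSeries.constantCoeff (resolvent d u) = 1 := by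
  rw [← PowerSeries.coeff_zero_eq_constantCoeff_apply, coeff_resolvent, b, map_one]

theorem disc_resolvent (u : S) : disc d u (resolvent d u) = 4 := by
  have h := congrArg (PowerSeries.map (jet d u : DiffPoly →+* S)) disc_bSeries
  simp only [disc, map_add, map_sub, map_mul, map_pow, map_jet_seriesD, PowerSeries.map_X,
    PowerSeries.map_C, map_ofNat, map_one] at h
  rw [disc, resolvent]
  simpa [jet_X] using h

theorem seriesD_resolvent (u : S) :
    PowerSeries.X * seriesD d (seriesD d (seriesD d (resolvent d u)))
      = -(4 * seriesD d (resolvent d u))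
        - 4 * PowerSeries.X * PowerSeries.C u * seriesD d (resolvent d u)
        - 2 * PowerSeries.X * PowerSeries.C (d u) * resolvent d u := by
  have h := congrArg (PowerSeries.map (jet d u : DiffPoly →+* S)) seriesD_bSeries
  simp only [map_sub, map_neg, map_mul, map_jet_seriesD, PowerSeries.map_X,
    PowerSeries.map_C] at h
  rw [← resolvent] at h
  have e0 : (jet d u : DiffPoly →+* S) (MvPolynomial.X 0) = u := by simp [jet_X]
  have e1 : (jet d u : DiffPoly →+* S) (MvPolynomial.X 1) = d u := by simp [jet_X]
  have h4 : (PowerSeries.C ((jet d u : DiffPoly →+* S) (MvPolynomial.C (1 / 4))) : PowerSeries S)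
      * 4 = 1 := by
    rw [← map_ofNat (PowerSeries.C (R := S)) 4, ← map_mul, ← map_ofNat (jet d u : DiffPoly →+* S) 4,
      ← map_mul, four_quarter, map_one, map_one]
  have h2 : (PowerSeries.C ((jet d u : DiffPoly →+* S) (MvPolynomial.C (1 / 2))) : PowerSeries S)
      * 2 = 1 := by
    rw [← map_ofNat (PowerSeries.C (R := S)) 2, ← map_mul, ← map_ofNat (jet d u : DiffPoly →+* S) 2,
      ← map_mul, two_half, map_one, map_one]
  rw [e0, e1] at h
  linear_combination 4 * h
    - PowerSeries.X * seriesD d (seriesD d (seriesD d (resolvent d u))) * h4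
    - 2 * PowerSeries.X * PowerSeries.C (d u) * resolvent d u * h2

/-- The series `1 / (1 - ξ z)`. -/
noncomputable def geom (S : Type*) [CommRing S] [Algebra ℝ S] (xi : ℝ) : PowerSeries S :=
  PowerSeries.map (algebraMap ℝ S) (PowerSeries.mk fun i => xi ^ i)

theorem geom_eq (xi : ℝ) : geom S xi =
    1 + PowerSeries.C (algebraMap ℝ S xi) * (PowerSeries.X * geom S xi) := by
  ext k
  cases k with
  | zero => simp [geom]
  | succ k =>
    rw [map_add, PowerSeries.coeff_C_mul, PowerSeries.coeff_succ_X_mul]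
    simp [geom, PowerSeries.coeff_one, pow_succ, mul_comm]

/-- Dividing the resolvent by `1 - ξ z` produces its partial sums at `ξ`; dividing twice, with a
shift by `z`, produces the confluent divided differences. This translates the gauge formula into
coefficients. -/
theorem coeff_geom_mul (u : S) (xi : ℝ) (n : ℕ) :
    PowerSeries.coeff n (geom S xi * resolvent d u) = jet d u (BP xi n) := by
  have h : geom S xi * resolvent d u = resolvent d u
      + PowerSeries.C (algebraMap ℝ S xi) * (PowerSeries.X * (geom S xi * resolvent d u)) := by
    linear_combination resolvent d u * geom_eq (S := S) xi
  induction n with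
  | zero => rw [h]; simp [constantCoeff_resolvent, BP]
  | succ n ih =>
    rw [h, map_add, PowerSeries.coeff_C_mul, PowerSeries.coeff_succ_X_mul, ih, coeff_resolvent,
      BP, map_add, map_mul, jet_C]
    ring

theorem coeff_geom_sq_mul (u : S) (xi : ℝ) (n : ℕ) :
    PowerSeries.coeff n (PowerSeries.X * (geom S xi ^ 2 * resolvent d u))
      = jet d u (CP xi xi n) := by
  have h : PowerSeries.X * (geom S xi ^ 2 * resolvent d u)
      = PowerSeries.X * (geom S xi * resolvent d u) + PowerSeries.C (algebraMap ℝ S xi)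
        * (PowerSeries.X * (PowerSeries.X * (geom S xi ^ 2 * resolvent d u))) := by
    linear_combination PowerSeries.X * geom S xi * resolvent d u * geom_eq (S := S) xi
  induction n with
  | zero => simp [CP]
  | succ n ih =>
    rw [h, map_add, PowerSeries.coeff_C_mul, PowerSeries.coeff_succ_X_mul,
      PowerSeries.coeff_succ_X_mul, ih, coeff_geom_mul, CP, map_add, map_mul, jet_C]
    ring

/-- The coefficients `b_k` of the transformed potential. -/
theorem jet_b_binary {u f G : S} {xi : ℝ} (hf : d (d f) = -((algebraMap ℝ S xi + u) * f))
    (hG : d G = -(f ^ 2 * G ^ 2)) (n : ℕ) :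
    jet d (u + 2 * d (f ^ 2 * G)) (b (n + 2)) = jet d u (b (n + 2))
      + f * G * (f * d (jet d u (BP xi n)) - 2 * d f * jet d u (BP xi n))
      + f ^ 2 * G ^ 2 * (f ^ 2 * (algebraMap ℝ S (1 / 2) * d (d (jet d u (CP xi xi n)))
          + (algebraMap ℝ S xi + u) * jet d u (CP xi xi n) + jet d u (BP xi n))
        - f * d f * d (jet d u (CP xi xi n)) + d f ^ 2 * jet d u (CP xi xi n)) := by
  set R := resolvent d u with hRdef
  set h : PowerSeries S := PowerSeries.C (algebraMap ℝ S (1 / 2)) with hh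
  have h2 : 2 * h = 1 := by
    rw [hh, ← map_ofNat (PowerSeries.C (R := S)) 2, ← map_mul, ← map_ofNat (algebraMap ℝ S) 2,
      ← map_mul]
    norm_num
  have hD : seriesD d h = 0 := by rw [hh, seriesD_C, D_algebraMap, map_zero]
  have hy : seriesD d (geom S xi) = 0 := seriesD_map d _
  have hR3 := seriesD_resolvent d u
  rw [← hRdef] at hR3
  -- The first two equations of the system force `q = R'/2` and `σ = z R''/2 + (1 + z u) R`; the
  -- third is then the equation of the resolvent.
  have key := gauge_disc_binary (seriesD d) (z := PowerSeries.X) (y := geom S xi)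
    (x := PowerSeries.C (algebraMap ℝ S xi)) (u := PowerSeries.C u) (f := PowerSeries.C f)
    (G := PowerSeries.C G) (R := R)
    (σ := h * (PowerSeries.X * seriesD d (seriesD d R)) + (1 + PowerSeries.X * PowerSeries.C u) * R)
    (q := h * seriesD d R) (seriesD_X d) hy (geom_eq xi)
    (by simp only [seriesD_C, hf, map_neg, map_mul, map_add])
    (by simp only [seriesD_C, hG, map_neg, map_mul, map_pow])
    (by linear_combination (-(seriesD d R)) * h2)
    (by rw [D_mul', hD]; ring)
    (by
      simp only [map_add, D_mul', hD, seriesD_X, seriesD_C, Derivation.map_one_eq_zero]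
      linear_combination h * hR3 + (-(PowerSeries.X * PowerSeries.C (d u) * R)
        - (1 + PowerSeries.X * PowerSeries.C u) * seriesD d R) * h2) rfl
  have hdisc : 4 * (R * (h * (PowerSeries.X * seriesD d (seriesD d R))
      + (1 + PowerSeries.X * PowerSeries.C u) * R) - PowerSeries.X * (h * seriesD d R) ^ 2)
      = 4 := by
    have := disc_resolvent d u
    rw [disc, ← hRdef] at this
    linear_combination this + (2 * R * PowerSeries.X * seriesD d (seriesD d R)
      - PowerSeries.X * seriesD d R ^ 2 * (2 * h + 1)) * h2
  rw [hdisc] at key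
  have hD' : (2 * seriesD d (PowerSeries.C f ^ 2 * PowerSeries.C G) : PowerSeries S)
      = PowerSeries.C (2 * d (f ^ 2 * G)) := by
    rw [← map_pow, ← map_mul, seriesD_C, ← map_ofNat (PowerSeries.C (R := S)) 2, ← map_mul]
  rw [hD', ← map_add] at key
  -- The transformed series has constant term 1 and first integral 4, so it is the resolvent of the
  -- new potential.
  have huniq := disc_unique d (u + 2 * d (f ^ 2 * G))
    (constantCoeff_resolvent d (u + 2 * d (f ^ 2 * G))) (R := _) ?_
    ((disc_resolvent d _).trans key.symm)
  · rw [← coeff_resolvent, huniq, ← coeff_resolvent]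
    rw [← hRdef]
    have e : (1 - PowerSeries.X * geom S xi * PowerSeries.C f * seriesD d (PowerSeries.C f)
          * PowerSeries.C G) ^ 2 * R
        + 2 * PowerSeries.X * (1 - PowerSeries.X * geom S xi * PowerSeries.C f
          * seriesD d (PowerSeries.C f) * PowerSeries.C G)
          * (geom S xi * PowerSeries.C f ^ 2 * PowerSeries.C G) * (h * seriesD d R)
        + PowerSeries.X * (geom S xi * PowerSeries.C f ^ 2 * PowerSeries.C G) ^ 2
          * (h * (PowerSeries.X * seriesD d (seriesD d R))
            + (1 + PowerSeries.X * PowerSeries.C u) * R)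
        = R + PowerSeries.C (f ^ 2 * G) * (PowerSeries.X * seriesD d (geom S xi * R))
          - PowerSeries.C (2 * f * d f * G) * (PowerSeries.X * (geom S xi * R))
          + PowerSeries.C (f ^ 2 * d f ^ 2 * G ^ 2) * (PowerSeries.X * (PowerSeries.X * (geom S xi ^ 2 * R)))
          + PowerSeries.C (f ^ 4 * G ^ 2 * u) * (PowerSeries.X * (PowerSeries.X * (geom S xi ^ 2 * R)))
          - PowerSeries.C (f ^ 3 * d f * G ^ 2) * (PowerSeries.X * seriesD d
            (PowerSeries.X * (geom S xi ^ 2 * R)))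
          + PowerSeries.C (f ^ 4 * G ^ 2 * algebraMap ℝ S (1 / 2)) * (PowerSeries.X * seriesD d
            (seriesD d (PowerSeries.X * (geom S xi ^ 2 * R))))
          + PowerSeries.C (f ^ 4 * G ^ 2) * (PowerSeries.X * (geom S xi ^ 2 * R)) := by
      simp only [D_mul', hy, seriesD_C, seriesD_X, map_mul, map_pow, map_ofNat, ← hh,
        pow_two, mul_zero, add_zero]
      linear_combination (PowerSeries.X * (1 - PowerSeries.X * geom S xi * PowerSeries.C f
        * PowerSeries.C (d f) * PowerSeries.C G) * (geom S xi * PowerSeries.C f ^ 2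
        * PowerSeries.C G) * seriesD d R) * h2
    rw [e]
    simp only [map_add, map_sub, PowerSeries.coeff_C_mul, PowerSeries.coeff_succ_X_mul,
      coeff_seriesD, hRdef, coeff_geom_mul, coeff_geom_sq_mul]
    -- One occurrence of the squared geometric series lacks the extra factor `z`; its coefficient is
    -- `C_{n+1}(ξ, ξ) = ξ C_n + B_n`, which supplies the `ξ` and `B_n` terms of the claim.
    have e2 : PowerSeries.coeff (n + 1) (PowerSeries.X * (geom S xi ^ 2 * resolvent d u))
        = jet d u (CP xi xi (n + 1)) := coeff_geom_sq_mul d u xi (n + 1)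
    rw [PowerSeries.coeff_succ_X_mul] at e2
    rw [e2, CP, map_add (jet d u), map_mul (jet d u), jet_C]
    ring
  · simp [constantCoeff_resolvent, hRdef]

end Jet

end KdV

/-! ### The bilinear density and the transformed local flow -/

namespace KdV

section Jet

variable {S : Type*} [CommRing S] [Algebra ℝ S] (d : Derivation ℝ S S)

theorem jet_M_eq {u : S} {p q : DiffPoly} (h : M p = q) :
    d (d (d (jet d u p))) = -(4 * jet d u q) - 4 * u * d (jet d u p) - 2 * d u * jet d u p := by
  have h1 := congrArg (jet d u) h
  simp only [M, map_sub, map_neg, map_mul, jet_D, jet_X, jet_C, Function.iterate_zero, id,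
    Function.iterate_one] at h1
  have h4 : algebraMap ℝ S (1 / 4) * 4 = 1 := by
    rw [← map_ofNat (algebraMap ℝ S) 4, ← map_mul]; norm_num
  have h2 : algebraMap ℝ S (1 / 2) * 2 = 1 := by
    rw [← map_ofNat (algebraMap ℝ S) 2, ← map_mul]; norm_num
  linear_combination (-4) * h1 - d (d (d (jet d u p))) * h4 - 2 * d u * jet d u p * h2

/-- The bilinear local density with `∂ Ω(f, g) = f · A_λ g + g · A_ξ f`. -/
noncomputable def Omega (u : S) (lam xi : ℝ) (n : ℕ) (f g : S) : S :=
  f * g * (algebraMap ℝ S (1 / 2) * d (d (jet d u (CP lam xi n)))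
      + (algebraMap ℝ S lam + u) * jet d u (CP lam xi n) + jet d u (BP xi n))
    - algebraMap ℝ S (1 / 2) * d (jet d u (CP lam xi n)) * (f * d g + g * d f)
    + jet d u (CP lam xi n) * d f * d g

/-- The third derivative of `C_n(λ, ξ)` is eliminated by `M_CP`, and `(λ - ξ) C_n(λ, ξ) = B_n(λ) -
B_n(ξ)` accounts for the asymmetry of the two equations. -/
theorem D_Omega {u f g : S} {lam xi : ℝ} (n : ℕ)
    (hf : d (d f) = -((algebraMap ℝ S xi + u) * f))
    (hg : d (d g) = -((algebraMap ℝ S lam + u) * g)) :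
    d (Omega d u lam xi n f g)
      = f * (jet d u (BP lam n) * d g - algebraMap ℝ S (1 / 2) * d (jet d u (BP lam n)) * g)
        + g * (jet d u (BP xi n) * d f
          - algebraMap ℝ S (1 / 2) * d (jet d u (BP xi n)) * f) := by
  have h3 := jet_M_eq d (u := u) (M_CP lam xi n)
  have hB := congrArg (jet d u) (BP_sub lam xi n)
  have hB' := congrArg d hB
  simp only [map_sub, map_mul, map_add, jet_C, jet_D, D_mul', D_algebraMap] at h3 hB hB'
  have h2 : algebraMap ℝ S (1 / 2) * 2 = 1 := by
    rw [← map_ofNat (algebraMap ℝ S) 2, ← map_mul]; norm_num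
  simp only [Omega, map_add, map_sub, D_mul', D_algebraMap, hf, hg]
  linear_combination f * g * algebraMap ℝ S (1 / 2) * h3
    - (f * d g) * hB + algebraMap ℝ S (1 / 2) * f * g * hB'
    - (f * g * ((algebraMap ℝ S lam + u) * d (jet d u (CP lam xi n))
        + jet d u (CP lam xi n) * d u + d (jet d u (BP xi n)))
      + d (jet d u (CP lam xi n)) * d g * d f) * h2

/-- The change of `b_{n+2}` as a total derivative, the form that cancels against the time derivative
of `∂⁻¹ f²`. -/
theorem jet_b_binary_eq {u f G : S} {xi : ℝ} (hf : d (d f) = -((algebraMap ℝ S xi + u) * f))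
    (hG : d G = -(f ^ 2 * G ^ 2)) (n : ℕ) :
    jet d (u + 2 * d (f ^ 2 * G)) (b (n + 2)) = jet d u (b (n + 2))
      - d (Omega d u xi xi n f f * G) := by
  have h2 : algebraMap ℝ S (1 / 2) * 2 = 1 := by
    rw [← map_ofNat (algebraMap ℝ S) 2, ← map_mul]; norm_num
  rw [jet_b_binary d hf hG, D_mul', D_Omega d n hf hf, hG, Omega]
  linear_combination (f ^ 3 * G ^ 2 * d f * d (jet d u (CP xi xi n))
    - f ^ 2 * G * d (jet d u (BP xi n))) * h2

/-- Both sides obey the recursion `B_{n+1} = λ B_n + b_{n+2}`: the increments of `BP`, `CP`, `EP`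
are exactly the three terms of `jet_b_binary`. -/
theorem jet_BP_binary {u f G : S} {xi : ℝ} (hf : d (d f) = -((algebraMap ℝ S xi + u) * f))
    (hG : d G = -(f ^ 2 * G ^ 2)) (lam : ℝ) (n : ℕ) :
    jet d (u + 2 * d (f ^ 2 * G)) (BP lam n) = jet d u (BP lam n)
      + f * G * (f * d (jet d u (CP lam xi n)) - 2 * d f * jet d u (CP lam xi n))
      + f ^ 2 * G ^ 2 * (f ^ 2 * (algebraMap ℝ S (1 / 2) * d (d (jet d u (EP lam xi n)))
          + (algebraMap ℝ S xi + u) * jet d u (EP lam xi n) + jet d u (CP lam xi n))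
        - f * d f * d (jet d u (EP lam xi n)) + d f ^ 2 * jet d u (EP lam xi n)) := by
  induction n with
  | zero => simp [BP, CP, EP]
  | succ n ih =>
    have h := jet_b_binary d hf hG n
    generalize u + 2 * d (f ^ 2 * G) = v at h ih ⊢
    simp only [BP, CP, EP, map_add, map_mul, jet_C, D_mul', D_algebraMap, mul_zero, add_zero]
    rw [h, ih]
    ring

/-- The spatial part of the transformed linear problem, for the local part of the flow. -/
theorem binary_evolution {u f g G w : S} {lam xi : ℝ}
    (hf : d (d f) = -((algebraMap ℝ S xi + u) * f))
    (hG : d G = -(f ^ 2 * G ^ 2)) (hw : d w = f * g)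
    (hwr : f * d g - d f * g = (algebraMap ℝ S xi - algebraMap ℝ S lam) * w) (n : ℕ) :
    jet d (u + 2 * d (f ^ 2 * G)) (BP lam n) * d (g - f * G * w)
      - algebraMap ℝ S (1 / 2) * d (jet d (u + 2 * d (f ^ 2 * G)) (BP lam n)) * (g - f * G * w)
    = (jet d u (BP lam n) * d g - algebraMap ℝ S (1 / 2) * d (jet d u (BP lam n)) * g)
      - ((jet d u (BP xi n) * d f - algebraMap ℝ S (1 / 2) * d (jet d u (BP xi n)) * f) * G * w
        + f * G * Omega d u lam xi n f g)
      + f * G ^ 2 * w * Omega d u xi xi n f f := by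
  have h2 : algebraMap ℝ S (1 / 2) * 2 = 1 := by
    rw [← map_ofNat (algebraMap ℝ S) 2, ← map_mul]; norm_num
  -- Differentiating the transformed `B_n` brings in the third derivative of `E_n`, which the
  -- resolvent-type equation `M_EP` removes.
  have hE : algebraMap ℝ S (1 / 2) * algebraMap ℝ S (1 / 2) * d (d (d (jet d u (EP lam xi n))))
      = -(jet d u (M (EP lam xi n))) - u * d (jet d u (EP lam xi n))
        - algebraMap ℝ S (1 / 2) * d u * jet d u (EP lam xi n) := by
    have h := jet_M_eq d (u := u) (rfl : M (EP lam xi n) = _)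
    linear_combination algebraMap ℝ S (1 / 2) * algebraMap ℝ S (1 / 2) * h
      - ((jet d u (M (EP lam xi n)) + u * d (jet d u (EP lam xi n)))
          * (2 * algebraMap ℝ S (1 / 2) + 1)
        + algebraMap ℝ S (1 / 2) * d u * jet d u (EP lam xi n)) * h2
  rw [M_EP] at hE
  have hB := congrArg (jet d u) (BP_sub lam xi n)
  have hC := congrArg (jet d u) (CP_sub lam xi n)
  have hB' := congrArg d hB
  have hC' := congrArg d hC
  have hC'' := congrArg d hC'
  simp only [map_sub, map_mul, map_add, jet_C, jet_D, D_mul', D_algebraMap]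
    at hE hB hC hB' hC' hC''
  rw [jet_BP_binary d hf hG]
  simp only [Omega, map_sub, map_add, D_mul', D_two, D_algebraMap, hf, hG, hw, mul_zero,
    add_zero, pow_succ, pow_zero, one_mul]
  -- The differential relations have already been used as rewrite rules. What is left is polynomial
  -- algebra modulo the divided difference relations, their derivatives, the equation for `E_n`, the
  -- Wronskian relation and the value of one half.
  clear hf hG hw
  grind

end Jet

end KdV

namespace KdV

/-! ### The differential algebra of smooth functions -/

/-- The algebra of smooth functions on the line. -/
def SmoothFun : Subalgebra ℝ (ℝ → ℝ) where
  carrier := {g | ContDiff ℝ ∞ g}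
  mul_mem' := fun {_ _} (h1 : ContDiff ℝ ∞ _) (h2 : ContDiff ℝ ∞ _) => h1.mul h2
  add_mem' := fun {_ _} (h1 : ContDiff ℝ ∞ _) (h2 : ContDiff ℝ ∞ _) => h1.add h2
  algebraMap_mem' := fun r => (contDiff_const : ContDiff ℝ ∞ fun _ : ℝ => r)

theorem contDiff_deriv_infty {g : ℝ → ℝ} (h : ContDiff ℝ ∞ g) : ContDiff ℝ ∞ (deriv g) :=
  (contDiff_infty_iff_deriv.1 h).2

theorem hasDerivAt_of_smooth {g : ℝ → ℝ} (h : ContDiff ℝ ∞ g) (x : ℝ) :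
    HasDerivAt g (deriv g x) x :=
  ((contDiff_infty_iff_deriv.1 h).1 x).hasDerivAt

/-- Differentiation of smooth functions. -/
noncomputable def smoothD : Derivation ℝ SmoothFun SmoothFun :=
  Derivation.mk'
    { toFun := fun g => ⟨deriv g.1, contDiff_deriv_infty g.2⟩
      map_add' := fun g h => Subtype.ext <| funext fun x =>
        ((hasDerivAt_of_smooth g.2 x).add (hasDerivAt_of_smooth h.2 x)).deriv
      map_smul' := fun r g => Subtype.ext <| funext fun x =>
        ((hasDerivAt_of_smooth g.2 x).const_smul r).deriv }
    (fun g h => Subtype.ext <| funext fun x => by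
      have := ((hasDerivAt_of_smooth g.2 x).mul (hasDerivAt_of_smooth h.2 x)).deriv
      refine this.trans ?_
      change _ = g.1 x * deriv h.1 x + h.1 x * deriv g.1 x
      ring)

theorem coe_smoothD (g : SmoothFun) : ((smoothD g : SmoothFun) : ℝ → ℝ) = deriv g.1 := rfl

theorem coe_iterate_smoothD (g : SmoothFun) (i : ℕ) :
    ((smoothD^[i] g : SmoothFun) : ℝ → ℝ) = iteratedDeriv i g.1 := by
  induction i with
  | zero => rfl
  | succ i ih => rw [Function.iterate_succ_apply', coe_smoothD, ih, iteratedDeriv_succ]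

/-- The value at `x` of the differential polynomial `p` in the function `w`. -/
noncomputable def evf (p : DiffPoly) (w : ℝ → ℝ) (x : ℝ) : ℝ :=
  MvPolynomial.eval (fun i => iteratedDeriv i w x) p

theorem coe_jet (w : SmoothFun) (p : DiffPoly) :
    ((jet smoothD w p : SmoothFun) : ℝ → ℝ) = evf p w.1 := by
  funext x
  induction p using MvPolynomial.induction_on with
  | C r => rw [jet_C, evf, MvPolynomial.eval_C]; rfl
  | add p q hp hq =>
    rw [map_add, evf, map_add, ← evf, ← evf, ← hp, ← hq]; rfl
  | mul_X p i hp =>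
    rw [map_mul, evf, map_mul, ← evf, ← hp, jet_X, MvPolynomial.eval_X, ← coe_iterate_smoothD]; rfl

theorem contDiff_evf {w : ℝ → ℝ} (hw : ContDiff ℝ ∞ w) (p : DiffPoly) :
    ContDiff ℝ ∞ (evf p w) := by
  have := (jet smoothD ⟨w, hw⟩ p).2
  rwa [coe_jet] at this

theorem deriv_evf {w : ℝ → ℝ} (hw : ContDiff ℝ ∞ w) (p : DiffPoly) :
    deriv (evf p w) = evf (D p) w := by
  have h := jet_D smoothD ⟨w, hw⟩ p
  have h' := congrArg (Subtype.val) h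
  rw [coe_smoothD, coe_jet, coe_jet] at h'
  exact h'.symm

theorem hasDerivAt_evf {w : ℝ → ℝ} (hw : ContDiff ℝ ∞ w) (p : DiffPoly) (x : ℝ) :
    HasDerivAt (evf p w) (evf (D p) w x) x := by
  rw [← deriv_evf hw]
  exact hasDerivAt_of_smooth (contDiff_evf hw p) x

/-- The local part of the time evolution of a solution of the linear problem. -/
noncomputable def locA (n : ℕ) (u : ℝ → ℝ) (lam : ℝ) (g : ℝ → ℝ) (x : ℝ) : ℝ :=
  evf (BP lam n) u x * deriv g x - 1 / 2 * evf (D (BP lam n)) u x * g x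

/-- The bilinear local density with `∂ Ω(f, g) = f · A_λ g + g · A_ξ f`. -/
noncomputable def omegaF (n : ℕ) (u : ℝ → ℝ) (lam xi : ℝ) (f g : ℝ → ℝ) (x : ℝ) : ℝ :=
  f x * g x * (1 / 2 * evf (D (D (CP lam xi n))) u x
      + (lam + u x) * evf (CP lam xi n) u x + evf (BP xi n) u x)
    - 1 / 2 * evf (D (CP lam xi n)) u x * (f x * deriv g x + g x * deriv f x)
    + evf (CP lam xi n) u x * deriv f x * deriv g x

/-- The recursive form agrees with the sum in `A`; the additional term `i = 0` is harmless because
`b_0 = 0`. -/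
theorem BP_eq_sum (lam : ℝ) (n : ℕ) :
    BP lam n = ∑ i ∈ Finset.range (n + 2), MvPolynomial.C (lam ^ (n + 1 - i)) * b i := by
  induction n with
  | zero => simp [Finset.sum_range_succ, b, BP]
  | succ n ih =>
    rw [BP, ih, Finset.sum_range_succ _ (n + 2), Finset.mul_sum]
    congr 1
    · refine Finset.sum_congr rfl fun i hi => ?_
      have : n + 1 + 1 - i = n + 1 - i + 1 := by
        have := Finset.mem_range.1 hi; omega
      rw [this, pow_succ', map_mul, mul_assoc]
    · simp

theorem A_eq_locA (n : ℕ) (u : ℝ → ℝ → ℝ) (lam : ℝ) (ψ : ℝ → ℝ → ℝ) (t x : ℝ) :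
    A n u lam ψ t x = locA n (u t) lam (ψ t) x := by
  rw [A, locA, BP_eq_sum]
  simp only [evf, map_sum, map_mul, D_C_mul, MvPolynomial.eval_C, Finset.sum_mul, Finset.mul_sum,
    ← Finset.sum_sub_distrib, ev, a, map_neg]
  exact Finset.sum_congr rfl fun i _ => by ring

section Fixed

variable {n : ℕ} {u f g G w : ℝ → ℝ} {lam xi : ℝ}

theorem smoothD_schrodinger (hu : ContDiff ℝ ∞ u) (hf : ContDiff ℝ ∞ f)
    (hfs : ∀ x, deriv (deriv f) x = -((xi + u x) * f x)) :
    smoothD (smoothD ⟨f, hf⟩)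
      = -((algebraMap ℝ SmoothFun xi + ⟨u, hu⟩) * (⟨f, hf⟩ : SmoothFun)) :=
  Subtype.ext <| funext fun x => hfs x

theorem coe_Omega (hu : ContDiff ℝ ∞ u) (hf : ContDiff ℝ ∞ f) (hg : ContDiff ℝ ∞ g) :
    ((Omega smoothD (⟨u, hu⟩ : SmoothFun) lam xi n ⟨f, hf⟩ ⟨g, hg⟩ : SmoothFun) : ℝ → ℝ)
      = omegaF n u lam xi f g := by
  funext x
  rw [Omega, ← jet_D, ← jet_D]
  simp only [Subalgebra.coe_add, Subalgebra.coe_sub, Subalgebra.coe_mul, coe_jet, Pi.add_apply,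
    Pi.sub_apply, Pi.mul_apply]
  rfl

theorem contDiff_omegaF (hu : ContDiff ℝ ∞ u) (hf : ContDiff ℝ ∞ f) (hg : ContDiff ℝ ∞ g) :
    ContDiff ℝ ∞ (omegaF n u lam xi f g) := by
  have := (Omega smoothD (⟨u, hu⟩ : SmoothFun) lam xi n ⟨f, hf⟩ ⟨g, hg⟩ : SmoothFun).2
  rwa [coe_Omega] at this

theorem coe_locA (hu : ContDiff ℝ ∞ u) (hg : ContDiff ℝ ∞ g) :
    ((jet smoothD (⟨u, hu⟩ : SmoothFun) (BP lam n) * smoothD ⟨g, hg⟩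
      - algebraMap ℝ SmoothFun (1 / 2) * smoothD (jet smoothD (⟨u, hu⟩ : SmoothFun) (BP lam n))
        * ⟨g, hg⟩ : SmoothFun) : ℝ → ℝ) = locA n u lam g := by
  funext x
  rw [← jet_D]
  simp only [Subalgebra.coe_sub, Subalgebra.coe_mul, coe_jet, Pi.sub_apply, Pi.mul_apply]
  rfl

theorem hasDerivAt_omegaF (hu : ContDiff ℝ ∞ u) (hf : ContDiff ℝ ∞ f) (hg : ContDiff ℝ ∞ g)
    (hfs : ∀ x, deriv (deriv f) x = -((xi + u x) * f x))
    (hgs : ∀ x, deriv (deriv g) x = -((lam + u x) * g x)) (x : ℝ) :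
    HasDerivAt (omegaF n u lam xi f g)
      (f x * locA n u lam g x + g x * locA n u xi f x) x := by
  have h := congrArg Subtype.val (D_Omega smoothD n (smoothD_schrodinger hu hf hfs)
    (smoothD_schrodinger hu hg hgs))
  rw [coe_smoothD, coe_Omega, Subalgebra.coe_add, Subalgebra.coe_mul, Subalgebra.coe_mul,
    coe_locA, coe_locA] at h
  have h' := hasDerivAt_of_smooth (contDiff_omegaF hu hf hg (lam := lam) (xi := xi) (n := n)) x
  rw [h] at h'
  exact h'

theorem evf_b_binary (hu : ContDiff ℝ ∞ u) (hf : ContDiff ℝ ∞ f) (hG : ContDiff ℝ ∞ G)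
    (hfs : ∀ x, deriv (deriv f) x = -((xi + u x) * f x))
    (hGd : ∀ x, deriv G x = -(f x ^ 2 * G x ^ 2)) (x : ℝ) :
    evf (b (n + 2)) (fun y => u y + 2 * deriv (fun z => f z ^ 2 * G z) y) x
      = evf (b (n + 2)) u x - deriv (fun y => omegaF n u xi xi f f y * G y) x := by
  have h := congrArg (fun s : SmoothFun => s.1 x)
    (jet_b_binary_eq smoothD (G := ⟨G, hG⟩) (smoothD_schrodinger hu hf hfs)
    (Subtype.ext <| funext fun x => hGd x) n)
  simp only [coe_jet] at h
  refine h.trans ?_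
  rw [Subalgebra.coe_sub, coe_jet, coe_smoothD, Subalgebra.coe_mul, coe_Omega]
  rfl

theorem locA_binary (hu : ContDiff ℝ ∞ u) (hf : ContDiff ℝ ∞ f) (hG : ContDiff ℝ ∞ G)
    (hg : ContDiff ℝ ∞ g) (hw : ContDiff ℝ ∞ w)
    (hfs : ∀ x, deriv (deriv f) x = -((xi + u x) * f x))
    (hGd : ∀ x, deriv G x = -(f x ^ 2 * G x ^ 2)) (hwd : ∀ x, deriv w x = f x * g x)
    (hwr : ∀ x, f x * deriv g x - deriv f x * g x = (xi - lam) * w x) (x : ℝ) :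
    locA n (fun y => u y + 2 * deriv (fun z => f z ^ 2 * G z) y) lam
        (fun y => g y - f y * G y * w y) x
      = locA n u lam g x - (locA n u xi f x * G x * w x + f x * G x * omegaF n u lam xi f g x)
        + f x * G x ^ 2 * w x * omegaF n u xi xi f f x := by
  have h := congrArg (fun s : SmoothFun => s.1 x)
    (binary_evolution smoothD (G := ⟨G, hG⟩) (g := ⟨g, hg⟩) (w := ⟨w, hw⟩) (lam := lam)
      (smoothD_schrodinger hu hf hfs)
      (Subtype.ext <| funext fun x => hGd x) (Subtype.ext <| funext fun x => hwd x)
      (Subtype.ext <| funext fun x => hwr x) n)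
  have e := coe_locA (n := n) (lam := lam)
    (⟨u, hu⟩ + 2 * smoothD (⟨f, hf⟩ ^ 2 * ⟨G, hG⟩) : SmoothFun).2
    ((⟨g, hg⟩ - ⟨f, hf⟩ * ⟨G, hG⟩ * ⟨w, hw⟩ : SmoothFun)).2
  refine (congrFun e x).symm.trans (h.trans ?_)
  rw [Subalgebra.coe_add, Subalgebra.coe_sub, Subalgebra.coe_add, Subalgebra.coe_mul,
    Subalgebra.coe_mul, Subalgebra.coe_mul, Subalgebra.coe_mul, Subalgebra.coe_mul, coe_locA,
    coe_locA, coe_Omega, coe_Omega]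
  rfl

end Fixed

end KdV

namespace KdV

open Set Filter Topology

/-! ### Calculus on the strip -/

theorem one_le_infty : (1 : WithTop ℕ∞) ≤ ∞ := by exact_mod_cast le_top

/-- Joint `C^k` regularity on the strip. -/
def StripC (k : WithTop ℕ∞) (T : Set ℝ) (g : ℝ → ℝ → ℝ) : Prop :=
  ContDiffOn ℝ k (fun p : ℝ × ℝ => g p.1 p.2) (T ×ˢ univ)

theorem isOpen_strip {T : Set ℝ} (hT : IsOpen T) : IsOpen (T ×ˢ (univ : Set ℝ)) :=
  hT.prod isOpen_univ

theorem hasDerivAt_clm_apply {Φ : ℝ × ℝ → (ℝ × ℝ →L[ℝ] ℝ)} {A : ℝ × ℝ →L[ℝ] (ℝ × ℝ →L[ℝ] ℝ)}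
    {c : ℝ → ℝ × ℝ} {c' : ℝ × ℝ} {s : ℝ} (h : HasFDerivAt Φ A (c s)) (hc : HasDerivAt c c' s)
    (v : ℝ × ℝ) : HasDerivAt (fun r => Φ (c r) v) (A c' v) s := by
  simpa using (h.comp_hasDerivAt s hc).clm_apply (hasDerivAt_const s v)

namespace StripC

variable {k : WithTop ℕ∞} {T : Set ℝ} {g h : ℝ → ℝ → ℝ}

theorem contDiffAt (hg : StripC k T g) (hT : IsOpen T) {t : ℝ} (ht : t ∈ T) (x : ℝ) :
    ContDiffAt ℝ k (fun p : ℝ × ℝ => g p.1 p.2) (t, x) :=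
  ContDiffOn.contDiffAt hg ((isOpen_strip hT).mem_nhds ⟨ht, mem_univ x⟩)

theorem of_contDiffAt (hg : ∀ t ∈ T, ∀ x, ContDiffAt ℝ k (fun p : ℝ × ℝ => g p.1 p.2) (t, x)) :
    StripC k T g := fun p hp => (hg p.1 hp.1 p.2).contDiffWithinAt

theorem congr (hg : StripC k T g) (e : ∀ t ∈ T, ∀ x, h t x = g t x) : StripC k T h :=
  ContDiffOn.congr hg fun p hp => e p.1 hp.1 p.2

theorem const (c : ℝ) : StripC k T fun _ _ => c := contDiffOn_const

theorem add (hg : StripC k T g) (hh : StripC k T h) : StripC k T fun t x => g t x + h t x :=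
  ContDiffOn.add hg hh

theorem sub (hg : StripC k T g) (hh : StripC k T h) : StripC k T fun t x => g t x - h t x :=
  ContDiffOn.sub hg hh

theorem mul (hg : StripC k T g) (hh : StripC k T h) : StripC k T fun t x => g t x * h t x :=
  ContDiffOn.mul hg hh

theorem pow (hg : StripC k T g) (m : ℕ) : StripC k T fun t x => g t x ^ m :=
  ContDiffOn.pow hg m

theorem inv (hg : StripC k T g) (h0 : ∀ t ∈ T, ∀ x, g t x ≠ 0) : StripC k T fun t x => (g t x)⁻¹ :=
  ContDiffOn.inv hg fun p hp => h0 p.1 hp.1 p.2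

theorem sum {ι : Type*} {s : Finset ι} {g : ι → ℝ → ℝ → ℝ} (hg : ∀ i ∈ s, StripC k T (g i)) :
    StripC k T fun t x => ∑ i ∈ s, g i t x :=
  ContDiffOn.sum hg

theorem of_le {l : WithTop ℕ∞} (hg : StripC k T g) (hl : l ≤ k) : StripC l T g :=
  ContDiffOn.of_le hg hl

theorem contDiff_x (hg : StripC k T g) {t : ℝ} (ht : t ∈ T) : ContDiff ℝ k (g t) := by
  have h1 : ContDiff ℝ k fun x : ℝ => (t, x) := contDiff_const.prodMk contDiff_id
  have h2 := ContDiffOn.comp hg h1.contDiffOn (s := univ) fun x _ => ⟨ht, mem_univ x⟩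
  exact contDiffOn_univ.1 h2

theorem contDiffAt_t (hg : StripC k T g) (hT : IsOpen T) {t : ℝ} (ht : t ∈ T) (x : ℝ) :
    ContDiffAt ℝ k (fun s => g s x) t := by
  have h1 : ContDiffAt ℝ k (fun s : ℝ => (s, x)) t := contDiffAt_id.prodMk contDiffAt_const
  exact (hg.contDiffAt hT ht x).comp t h1

theorem continuousOn (hg : StripC k T g) : ContinuousOn (fun p : ℝ × ℝ => g p.1 p.2) (T ×ˢ univ) :=
  ContDiffOn.continuousOn hg

theorem deriv_x_eq (hg : StripC k T g) (hk : 1 ≤ k) (hT : IsOpen T) {t : ℝ} (ht : t ∈ T) (x : ℝ) :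
    deriv (g t) x = fderiv ℝ (fun p : ℝ × ℝ => g p.1 p.2) (t, x) (0, 1) := by
  have h1 := ((hg.contDiffAt hT ht x).differentiableAt (by positivity)).hasFDerivAt
  have h2 : HasDerivAt (fun y : ℝ => (t, y)) (0, 1) x :=
    (hasDerivAt_const x t).prodMk (hasDerivAt_id x)
  exact (h1.comp_hasDerivAt x h2).deriv

theorem deriv_t_eq (hg : StripC k T g) (hk : 1 ≤ k) (hT : IsOpen T) {t : ℝ} (ht : t ∈ T) (x : ℝ) :
    deriv (fun s => g s x) t = fderiv ℝ (fun p : ℝ × ℝ => g p.1 p.2) (t, x) (1, 0) := by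
  have h1 := ((hg.contDiffAt hT ht x).differentiableAt (by positivity)).hasFDerivAt
  have h2 : HasDerivAt (fun s : ℝ => (s, x)) (1, 0) t :=
    (hasDerivAt_id t).prodMk (hasDerivAt_const t x)
  exact (h1.comp_hasDerivAt t h2).deriv

theorem fderiv_apply (hg : StripC ∞ T g) (hT : IsOpen T) (v : ℝ × ℝ) :
    StripC ∞ T fun t x => fderiv ℝ (fun p : ℝ × ℝ => g p.1 p.2) (t, x) v := by
  have h1 := ContDiffOn.fderiv_of_isOpen hg (isOpen_strip hT) (m := ∞) le_rfl
  exact ContDiffOn.clm_apply h1 contDiffOn_const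

theorem deriv_x (hg : StripC ∞ T g) (hT : IsOpen T) : StripC ∞ T fun t x => deriv (g t) x :=
  (hg.fderiv_apply hT (0, 1)).congr fun _ ht x => hg.deriv_x_eq one_le_infty hT ht x

theorem deriv_t (hg : StripC ∞ T g) (hT : IsOpen T) :
    StripC ∞ T fun t x => deriv (fun s => g s x) t :=
  (hg.fderiv_apply hT (1, 0)).congr fun _ ht x => hg.deriv_t_eq one_le_infty hT ht x

theorem hasDerivAt_x (hg : StripC ∞ T g) {t : ℝ} (ht : t ∈ T) (x : ℝ) :
    HasDerivAt (g t) (deriv (g t) x) x :=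
  hasDerivAt_of_smooth (hg.contDiff_x ht) x

theorem hasDerivAt_t (hg : StripC ∞ T g) (hT : IsOpen T) {t : ℝ} (ht : t ∈ T) (x : ℝ) :
    HasDerivAt (fun s => g s x) (deriv (fun s => g s x) t) t :=
  ((hg.contDiffAt_t hT ht x).differentiableAt (by simp)).hasDerivAt

theorem iteratedDeriv_x (hg : StripC ∞ T g) (hT : IsOpen T) (i : ℕ) :
    StripC ∞ T fun t x => iteratedDeriv i (g t) x := by
  induction i with
  | zero => simpa using hg
  | succ i ih => exact (ih.deriv_x hT).congr fun t _ x => by rw [iteratedDeriv_succ]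

theorem evf (hg : StripC ∞ T g) (hT : IsOpen T) (p : DiffPoly) :
    StripC ∞ T fun t x => evf p (g t) x := by
  unfold KdV.evf
  induction p using MvPolynomial.induction_on with
  | C r => simpa using const r
  | add p q hp hq => simpa using hp.add hq
  | mul_X p i hp => simpa using hp.mul (hg.iteratedDeriv_x hT i)

theorem omegaF (n : ℕ) (lam xi : ℝ) {u : ℝ → ℝ → ℝ} (hu : StripC ∞ T u) (hg : StripC ∞ T g)
    (hh : StripC ∞ T h) (hT : IsOpen T) :
    StripC ∞ T fun t x => omegaF n (u t) lam xi (g t) (h t) x := by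
  unfold KdV.omegaF
  exact (((hg.mul hh).mul ((((const (1 / 2)).mul (hu.evf hT _)).add
    (((const lam).add hu).mul (hu.evf hT _))).add (hu.evf hT _))).sub
    (((const (1 / 2)).mul (hu.evf hT _)).mul ((hg.mul (hh.deriv_x hT)).add
      (hh.mul (hg.deriv_x hT))))).add (((hu.evf hT _).mul (hg.deriv_x hT)).mul (hh.deriv_x hT))

/-- Mixed partial derivatives commute. -/
theorem deriv_comm (hg : StripC ∞ T g) (hT : IsOpen T) {t : ℝ} (ht : t ∈ T) (x : ℝ) :
    deriv (fun s => deriv (g s) x) t = deriv (fun y => deriv (fun s => g s y) t) x := by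
  have h1 := hg.contDiffAt hT ht x
  have hsymm := h1.isSymmSndFDerivAt (by simp; norm_cast)
  have hd : DifferentiableAt ℝ (fderiv ℝ (fun p : ℝ × ℝ => g p.1 p.2)) (t, x) :=
    (h1.fderiv_right (m := 1) (by norm_cast)).differentiableAt (by norm_num)
  have e1 : deriv (fun s => deriv (g s) x) t
      = fderiv ℝ (fderiv ℝ (fun p : ℝ × ℝ => g p.1 p.2)) (t, x) (1, 0) (0, 1) := by
    have h2 : HasDerivAt (fun s : ℝ => (s, x)) (1, 0) t :=
      (hasDerivAt_id t).prodMk (hasDerivAt_const t x)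
    have h3 := hasDerivAt_clm_apply (c := fun s : ℝ => (s, x)) hd.hasFDerivAt h2 (0, 1)
    have h4 : (fun s => deriv (g s) x) =ᶠ[𝓝 t]
        fun s => fderiv ℝ (fun p : ℝ × ℝ => g p.1 p.2) (s, x) (0, 1) := by
      filter_upwards [hT.mem_nhds ht] with s hs
      exact hg.deriv_x_eq one_le_infty hT hs x
    rw [h4.deriv_eq]
    exact h3.deriv
  have e2 : deriv (fun y => deriv (fun s => g s y) t) x
      = fderiv ℝ (fderiv ℝ (fun p : ℝ × ℝ => g p.1 p.2)) (t, x) (0, 1) (1, 0) := by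
    have h2 : HasDerivAt (fun y : ℝ => (t, y)) (0, 1) x :=
      (hasDerivAt_const x t).prodMk (hasDerivAt_id x)
    have h3 := hasDerivAt_clm_apply (c := fun y : ℝ => (t, y)) hd.hasFDerivAt h2 (1, 0)
    have h4 : (fun y => deriv (fun s => g s y) t) =
        fun y => fderiv ℝ (fun p : ℝ × ℝ => g p.1 p.2) (t, y) (1, 0) :=
      funext fun y => hg.deriv_t_eq one_le_infty hT ht y
    rw [h4]
    exact h3.deriv
  rw [e1, e2]
  exact hsymm _ _

/-- A function with `C^k` partial derivatives is `C^(k+1)`. -/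
theorem succ_of_partial {k : ℕ} {P Q : ℝ → ℝ → ℝ} (hT : IsOpen T)
    (h1 : ∀ t ∈ T, ∀ x, HasDerivAt (fun s => g s x) (P t x) t)
    (h2 : ∀ t ∈ T, ∀ x, HasDerivAt (g t) (Q t x) x)
    (hP : StripC k T P) (hQ : StripC k T Q) : StripC (k + 1 : ℕ) T g := by
  have hF : ∀ p ∈ T ×ˢ (univ : Set ℝ), HasFDerivAt (fun p : ℝ × ℝ => g p.1 p.2)
      ((ContinuousLinearMap.toSpanSingleton ℝ (P p.1 p.2)).coprod
        (ContinuousLinearMap.toSpanSingleton ℝ (Q p.1 p.2))) p := by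
    intro p hp
    have hc : Continuous fun c : ℝ => ContinuousLinearMap.toSpanSingleton ℝ c :=
      (ContinuousLinearMap.toSpanSingletonCLE (𝕜 := ℝ) (E := ℝ)).continuous
    have hev := (isOpen_strip hT).mem_nhds hp
    have := hasStrictFDerivAt_uncurry_coprod (𝕜 := ℝ) (u := p) (f := g)
      (f₁ := fun t x => ContinuousLinearMap.toSpanSingleton ℝ (P t x))
      (f₂ := fun t x => ContinuousLinearMap.toSpanSingleton ℝ (Q t x))
      (by filter_upwards [hev] with v hv; exact (h1 v.1 hv.1 v.2).hasFDerivAt)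
      (by filter_upwards [hev] with v hv; exact (h2 v.1 hv.1 v.2).hasFDerivAt)
      (hc.continuousAt.comp (hP.continuousOn.continuousAt hev))
      (hc.continuousAt.comp (hQ.continuousOn.continuousAt hev))
    exact this.hasFDerivAt
  have hc : ContDiff ℝ k fun c : ℝ × ℝ => (ContinuousLinearMap.toSpanSingleton ℝ c.1).coprod
      (ContinuousLinearMap.toSpanSingleton ℝ c.2) := by
    have e : (fun c : ℝ × ℝ => (ContinuousLinearMap.toSpanSingleton ℝ c.1).coprod
      (ContinuousLinearMap.toSpanSingleton ℝ c.2)) = fun c => c.1 • ContinuousLinearMap.fst ℝ ℝ ℝ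
        + c.2 • ContinuousLinearMap.snd ℝ ℝ ℝ := by
      funext c
      ext <;> simp
    rw [e]
    exact (contDiff_fst.smul contDiff_const).add (contDiff_snd.smul contDiff_const)
  unfold StripC
  rw [Nat.cast_add, Nat.cast_one, contDiffOn_succ_iff_fderiv_of_isOpen (isOpen_strip hT)]
  refine ⟨fun p hp => (hF p hp).differentiableAt.differentiableWithinAt, by simp, ?_⟩
  refine (hc.comp_contDiffOn (ContDiffOn.prodMk hP hQ)).congr fun p hp => ?_
  exact (hF p hp).fderiv

/-- Joint continuity from a locally bounded partial derivative in `x` and continuity in `t`. -/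
theorem zero_of_partial {Q : ℝ → ℝ → ℝ} (hT : IsOpen T)
    (h1 : ∀ t ∈ T, ∀ x, ContinuousAt (fun s => g s x) t)
    (h2 : ∀ t ∈ T, ∀ x, HasDerivAt (g t) (Q t x) x)
    (hQ : StripC 0 T Q) : StripC 0 T g := by
  refine of_contDiffAt fun t ht x => ?_
  have hcont : ContinuousAt (fun p : ℝ × ℝ => Q p.1 p.2) (t, x) :=
    hQ.continuousOn.continuousAt ((isOpen_strip hT).mem_nhds ⟨ht, mem_univ x⟩)
  have hb : ∀ᶠ p : ℝ × ℝ in 𝓝 (t, x), ‖Q p.1 p.2‖ < ‖Q t x‖ + 1 ∧ p.1 ∈ T :=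
    (hcont.norm.eventually_lt continuousAt_const (by simp)).and
      (continuousAt_fst.eventually (hT.mem_nhds ht))
  obtain ⟨ε, hε, hball⟩ := Metric.eventually_nhds_iff_ball.1 hb
  have hmem : ∀ s ∈ Metric.ball t ε, ∀ y ∈ Metric.ball x ε, ‖Q s y‖ < ‖Q t x‖ + 1 ∧ s ∈ T := by
    intro s hs y hy
    exact hball (s, y) (by rw [← ball_prod_same]; exact ⟨hs, hy⟩)
  -- Near `(t, x)` the bound on `Q` makes `g s` Lipschitz with a constant independent of `s`; with
  -- continuity in time this gives joint continuity.
  have hlip : ContinuousOn (fun p : ℝ × ℝ => g p.1 p.2) (Metric.ball t ε ×ˢ Metric.ball x ε) := by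
    refine continuousOn_prod_of_continuousOn_lipschitzOnWith' _ ⟨‖Q t x‖ + 1, by positivity⟩ ?_ ?_
    · intro s hs
      refine Convex.lipschitzOnWith_of_nnnorm_hasDerivWithin_le (convex_ball x ε)
        (fun y hy => (h2 s (hmem s hs y hy).2 y).hasDerivWithinAt) fun y hy => ?_
      exact (hmem s hs y hy).1.le
    · intro y hy s hs
      exact (h1 s (hmem s hs y hy).2 y).continuousWithinAt
  have hopen : IsOpen (Metric.ball t ε ×ˢ Metric.ball x ε) := Metric.isOpen_ball.prod Metric.isOpen_ball
  refine contDiffOn_zero.2 hlip |>.contDiffAt (hopen.mem_nhds ⟨?_, ?_⟩) <;>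
    exact Metric.mem_ball_self hε

end StripC

end KdV

namespace KdV

open Set Filter Topology MeasureTheory

/-! ### Pairs of functions at a fixed time -/

/-- Two smooth functions whose derivatives have integrable products near `-∞`. -/
structure Decay (f g : ℝ → ℝ) : Prop where
  smooth_left : ContDiff ℝ ∞ f
  smooth_right : ContDiff ℝ ∞ g
  integrableOn : ∀ p q x,
    IntegrableOn (fun y => iteratedDeriv p f y * iteratedDeriv q g y) (Iic x)

/-- `∂⁻¹ (f g)` at a fixed time. -/
noncomputable def om (f g : ℝ → ℝ) (x : ℝ) : ℝ := ∫ y in Iic x, f y * g y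

theorem om_comm (f g : ℝ → ℝ) : om f g = om g f := by
  funext x
  simp only [om, mul_comm]

theorem contDiff_iteratedDeriv {f : ℝ → ℝ} (hf : ContDiff ℝ ∞ f) (p : ℕ) :
    ContDiff ℝ ∞ (iteratedDeriv p f) := by
  induction p with
  | zero => simpa using hf
  | succ p ih => rw [iteratedDeriv_succ]; exact contDiff_deriv_infty ih

theorem hasDerivAt_iteratedDeriv {f : ℝ → ℝ} (hf : ContDiff ℝ ∞ f) (p : ℕ) (x : ℝ) :
    HasDerivAt (iteratedDeriv p f) (iteratedDeriv (p + 1) f x) x := by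
  rw [iteratedDeriv_succ]
  exact hasDerivAt_of_smooth (contDiff_iteratedDeriv hf p) x

theorem integrableOn_Iic_of_Iic {g : ℝ → ℝ} (hg : Continuous g) {a : ℝ}
    (h : IntegrableOn g (Iic a)) (x : ℝ) : IntegrableOn g (Iic x) := by
  have h1 : IntegrableOn g (Icc a x) := hg.continuousOn.integrableOn_Icc
  refine (h.union h1).mono_set fun y hy => ?_
  rcases le_total y a with h2 | h2
  · exact Or.inl h2
  · exact Or.inr ⟨h2, hy⟩

namespace Decay

variable {f g : ℝ → ℝ}

/-- A function that is integrable near `-∞` together with its derivative tends to 0 there. This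
removes all boundary terms at `-∞`. -/
theorem tendsto (h : Decay f g) (p q : ℕ) :
    Tendsto (fun y => iteratedDeriv p f y * iteratedDeriv q g y) atBot (𝓝 0) :=
  tendsto_zero_of_hasDerivAt_of_integrableOn_Iic (a := 0)
    (fun x _ => (hasDerivAt_iteratedDeriv h.smooth_left p x).mul
      (hasDerivAt_iteratedDeriv h.smooth_right q x))
    ((h.integrableOn (p + 1) q 0).add (h.integrableOn p (q + 1) 0)) (h.integrableOn p q 0)

theorem integrableOn_zero (h : Decay f g) (x : ℝ) : IntegrableOn (fun y => f y * g y) (Iic x) := by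
  simpa using h.integrableOn 0 0 x

theorem hasDerivAt_om (h : Decay f g) (x : ℝ) : HasDerivAt (om f g) (f x * g x) x := by
  have hc : Continuous fun y => f y * g y := h.smooth_left.continuous.mul h.smooth_right.continuous
  have e : om f g = fun x => om f g 0 + ∫ y in (0 : ℝ)..x, f y * g y := by
    funext x
    rw [om, om, ← intervalIntegral.integral_Iic_sub_Iic (h.integrableOn_zero 0)
      (h.integrableOn_zero x)]
    ring
  rw [e]
  exact (intervalIntegral.integral_hasDerivAt_right (hc.intervalIntegrable _ _)
    hc.aestronglyMeasurable.stronglyMeasurableAtFilter hc.continuousAt).const_add _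

theorem tendsto_om (f g : ℝ → ℝ) : Tendsto (om f g) atBot (𝓝 0) :=
  tendsto_integral_Iic_zero tendsto_id

theorem contDiff_om (h : Decay f g) : ContDiff ℝ ∞ (om f g) := by
  rw [contDiff_infty_iff_deriv]
  refine ⟨fun x => (h.hasDerivAt_om x).differentiableAt, ?_⟩
  rw [show deriv (om f g) = fun x => f x * g x from funext fun x => (h.hasDerivAt_om x).deriv]
  exact h.smooth_left.mul h.smooth_right

/-- The Wronskian of two solutions of Schrödinger equations is the integral of their product. -/
theorem wronskian (h : Decay f g) {u : ℝ → ℝ} {lam xi : ℝ}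
    (hf : ∀ x, deriv (deriv f) x = -((xi + u x) * f x))
    (hg : ∀ x, deriv (deriv g) x = -((lam + u x) * g x)) (x : ℝ) :
    f x * deriv g x - deriv f x * g x = (xi - lam) * om f g x := by
  have h1 : ∀ y, HasDerivAt (fun y => f y * deriv g y - deriv f y * g y)
      ((xi - lam) * (f y * g y)) y := by
    intro y
    have e1 := (hasDerivAt_of_smooth h.smooth_left y).mul
      (hasDerivAt_of_smooth (contDiff_deriv_infty h.smooth_right) y)
    have e2 := (hasDerivAt_of_smooth (contDiff_deriv_infty h.smooth_left) y).mul
      (hasDerivAt_of_smooth h.smooth_right y)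
    refine (e1.sub e2).congr_deriv ?_
    rw [hf, hg]; ring
  have h2 : Tendsto (fun y => f y * deriv g y - deriv f y * g y) atBot (𝓝 0) := by
    have e1 := h.tendsto 0 1
    have e2 := h.tendsto 1 0
    simp only [iteratedDeriv_zero, iteratedDeriv_one] at e1 e2
    simpa using e1.sub e2
  have h3 := integral_Iic_of_hasDerivAt_of_tendsto' (a := x) (fun y _ => h1 y)
    ((h.integrableOn_zero x).const_mul _) h2
  rw [integral_const_mul, sub_zero] at h3
  exact h3.symm

end Decay

/-- Grönwall for the energy `h² + h'²`, whose derivative `2 h h' (1 - q)` is at most `1 + C` times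
the energy when `|q| ≤ C`. The left half-line follows by reflection. -/
theorem eq_zero_right_of_schrodinger {q h : ℝ → ℝ} (hq : Continuous q) (hh : ContDiff ℝ ∞ h)
    (hs : ∀ x, deriv (deriv h) x = -(q x * h x)) {a : ℝ} (h0 : h a = 0) (h1 : deriv h a = 0)
    {x : ℝ} (hx : a ≤ x) : h x = 0 := by
  obtain ⟨C, hC⟩ := (isCompact_Icc (a := a) (b := x)).exists_bound_of_continuousOn hq.continuousOn
  have hd : ∀ y, HasDerivAt (fun y => h y ^ 2 + deriv h y ^ 2)
      (2 * h y * deriv h y * (1 - q y)) y := by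
    intro y
    have e := ((hasDerivAt_of_smooth hh y).pow 2).add
      ((hasDerivAt_of_smooth (contDiff_deriv_infty hh) y).pow 2)
    refine e.congr_deriv ?_
    rw [hs]; ring
  have key := eq_zero_of_abs_deriv_le_mul_abs_self_of_eq_zero_right (K := 1 + C)
    (f := fun y => h y ^ 2 + deriv h y ^ 2) (a := a) (b := x)
    (fun y _ => (hd y).continuousAt.continuousWithinAt) (fun y _ => (hd y).hasDerivWithinAt)
    (by simp [h0, h1]) (fun y hy => by
      have hy' := hC y ⟨hy.1, hy.2.le⟩
      rw [Real.norm_eq_abs] at hy' ⊢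
      rw [Real.norm_eq_abs, abs_mul, abs_of_nonneg (by positivity : 0 ≤ h y ^ 2 + deriv h y ^ 2),
        mul_comm (1 + C)]
      have e1 : |2 * h y * deriv h y| ≤ h y ^ 2 + deriv h y ^ 2 := by
        rw [abs_le]; constructor <;> nlinarith [sq_nonneg (h y + deriv h y), sq_nonneg (h y - deriv h y)]
      have e2 : |1 - q y| ≤ 1 + C := by
        have := abs_sub 1 (q y)
        rw [abs_one] at this
        linarith
      exact mul_le_mul e1 e2 (abs_nonneg _) (by positivity)) x ⟨hx, le_rfl⟩
  nlinarith [sq_nonneg (h x), sq_nonneg (deriv h x)]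

theorem eq_zero_of_schrodinger {q h : ℝ → ℝ} (hq : Continuous q) (hh : ContDiff ℝ ∞ h)
    (hs : ∀ x, deriv (deriv h) x = -(q x * h x)) {a : ℝ} (h0 : h a = 0) (h1 : deriv h a = 0)
    (x : ℝ) : h x = 0 := by
  rcases le_total a x with hx | hx
  · exact eq_zero_right_of_schrodinger hq hh hs h0 h1 hx
  · have hn : ContDiff ℝ ∞ fun y => h (-y) := hh.comp contDiff_neg
    have hd : deriv (fun y => h (-y)) = fun y => -deriv h (-y) := funext fun y => deriv_comp_neg h y
    have hs' : ∀ y, deriv (deriv fun y => h (-y)) y = -(q (-y) * h (-y)) := by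
      intro y
      rw [hd]
      have : deriv (fun y => -deriv h (-y)) y = deriv (deriv h) (-y) := by
        rw [deriv.fun_neg, deriv_comp_neg (deriv h), neg_neg]
      rw [this, hs]
    have := eq_zero_right_of_schrodinger (hq.comp continuous_neg) hn hs' (a := -a) (x := -x)
      (by simpa using h0) (by rw [hd]; simpa using h1) (by linarith)
    simpa using this

/-- Two solutions of the same equation with vanishing Wronskian are proportional. -/
theorem proportional {u f g : ℝ → ℝ} {xi : ℝ} (hu : ContDiff ℝ ∞ u) (hf : ContDiff ℝ ∞ f)
    (hg : ContDiff ℝ ∞ g) (hfs : ∀ x, deriv (deriv f) x = -((xi + u x) * f x))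
    (hgs : ∀ x, deriv (deriv g) x = -((xi + u x) * g x))
    (hw : ∀ x, f x * deriv g x - deriv f x * g x = 0) {a : ℝ} (ha : f a ≠ 0) (x : ℝ) :
    g x = g a / f a * f x := by
  set c := g a / f a with hc
  have hca : c * f a = g a := by rw [hc]; field_simp
  have hd : deriv (fun y => g y - c * f y) = fun y => deriv g y - c * deriv f y :=
    funext fun y => ((hasDerivAt_of_smooth hg y).sub ((hasDerivAt_of_smooth hf y).const_mul c)).deriv
  have := eq_zero_of_schrodinger (q := fun y => xi + u y) (h := fun y => g y - c * f y)
    (continuous_const.add hu.continuous) (hg.sub (contDiff_const.mul hf)) (fun y => by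
      rw [hd]
      have := ((hasDerivAt_of_smooth (contDiff_deriv_infty hg) y).sub
        ((hasDerivAt_of_smooth (contDiff_deriv_infty hf) y).const_mul c)).deriv
      refine this.trans ?_
      rw [hfs, hgs]; ring) (a := a) (by simp [hca]) (by
      rw [hd]
      have h1 : f a * (deriv g a - c * deriv f a) = 0 := by
        linear_combination hw a - deriv f a * hca
      exact (mul_eq_zero.1 h1).resolve_left ha) x
  linarith

/-- A solution that is square integrable together with its derivatives is controlled, with its
first derivative, by its `L²` mass. -/
theorem sq_le_om {f q : ℝ → ℝ} (h : Decay f f) (hs : ∀ x, deriv (deriv f) x = -(q x * f x))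
    {C : ℝ} {x : ℝ} (hC : ∀ y ≤ x, |q y| ≤ C) (hC1 : 1 ≤ C) :
    f x ^ 2 ≤ (1 + (2 * ((1 + C) ^ 2 / 2 + C))) * C * om f f x ∧
      deriv f x ^ 2 ≤ (1 + (2 * ((1 + C) ^ 2 / 2 + C))) * C * om f f x := by
  set F := om f f x with hF
  have i00 := h.integrableOn 0 0 x
  have i01 := h.integrableOn 0 1 x
  have i11 := h.integrableOn 1 1 x
  have i02 := h.integrableOn 0 2 x
  have i12 := h.integrableOn 1 2 x
  have t00 := h.tendsto 0 0
  have t01 := h.tendsto 0 1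
  have t11 := h.tendsto 1 1
  simp only [iteratedDeriv_succ, iteratedDeriv_zero, ← pow_two, hs] at i00 i01 i11 i02 i12 t00 t01 t11
  set P := ∫ y in Iic x, deriv f y ^ 2 with hP
  have hFe : F = ∫ y in Iic x, f y ^ 2 := by simp only [hF, om, pow_two]
  have hF0 : 0 ≤ F := by rw [hFe]; exact integral_nonneg fun y => sq_nonneg _
  have hP0 : 0 ≤ P := integral_nonneg fun y => sq_nonneg _
  have df := fun y => hasDerivAt_of_smooth h.smooth_left y
  have ddf := fun y => hasDerivAt_of_smooth (contDiff_deriv_infty h.smooth_left) y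
  -- `f² = 2 ∫ f f'`
  have e1 : f x ^ 2 = ∫ y in Iic x, 2 * (f y * deriv f y) := by
    have := integral_Iic_of_hasDerivAt_of_tendsto' (a := x) (f := fun y => f y ^ 2)
      (f' := fun y => 2 * (f y * deriv f y)) (fun y _ => by
        refine ((df y).pow 2).congr_deriv ?_; ring) (i01.const_mul 2) t00
    rw [this, sub_zero]
  have e2 : deriv f x ^ 2 = ∫ y in Iic x, 2 * (deriv f y * -(q y * f y)) := by
    have := integral_Iic_of_hasDerivAt_of_tendsto' (a := x) (f := fun y => deriv f y ^ 2)
      (f' := fun y => 2 * (deriv f y * -(q y * f y))) (fun y _ => by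
        refine ((ddf y).pow 2).congr_deriv ?_; rw [hs]; ring) (i12.const_mul 2) t11
    rw [this, sub_zero]
  have e3 : f x * deriv f x = P + ∫ y in Iic x, f y * -(q y * f y) := by
    have := integral_Iic_of_hasDerivAt_of_tendsto' (a := x) (f := fun y => f y * deriv f y)
      (f' := fun y => deriv f y ^ 2 + f y * -(q y * f y)) (fun y _ => by
        refine ((df y).mul (ddf y)).congr_deriv ?_; rw [hs]; ring) (i11.add i02) t01
    rw [sub_zero, integral_add i11 i02] at this
    exact this.symm
  -- Young's inequality with a free weight `ε`, integrated; `b2` is the analogue for the derivative.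
  have b1 : ∀ ε > 0, f x ^ 2 ≤ ε * P + ε⁻¹ * F := by
    intro ε hε
    rw [e1, hFe, hP, ← integral_const_mul, ← integral_const_mul,
      ← integral_add (i11.const_mul ε) (i00.const_mul ε⁻¹)]
    refine integral_mono (i01.const_mul 2) ((i11.const_mul ε).add (i00.const_mul ε⁻¹)) fun y => ?_
    have : 0 ≤ ε⁻¹ * (ε * deriv f y - f y) ^ 2 := by positivity
    have e : ε⁻¹ * (ε * deriv f y - f y) ^ 2
        = ε * deriv f y ^ 2 + ε⁻¹ * f y ^ 2 - 2 * (f y * deriv f y) := by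
      field_simp; ring
    change _ ≤ ε * deriv f y ^ 2 + ε⁻¹ * f y ^ 2
    linarith
  have b2 : ∀ ε > 0, deriv f x ^ 2 ≤ C * (ε * P + ε⁻¹ * F) := by
    intro ε hε
    rw [e2, hFe, hP, ← integral_const_mul ε, ← integral_const_mul ε⁻¹,
      ← integral_add (i11.const_mul ε) (i00.const_mul ε⁻¹), ← integral_const_mul]
    refine setIntegral_mono_on (i12.const_mul 2)
      (((i11.const_mul ε).add (i00.const_mul ε⁻¹)).const_mul C) measurableSet_Iic fun y hy => ?_
    have h1 := hC y hy
    have h2 : 0 ≤ ε⁻¹ * (ε * |deriv f y| - |f y|) ^ 2 := by positivity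
    have e : ε⁻¹ * (ε * |deriv f y| - |f y|) ^ 2
        = ε * deriv f y ^ 2 + ε⁻¹ * f y ^ 2 - 2 * (|f y| * |deriv f y|) := by
      rw [← sq_abs (deriv f y), ← sq_abs (f y)]; field_simp; ring
    have h3 : 2 * (deriv f y * -(q y * f y)) ≤ C * (2 * (|f y| * |deriv f y|)) := by
      refine (le_abs_self _).trans ?_
      rw [abs_mul, abs_mul, abs_neg, abs_mul, abs_two]
      nlinarith [mul_nonneg (abs_nonneg (f y)) (abs_nonneg (deriv f y))]
    refine h3.trans (mul_le_mul_of_nonneg_left ?_ (by linarith))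
    linarith
  have b3 : |∫ y in Iic x, f y * -(q y * f y)| ≤ C * F := by
    rw [hFe, ← integral_const_mul, ← Real.norm_eq_abs]
    refine norm_integral_le_of_norm_le (i00.const_mul C) ?_
    refine (ae_restrict_iff' measurableSet_Iic).2 (Eventually.of_forall fun y hy => ?_)
    rw [Real.norm_eq_abs, abs_mul, abs_neg, abs_mul, ← sq_abs (f y)]
    nlinarith [hC y hy, abs_nonneg (f y), sq_nonneg (|f y|)]
  -- With `ε = 1/(1 + C)`, `b1` and `b2` give `f² + f'² ≤ P + (1 + C)² F`. On the other hand `2 P ≤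
  -- 2 f f' + 2 C F ≤ f² + f'² + 2 C F`, so one copy of `P` is absorbed.
  have hPF : P ≤ 2 * ((1 + C) ^ 2 / 2 + C) * F := by
    have h1 := b1 (1 + C)⁻¹ (by positivity)
    have h2 := b2 (1 + C)⁻¹ (by positivity)
    rw [inv_inv] at h1 h2
    have h3 := abs_le.1 b3
    have h4 : 2 * (f x * deriv f x) ≤ f x ^ 2 + deriv f x ^ 2 := by
      nlinarith [sq_nonneg (f x - deriv f x)]
    have h5 : f x ^ 2 + deriv f x ^ 2 ≤ (1 + C) * ((1 + C)⁻¹ * P + (1 + C) * F) := by linarith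
    have h6 : (1 + C) * ((1 + C)⁻¹ * P + (1 + C) * F) = P + (1 + C) ^ 2 * F := by
      have : 1 + C ≠ 0 := by positivity
      field_simp
    nlinarith
  have c1 := b1 1 one_pos
  have c2 := b2 1 one_pos
  have h7 : P + F ≤ (1 + 2 * ((1 + C) ^ 2 / 2 + C)) * F := by linarith
  rw [inv_one, one_mul, one_mul] at c1 c2
  constructor
  · have : 0 ≤ (P + F) * (C - 1) := mul_nonneg (by linarith) (by linarith)
    nlinarith
  · nlinarith

end KdV

namespace KdV

open Set Filter Topology MeasureTheory

/-! ### One step of the transformation: seeds and partners -/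

theorem ProductDecays.symm {T : Set ℝ} {g h : ℝ → ℝ → ℝ} (H : ProductDecays T g h) :
    ProductDecays T h g := fun K hK hKc p q => by
  obtain ⟨G, hG, hb⟩ := H K hK hKc q p
  exact ⟨G, hG, fun t ht x hx => by rw [mul_comm]; exact hb t ht x hx⟩

theorem ProductDecays.decay {T : Set ℝ} {g h : ℝ → ℝ → ℝ} (H : ProductDecays T g h)
    (hg : StripC ∞ T g) (hh : StripC ∞ T h) {t : ℝ} (ht : t ∈ T) : Decay (g t) (h t) where
  smooth_left := hg.contDiff_x ht
  smooth_right := hh.contDiff_x ht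
  integrableOn p q x := by
    have hc : Continuous fun y => iteratedDeriv p (g t) y * iteratedDeriv q (h t) y :=
      (contDiff_iteratedDeriv (hg.contDiff_x ht) p).continuous.mul
        (contDiff_iteratedDeriv (hh.contDiff_x ht) q).continuous
    refine integrableOn_Iic_of_Iic hc (a := 0) ?_ x
    obtain ⟨G, hG, hb⟩ := H {t} (singleton_subset_iff.2 ht) isCompact_singleton p q
    exact hG.mono' hc.aestronglyMeasurable
      ((ae_restrict_iff' measurableSet_Iic).2 (Eventually.of_forall fun y hy => hb t rfl y hy))

/-- The Schrödinger equation in terms of iterated first derivatives. -/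
def Spectral (T : Set ℝ) (u : ℝ → ℝ → ℝ) (lam : ℝ) (g : ℝ → ℝ → ℝ) : Prop :=
  ∀ t ∈ T, ∀ x, deriv (deriv (g t)) x = -((lam + u t x) * g t x)

theorem schrodinger_iff {T : Set ℝ} {u : ℝ → ℝ → ℝ} {lam : ℝ} {g : ℝ → ℝ → ℝ} :
    Schrodinger T u lam g ↔ Spectral T u lam g := by
  refine forall₂_congr fun t _ => forall_congr' fun x => ?_
  rw [iteratedDeriv_succ, iteratedDeriv_one]
  constructor <;> intro h <;> linarith

/-- A function that can serve as the seed of a binary Darboux transformation. -/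
structure Seed (T : Set ℝ) (u : ℝ → ℝ → ℝ) (xi : ℝ) (f : ℝ → ℝ → ℝ) : Prop where
  isOpen : IsOpen T
  smooth_u : StripC ∞ T u
  bounded_u : BoundedAtNegInfty T u
  smooth : StripC ∞ T f
  spectral : Spectral T u xi f
  decays : ProductDecays T f f
  ne_zero : ∀ t ∈ T, ∀ x, om (f t) (f t) x ≠ 0

/-- A solution of a Schrödinger equation on which the transformation with seed `f` can act. -/
structure Partner (T : Set ℝ) (u f : ℝ → ℝ → ℝ) (lam : ℝ) (g : ℝ → ℝ → ℝ) : Prop where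
  smooth : StripC ∞ T g
  spectral : Spectral T u lam g
  decays : ProductDecays T f g

/-- The transformed function. -/
noncomputable def bdt (f g : ℝ → ℝ → ℝ) (t x : ℝ) : ℝ :=
  g t x - f t x * (om (f t) (f t) x)⁻¹ * om (f t) (g t) x

/-- The transformed potential. -/
noncomputable def bdtPot (f u : ℝ → ℝ → ℝ) (t x : ℝ) : ℝ :=
  u t x + 2 * deriv (fun y => f t y ^ 2 * (om (f t) (f t) y)⁻¹) x

theorem bounded_nonneg {T : Set ℝ} {u : ℝ → ℝ → ℝ} (h : BoundedAtNegInfty T u) {K : Set ℝ}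
    (hK : K ⊆ T) (hKc : IsCompact K) (p : ℕ) :
    ∃ C, 0 ≤ C ∧ ∀ t ∈ K, ∀ x ≤ 0, |iteratedDeriv p (u t) x| ≤ C := by
  obtain ⟨C, hC⟩ := h K hK hKc p
  exact ⟨max C 0, le_max_right _ _, fun t ht x hx => (hC t ht x hx).trans (le_max_left _ _)⟩

theorem bounded_evf {T : Set ℝ} {u : ℝ → ℝ → ℝ} (h : BoundedAtNegInfty T u) {K : Set ℝ}
    (hK : K ⊆ T) (hKc : IsCompact K) (p : DiffPoly) :
    ∃ C, 0 ≤ C ∧ ∀ t ∈ K, ∀ x ≤ 0, |evf p (u t) x| ≤ C := by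
  unfold evf
  induction p using MvPolynomial.induction_on with
  | C r => exact ⟨|r|, abs_nonneg r, fun t _ x _ => by simp⟩
  | add p q hp hq =>
    obtain ⟨A, hA0, hA⟩ := hp
    obtain ⟨B, hB0, hB⟩ := hq
    refine ⟨A + B, by positivity, fun t ht x hx => ?_⟩
    rw [map_add]
    exact (abs_add_le _ _).trans (add_le_add (hA t ht x hx) (hB t ht x hx))
  | mul_X p i hp =>
    obtain ⟨A, hA0, hA⟩ := hp
    obtain ⟨B, hB0, hB⟩ := bounded_nonneg h hK hKc i
    refine ⟨A * B, by positivity, fun t ht x hx => ?_⟩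
    rw [map_mul, MvPolynomial.eval_X, abs_mul]
    exact mul_le_mul (hA t ht x hx) (hB t ht x hx) (abs_nonneg _) hA0

/-- All `x`-derivatives of a solution are combinations of the first two, with coefficients that
are differential polynomials in the potential. -/
theorem exists_iteratedDeriv_eq (lam : ℝ) (p : ℕ) : ∃ P Q : DiffPoly, ∀ u g : ℝ → ℝ,
    ContDiff ℝ ∞ u → ContDiff ℝ ∞ g → (∀ x, deriv (deriv g) x = -((lam + u x) * g x)) →
    ∀ x, iteratedDeriv p g x = evf P u x * g x + evf Q u x * deriv g x := by
  induction p with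
  | zero => exact ⟨1, 0, fun u g _ _ _ x => by simp [evf]⟩
  | succ p ih =>
    obtain ⟨P, Q, h⟩ := ih
    refine ⟨D P - (MvPolynomial.C lam + MvPolynomial.X 0) * Q, P + D Q,
      fun u g hu hg hs x => ?_⟩
    rw [iteratedDeriv_succ, show iteratedDeriv p g
      = fun x => evf P u x * g x + evf Q u x * deriv g x from funext (h u g hu hg hs)]
    have e := ((hasDerivAt_evf hu P x).mul (hasDerivAt_of_smooth hg x)).add
      ((hasDerivAt_evf hu Q x).mul (hasDerivAt_of_smooth (contDiff_deriv_infty hg) x))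
    refine e.deriv.trans ?_
    rw [hs]
    simp only [evf, map_sub, map_mul, map_add, MvPolynomial.eval_C, MvPolynomial.eval_X,
      iteratedDeriv_zero]
    ring

theorem iteratedDeriv_le {T : Set ℝ} {u g : ℝ → ℝ → ℝ} {lam : ℝ} (hu : StripC ∞ T u)
    (hb : BoundedAtNegInfty T u) (hg : StripC ∞ T g) (hs : Spectral T u lam g) {K : Set ℝ}
    (hK : K ⊆ T) (hKc : IsCompact K) (p : ℕ) :
    ∃ C, 0 ≤ C ∧ ∀ t ∈ K, ∀ x ≤ 0,
      |iteratedDeriv p (g t) x| ≤ C * (|g t x| + |deriv (g t) x|) := by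
  obtain ⟨P, Q, h⟩ := exists_iteratedDeriv_eq lam p
  obtain ⟨A, hA0, hA⟩ := bounded_evf hb hK hKc P
  obtain ⟨B, hB0, hB⟩ := bounded_evf hb hK hKc Q
  refine ⟨A + B, by positivity, fun t ht x hx => ?_⟩
  rw [h (u t) (g t) (hu.contDiff_x (hK ht)) (hg.contDiff_x (hK ht)) (hs t (hK ht))]
  refine (abs_add_le _ _).trans ?_
  rw [abs_mul, abs_mul]
  nlinarith [mul_le_mul_of_nonneg_right (hA t ht x hx) (abs_nonneg (g t x)),
    mul_le_mul_of_nonneg_right (hB t ht x hx) (abs_nonneg (deriv (g t) x)),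
    mul_nonneg hA0 (abs_nonneg (deriv (g t) x)), mul_nonneg hB0 (abs_nonneg (g t x))]

/-- Decay of a product is inherited by pairs of solutions dominated by the original ones. -/
theorem ProductDecays.of_dominated {T : Set ℝ} {v g h g' h' : ℝ → ℝ → ℝ} {lam mu : ℝ}
    (H : ProductDecays T g h) (hv : StripC ∞ T v) (hb : BoundedAtNegInfty T v)
    (hg : StripC ∞ T g') (hgs : Spectral T v lam g') (hh : StripC ∞ T h')
    (hhs : Spectral T v mu h')
    (dg : ∀ K ⊆ T, IsCompact K → ∃ C, 0 ≤ C ∧ ∀ t ∈ K, ∀ x ≤ 0,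
      |g' t x| + |deriv (g' t) x| ≤ C * (|g t x| + |deriv (g t) x|))
    (dh : ∀ K ⊆ T, IsCompact K → ∃ C, 0 ≤ C ∧ ∀ t ∈ K, ∀ x ≤ 0,
      |h' t x| + |deriv (h' t) x| ≤ C * (|h t x| + |deriv (h t) x|)) :
    ProductDecays T g' h' := by
  intro K hK hKc p q
  obtain ⟨A, hA0, hA⟩ := iteratedDeriv_le hv hb hg hgs hK hKc p
  obtain ⟨B, hB0, hB⟩ := iteratedDeriv_le hv hb hh hhs hK hKc q
  obtain ⟨A', hA0', hA'⟩ := dg K hK hKc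
  obtain ⟨B', hB0', hB'⟩ := dh K hK hKc
  -- Orders 0 and 1 suffice: the Schrödinger equations reduce all higher derivatives to these.
  obtain ⟨G00, i00, b00⟩ := H K hK hKc 0 0
  obtain ⟨G01, i01, b01⟩ := H K hK hKc 0 1
  obtain ⟨G10, i10, b10⟩ := H K hK hKc 1 0
  obtain ⟨G11, i11, b11⟩ := H K hK hKc 1 1
  refine ⟨fun x => A * A' * (B * B') * (G00 x + G01 x + (G10 x + G11 x)),
    ((i00.add i01).add (i10.add i11)).const_mul _, fun t ht x hx => ?_⟩
  have c00 := b00 t ht x hx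
  have c01 := b01 t ht x hx
  have c10 := b10 t ht x hx
  have c11 := b11 t ht x hx
  simp only [iteratedDeriv_zero, iteratedDeriv_one, abs_mul] at c00 c01 c10 c11
  rw [abs_mul]
  have e1 : |iteratedDeriv p (g' t) x| ≤ A * A' * (|g t x| + |deriv (g t) x|) := by
    refine (hA t ht x hx).trans ?_
    rw [mul_assoc]
    exact mul_le_mul_of_nonneg_left (hA' t ht x hx) hA0
  have e2 : |iteratedDeriv q (h' t) x| ≤ B * B' * (|h t x| + |deriv (h t) x|) := by
    refine (hB t ht x hx).trans ?_
    rw [mul_assoc]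
    exact mul_le_mul_of_nonneg_left (hB' t ht x hx) hB0
  refine (mul_le_mul e1 e2 (abs_nonneg _) (by positivity)).trans ?_
  have e3 : A * A' * (|g t x| + |deriv (g t) x|) * (B * B' * (|h t x| + |deriv (h t) x|))
      = A * A' * (B * B') * (|g t x| * |h t x| + |g t x| * |deriv (h t) x|
        + (|deriv (g t) x| * |h t x| + |deriv (g t) x| * |deriv (h t) x|)) := by ring
  rw [e3]
  refine mul_le_mul_of_nonneg_left ?_ (by positivity)
  linarith

/-! ### Functions with bounded derivatives -/

/-- The first `p` derivatives in `x` are bounded for `t ∈ K` and `x ≤ 0`. -/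
def BddUpTo (K : Set ℝ) (p : ℕ) (w : ℝ → ℝ → ℝ) : Prop :=
  (∀ t ∈ K, ContDiff ℝ ∞ (w t)) ∧
    ∀ q ≤ p, ∃ C, ∀ t ∈ K, ∀ x ≤ 0, |iteratedDeriv q (w t) x| ≤ C

namespace BddUpTo

variable {K : Set ℝ} {p : ℕ} {v w : ℝ → ℝ → ℝ}

theorem const (c : ℝ) : BddUpTo K p fun _ _ => c :=
  ⟨fun _ _ => contDiff_const, fun q _ => ⟨|c|, fun t _ x _ => by
    rw [iteratedDeriv_const]; split_ifs <;> simp⟩⟩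

theorem add (hv : BddUpTo K p v) (hw : BddUpTo K p w) : BddUpTo K p fun t x => v t x + w t x := by
  refine ⟨fun t ht => (hv.1 t ht).add (hw.1 t ht), fun q hq => ?_⟩
  obtain ⟨A, hA⟩ := hv.2 q hq
  obtain ⟨B, hB⟩ := hw.2 q hq
  refine ⟨A + B, fun t ht x hx => ?_⟩
  rw [iteratedDeriv_fun_add ((hv.1 t ht).of_le (by exact_mod_cast le_top)).contDiffAt
    ((hw.1 t ht).of_le (by exact_mod_cast le_top)).contDiffAt]
  exact (abs_add_le _ _).trans (add_le_add (hA t ht x hx) (hB t ht x hx))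

theorem mul (hv : BddUpTo K p v) (hw : BddUpTo K p w) : BddUpTo K p fun t x => v t x * w t x := by
  refine ⟨fun t ht => (hv.1 t ht).mul (hw.1 t ht), fun q hq => ?_⟩
  choose! A hA using hv.2
  choose! B hB using hw.2
  refine ⟨∑ i ∈ Finset.range (q + 1), q.choose i * |A i| * |B (q - i)|, fun t ht x hx => ?_⟩
  rw [iteratedDeriv_fun_mul ((hv.1 t ht).of_le (by exact_mod_cast le_top)).contDiffAt
    ((hw.1 t ht).of_le (by exact_mod_cast le_top)).contDiffAt]
  refine (Finset.abs_sum_le_sum_abs _ _).trans (Finset.sum_le_sum fun i hi => ?_)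
  have hi' := Finset.mem_range.1 hi
  rw [abs_mul, abs_mul, Nat.abs_cast]
  refine mul_le_mul (mul_le_mul_of_nonneg_left ?_ (by positivity)) ?_ (abs_nonneg _) (by positivity)
  · exact (hA i (by omega) t ht x hx).trans (le_abs_self _)
  · exact (hB (q - i) (by omega) t ht x hx).trans (le_abs_self _)

theorem succ (h0 : BddUpTo K 0 w) (h1 : BddUpTo K p fun t x => deriv (w t) x) :
    BddUpTo K (p + 1) w := by
  refine ⟨h0.1, fun q hq => ?_⟩
  cases q with
  | zero => exact h0.2 0 le_rfl
  | succ q =>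
    obtain ⟨C, hC⟩ := h1.2 q (by omega)
    exact ⟨C, fun t ht x hx => by rw [iteratedDeriv_succ']; exact hC t ht x hx⟩

theorem congr (h : BddUpTo K p w) (e : ∀ t ∈ K, v t = w t) : BddUpTo K p v :=
  ⟨fun t ht => by rw [e t ht]; exact h.1 t ht, fun q hq => by
    obtain ⟨C, hC⟩ := h.2 q hq
    exact ⟨C, fun t ht x hx => by rw [e t ht]; exact hC t ht x hx⟩⟩

end BddUpTo

end KdV

/-! ### One step: the Schrödinger equation and the estimates at `-∞` -/

namespace KdV

open Set Filter Topology MeasureTheory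

/-- After substituting the derivatives, the mismatch `(x - l) f G w` of the two spectral values is
the Wronskian relation, used once. -/
theorem binary_spectral {S : Type*} [CommRing S] [Algebra ℝ S] (d : Derivation ℝ S S)
    {u f g G w x l : S} (hf : d (d f) = -((x + u) * f)) (hg : d (d g) = -((l + u) * g))
    (hG : d G = -(f ^ 2 * G ^ 2)) (hw : d w = f * g) (hwr : f * d g - d f * g = (x - l) * w) :
    d (d (g - f * G * w)) = -((l + (u + 2 * d (f ^ 2 * G))) * (g - f * G * w)) := by
  simp only [map_sub, map_add, map_neg, D_mul', hf, hg, hG, hw, pow_succ, pow_zero, one_mul]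
  linear_combination (-(f * G)) * hwr

theorem deriv_binary {u f g G w : ℝ → ℝ} {lam xi : ℝ} (hu : ContDiff ℝ ∞ u)
    (hf : ContDiff ℝ ∞ f) (hG : ContDiff ℝ ∞ G) (hg : ContDiff ℝ ∞ g) (hw : ContDiff ℝ ∞ w)
    (hfs : ∀ x, deriv (deriv f) x = -((xi + u x) * f x))
    (hgs : ∀ x, deriv (deriv g) x = -((lam + u x) * g x))
    (hGd : ∀ x, deriv G x = -(f x ^ 2 * G x ^ 2)) (hwd : ∀ x, deriv w x = f x * g x)
    (hwr : ∀ x, f x * deriv g x - deriv f x * g x = (xi - lam) * w x) (x : ℝ) :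
    deriv (deriv (fun y => g y - f y * G y * w y)) x
      = -((lam + (u x + 2 * deriv (fun z => f z ^ 2 * G z) x)) * (g x - f x * G x * w x)) :=
  congrArg (fun s : SmoothFun => s.1 x)
    (binary_spectral smoothD (G := ⟨G, hG⟩) (w := ⟨w, hw⟩)
      (smoothD_schrodinger hu hf hfs) (smoothD_schrodinger hu hg hgs)
      (Subtype.ext <| funext fun x => hGd x) (Subtype.ext <| funext fun x => hwd x)
      (Subtype.ext <| funext fun x => hwr x))

namespace Seed

variable {T : Set ℝ} {u f g h : ℝ → ℝ → ℝ} {xi lam mu : ℝ}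

theorem partner (s : Seed T u xi f) : Partner T u f xi f := ⟨s.smooth, s.spectral, s.decays⟩

theorem decay (s : Seed T u xi f) (p : Partner T u f lam g) {t : ℝ} (ht : t ∈ T) :
    Decay (f t) (g t) := p.decays.decay s.smooth p.smooth ht

theorem pos (s : Seed T u xi f) {t : ℝ} (ht : t ∈ T) (x : ℝ) : 0 < om (f t) (f t) x := by
  refine lt_of_le_of_ne ?_ (s.ne_zero t ht x).symm
  exact integral_nonneg fun y => mul_self_nonneg _

theorem contDiff_G (s : Seed T u xi f) {t : ℝ} (ht : t ∈ T) :
    ContDiff ℝ ∞ fun x => (om (f t) (f t) x)⁻¹ :=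
  (s.decay s.partner ht).contDiff_om.inv (s.ne_zero t ht)

theorem deriv_G (s : Seed T u xi f) {t : ℝ} (ht : t ∈ T) (x : ℝ) :
    deriv (fun x => (om (f t) (f t) x)⁻¹) x = -(f t x ^ 2 * (om (f t) (f t) x)⁻¹ ^ 2) := by
  have h1 := ((s.decay s.partner ht).hasDerivAt_om x).inv (s.ne_zero t ht x)
  refine h1.deriv.trans ?_
  field_simp

theorem hasDerivAt_G (s : Seed T u xi f) {t : ℝ} (ht : t ∈ T) (x : ℝ) :
    HasDerivAt (fun x => (om (f t) (f t) x)⁻¹) (-(f t x ^ 2 * (om (f t) (f t) x)⁻¹ ^ 2)) x := by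
  rw [← s.deriv_G ht]
  exact hasDerivAt_of_smooth (s.contDiff_G ht) x

theorem deriv_sq_mul_G (s : Seed T u xi f) {t : ℝ} (ht : t ∈ T) (x : ℝ) :
    deriv (fun y => f t y ^ 2 * (om (f t) (f t) y)⁻¹) x
      = 2 * (f t x * deriv (f t) x * (om (f t) (f t) x)⁻¹)
        - (f t x ^ 2 * (om (f t) (f t) x)⁻¹) ^ 2 := by
  refine (((s.smooth.hasDerivAt_x ht x).pow 2).mul (s.hasDerivAt_G ht x)).deriv.trans ?_
  simp only [Pi.pow_apply]
  ring

theorem wronskian (s : Seed T u xi f) (p : Partner T u f lam g) {t : ℝ} (ht : t ∈ T) (x : ℝ) :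
    f t x * deriv (g t) x - deriv (f t) x * g t x = (xi - lam) * om (f t) (g t) x :=
  (s.decay p ht).wronskian (s.spectral t ht) (p.spectral t ht) x

theorem spectral_bdt (s : Seed T u xi f) (p : Partner T u f lam g) :
    Spectral T (bdtPot f u) lam (bdt f g) := fun t ht x =>
  deriv_binary (s.smooth_u.contDiff_x ht) (s.smooth.contDiff_x ht) (s.contDiff_G ht)
    (p.smooth.contDiff_x ht) (s.decay p ht).contDiff_om (s.spectral t ht) (p.spectral t ht)
    (s.deriv_G ht) (fun y => ((s.decay p ht).hasDerivAt_om y).deriv) (s.wronskian p ht) x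

theorem exists_ne_zero (s : Seed T u xi f) {t : ℝ} (ht : t ∈ T) : ∃ a, f t a ≠ 0 := by
  by_contra! hc
  exact s.ne_zero t ht 0 (by simp [om, hc])

theorem proportional (s : Seed T u xi f) (p : Partner T u f xi g) {t : ℝ} (ht : t ∈ T) {a : ℝ}
    (ha : f t a ≠ 0) (x : ℝ) : g t x = g t a / f t a * f t x :=
  KdV.proportional (s.smooth_u.contDiff_x ht) (s.smooth.contDiff_x ht) (p.smooth.contDiff_x ht)
    (s.spectral t ht) (p.spectral t ht)
    (fun y => by rw [s.wronskian p ht, sub_self, zero_mul]) ha x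

theorem om_proportional (s : Seed T u xi f) (p : Partner T u f xi g) {t : ℝ} (ht : t ∈ T) {a : ℝ}
    (ha : f t a ≠ 0) (x : ℝ) : om (f t) (g t) x = g t a / f t a * om (f t) (f t) x := by
  rw [om, om, ← integral_const_mul]
  congr 1
  funext y
  rw [s.proportional p ht ha y]
  ring

theorem sq_le (s : Seed T u xi f) {K : Set ℝ} (hK : K ⊆ T) (hKc : IsCompact K) :
    ∃ C, 0 ≤ C ∧ ∀ t ∈ K, ∀ x ≤ 0,
      f t x ^ 2 ≤ C * om (f t) (f t) x ∧ deriv (f t) x ^ 2 ≤ C * om (f t) (f t) x := by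
  obtain ⟨B, hB0, hB⟩ := bounded_nonneg s.bounded_u hK hKc 0
  have hC1 : 1 ≤ |xi| + B + 1 := by have := abs_nonneg xi; linarith
  refine ⟨(1 + (2 * ((1 + (|xi| + B + 1)) ^ 2 / 2 + (|xi| + B + 1)))) * (|xi| + B + 1),
    by positivity, fun t ht x hx => ?_⟩
  refine sq_le_om (s.decay s.partner (hK ht)) (q := fun y => xi + u t y) (s.spectral t (hK ht))
    (fun y hy => ?_) hC1
  have := hB t ht y (hy.trans hx)
  rw [iteratedDeriv_zero] at this
  have := abs_add_le xi (u t y)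
  linarith

/-- The coefficient functions of the transformation are bounded. -/
theorem ratios (s : Seed T u xi f) {K : Set ℝ} (hK : K ⊆ T) (hKc : IsCompact K) :
    ∃ C, 0 ≤ C ∧ ∀ t ∈ K, ∀ x ≤ 0,
      f t x ^ 2 * (om (f t) (f t) x)⁻¹ ≤ C
      ∧ |f t x * deriv (f t) x * (om (f t) (f t) x)⁻¹| ≤ C
      ∧ deriv (f t) x ^ 2 * (om (f t) (f t) x)⁻¹ ≤ C := by
  obtain ⟨C, hC0, hC⟩ := s.sq_le hK hKc
  refine ⟨C, hC0, fun t ht x hx => ?_⟩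
  obtain ⟨h1, h2⟩ := hC t ht x hx
  have hF := s.pos (hK ht) x
  simp only [← div_eq_mul_inv]
  refine ⟨(div_le_iff₀ hF).2 h1, ?_, (div_le_iff₀ hF).2 h2⟩
  rw [abs_div, abs_of_pos hF, div_le_iff₀ hF, abs_le]
  constructor
  · nlinarith [sq_nonneg (f t x + deriv (f t) x)]
  · nlinarith [sq_nonneg (f t x - deriv (f t) x)]

/-- For `λ = ξ` at a fixed time `g` is a multiple of `f`, and the two expressions are `g` and `g'`.
Otherwise the Wronskian replaces `∂⁻¹(f g)` by `(f g' - f' g)/(ξ - λ)`, and only the bounded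
quantities of `ratios` remain. -/
theorem ratio_om (s : Seed T u xi f) (p : Partner T u f lam g) {K : Set ℝ} (hK : K ⊆ T)
    (hKc : IsCompact K) : ∃ C, 0 ≤ C ∧ ∀ t ∈ K, ∀ x ≤ 0,
      |f t x * (om (f t) (f t) x)⁻¹ * om (f t) (g t) x| ≤ C * (|g t x| + |deriv (g t) x|)
      ∧ |deriv (f t) x * (om (f t) (f t) x)⁻¹ * om (f t) (g t) x|
        ≤ C * (|g t x| + |deriv (g t) x|) := by
  by_cases hl : lam = xi
  · subst hl
    refine ⟨1, zero_le_one, fun t ht x _ => ?_⟩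
    obtain ⟨a, ha⟩ := s.exists_ne_zero (hK ht)
    have hF := s.ne_zero t (hK ht) x
    have e1 : f t x * (om (f t) (f t) x)⁻¹ * om (f t) (g t) x = g t x := by
      rw [s.om_proportional p (hK ht) ha, s.proportional p (hK ht) ha x]
      field_simp
    have e2 : deriv (f t) x * (om (f t) (f t) x)⁻¹ * om (f t) (g t) x = deriv (g t) x := by
      have : deriv (g t) x = g t a / f t a * deriv (f t) x := by
        rw [show g t = fun x => g t a / f t a * f t x from
          funext fun x => s.proportional p (hK ht) ha x]
        have := ((s.smooth.hasDerivAt_x (hK ht) x).const_mul (g t a / f t a)).deriv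
        refine this.trans ?_
        field_simp
      rw [s.om_proportional p (hK ht) ha, this]
      field_simp
    rw [e1, e2]
    constructor <;> linarith [abs_nonneg (g t x), abs_nonneg (deriv (g t) x)]
  · obtain ⟨C, hC0, hC⟩ := s.ratios hK hKc
    have hd : xi - lam ≠ 0 := sub_ne_zero.2 (Ne.symm hl)
    refine ⟨C * |xi - lam|⁻¹, by positivity, fun t ht x hx => ?_⟩
    obtain ⟨c1, c2, c3⟩ := hC t ht x hx
    have hF := s.pos (hK ht) x
    have hw := s.wronskian p (hK ht) x
    have hA : |f t x ^ 2 * (om (f t) (f t) x)⁻¹| ≤ C := by rwa [abs_of_nonneg (by positivity)]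
    have hB : |deriv (f t) x ^ 2 * (om (f t) (f t) x)⁻¹| ≤ C := by
      rwa [abs_of_nonneg (by positivity)]
    have key : ∀ a b c d : ℝ, |a| ≤ C → |b| ≤ C →
        |(xi - lam)⁻¹ * (a * d - b * c)| ≤ C * |xi - lam|⁻¹ * (|c| + |d|) := by
      intro a b c d ha hb
      rw [abs_mul, abs_inv]
      have h1 : |a * d - b * c| ≤ C * (|c| + |d|) := by
        refine (abs_sub _ _).trans ?_
        rw [abs_mul, abs_mul]
        nlinarith [mul_le_mul_of_nonneg_right ha (abs_nonneg d),
          mul_le_mul_of_nonneg_right hb (abs_nonneg c)]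
      calc |xi - lam|⁻¹ * |a * d - b * c| ≤ |xi - lam|⁻¹ * (C * (|c| + |d|)) :=
            mul_le_mul_of_nonneg_left h1 (by positivity)
        _ = _ := by ring
    have hom : om (f t) (g t) x
        = (xi - lam)⁻¹ * (f t x * deriv (g t) x - deriv (f t) x * g t x) := by
      rw [hw]; field_simp
    rw [hom]
    constructor
    · convert key _ _ (g t x) (deriv (g t) x) hA c2 using 2; ring
    · convert key _ _ (g t x) (deriv (g t) x) c2 hB using 2; ring

/-- The derivative is grouped into the quantities bounded by `ratios` and `ratio_om`. -/
theorem hasDerivAt_bdt (s : Seed T u xi f) (p : Partner T u f lam g) {t : ℝ} (ht : t ∈ T) (x : ℝ) :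
    HasDerivAt (bdt f g t) (deriv (g t) x
      - (deriv (f t) x * (om (f t) (f t) x)⁻¹ * om (f t) (g t) x
        - (f t x ^ 2 * (om (f t) (f t) x)⁻¹)
          * (f t x * (om (f t) (f t) x)⁻¹ * om (f t) (g t) x)
        + f t x ^ 2 * (om (f t) (f t) x)⁻¹ * g t x)) x := by
  have := (p.smooth.hasDerivAt_x ht x).sub
    (((s.smooth.hasDerivAt_x ht x).mul (s.hasDerivAt_G ht x)).mul ((s.decay p ht).hasDerivAt_om x))
  refine this.congr_deriv ?_
  simp only [Pi.mul_apply]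
  ring

theorem bdt_le (s : Seed T u xi f) (p : Partner T u f lam g) {K : Set ℝ} (hK : K ⊆ T)
    (hKc : IsCompact K) : ∃ C, 0 ≤ C ∧ ∀ t ∈ K, ∀ x ≤ 0,
      |bdt f g t x| + |deriv (bdt f g t) x| ≤ C * (|g t x| + |deriv (g t) x|) := by
  obtain ⟨A, hA0, hA⟩ := s.ratios hK hKc
  obtain ⟨B, hB0, hB⟩ := s.ratio_om p hK hKc
  refine ⟨1 + B + (1 + B + A * B + A), by positivity, fun t ht x hx => ?_⟩
  obtain ⟨a1, -, -⟩ := hA t ht x hx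
  obtain ⟨b1, b2⟩ := hB t ht x hx
  have hF := s.pos (hK ht) x
  have hA' : |f t x ^ 2 * (om (f t) (f t) x)⁻¹| ≤ A := by rwa [abs_of_nonneg (by positivity)]
  rw [(s.hasDerivAt_bdt p (hK ht) x).deriv, bdt]
  set N := |g t x| + |deriv (g t) x| with hN
  have hgN : |g t x| ≤ N := by have := abs_nonneg (deriv (g t) x); linarith
  have hdN : |deriv (g t) x| ≤ N := by have := abs_nonneg (g t x); linarith
  have hN0 : 0 ≤ N := by positivity
  have e1 := abs_sub (g t x) (f t x * (om (f t) (f t) x)⁻¹ * om (f t) (g t) x)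
  have e2 : |f t x ^ 2 * (om (f t) (f t) x)⁻¹ * (f t x * (om (f t) (f t) x)⁻¹ * om (f t) (g t) x)|
      ≤ A * B * N := by
    rw [abs_mul, mul_assoc A]
    exact mul_le_mul hA' b1 (abs_nonneg _) hA0
  have e3 : |f t x ^ 2 * (om (f t) (f t) x)⁻¹ * g t x| ≤ A * N := by
    rw [abs_mul]
    exact mul_le_mul hA' hgN (abs_nonneg _) hA0
  have e4 : ∀ a b c d : ℝ, |a - (b - c + d)| ≤ |a| + |b| + |c| + |d| := by
    intro a b c d
    rw [abs_le]
    constructor <;>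
    linarith [neg_abs_le a, le_abs_self a, neg_abs_le b, le_abs_self b, neg_abs_le c,
      le_abs_self c, neg_abs_le d, le_abs_self d]
  have e5 := e4 (deriv (g t) x) (deriv (f t) x * (om (f t) (f t) x)⁻¹ * om (f t) (g t) x)
    (f t x ^ 2 * (om (f t) (f t) x)⁻¹ * (f t x * (om (f t) (f t) x)⁻¹ * om (f t) (g t) x))
    (f t x ^ 2 * (om (f t) (f t) x)⁻¹ * g t x)
  have e6 : (1 + B + (1 + B + A * B + A)) * N
      = (N + B * N) + (N + B * N + A * B * N + A * N) := by ring
  rw [e6]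
  linarith

/-- With `A = f²/F`, `B = f f'/F`, `C = f'²/F` one has `A' = 2B - A²`, `B' = C - (ξ + u) A - A B`
and `C' = -2 (ξ + u) B - A C`. Boundedness of these and of the derivatives of `u` therefore
propagates to every order. -/
theorem bddUpTo (s : Seed T u xi f) {K : Set ℝ} (hK : K ⊆ T) (hKc : IsCompact K) (p : ℕ) :
    BddUpTo K p (fun t x => f t x ^ 2 * (om (f t) (f t) x)⁻¹)
    ∧ BddUpTo K p (fun t x => f t x * deriv (f t) x * (om (f t) (f t) x)⁻¹)
    ∧ BddUpTo K p (fun t x => deriv (f t) x ^ 2 * (om (f t) (f t) x)⁻¹) := by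
  have hu : ∀ p, BddUpTo K p u := fun p =>
    ⟨fun t ht => s.smooth_u.contDiff_x (hK ht), fun q _ => s.bounded_u K hK hKc q⟩
  have cf := fun t ht => s.smooth.contDiff_x (hK ht) (t := t)
  have cd := fun t ht => contDiff_deriv_infty (cf t ht)
  have cG := fun t ht => s.contDiff_G (hK ht) (t := t)
  have base : BddUpTo K 0 (fun t x => f t x ^ 2 * (om (f t) (f t) x)⁻¹)
    ∧ BddUpTo K 0 (fun t x => f t x * deriv (f t) x * (om (f t) (f t) x)⁻¹)
    ∧ BddUpTo K 0 (fun t x => deriv (f t) x ^ 2 * (om (f t) (f t) x)⁻¹) := by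
    obtain ⟨C, hC0, hC⟩ := s.ratios hK hKc
    refine ⟨⟨fun t ht => ((cf t ht).pow 2).mul (cG t ht), ?_⟩,
      ⟨fun t ht => ((cf t ht).mul (cd t ht)).mul (cG t ht), ?_⟩,
      ⟨fun t ht => ((cd t ht).pow 2).mul (cG t ht), ?_⟩⟩ <;>
    · intro q hq
      obtain rfl : q = 0 := by omega
      refine ⟨C, fun t ht x hx => ?_⟩
      have hF := s.pos (hK ht) x
      have := hC t ht x hx
      rw [iteratedDeriv_zero]
      first
      | exact this.2.1
      | (rw [abs_of_nonneg (by positivity)]; first | exact this.1 | exact this.2.2)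
  induction p with
  | zero => exact base
  | succ p ih =>
    obtain ⟨hA, hB, hC⟩ := ih
    refine ⟨base.1.succ (((((BddUpTo.const 2).mul hB).add
        ((BddUpTo.const (-1)).mul (hA.mul hA)))).congr fun t ht => funext fun x => ?_),
      base.2.1.succ ((hC.add (((BddUpTo.const (-1)).mul
        (((BddUpTo.const xi).add (hu p)).mul hA)).add
        ((BddUpTo.const (-1)).mul (hA.mul hB)))).congr fun t ht => funext fun x => ?_),
      base.2.2.succ ((((BddUpTo.const (-2)).mul (((BddUpTo.const xi).add (hu p)).mul hB)).add
        ((BddUpTo.const (-1)).mul (hA.mul hC))).congr fun t ht => funext fun x => ?_)⟩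
    · rw [s.deriv_sq_mul_G (hK ht)]; ring
    · have := ((((s.smooth.hasDerivAt_x (hK ht) x).mul (hasDerivAt_of_smooth (cd t ht) x)).mul
        (s.hasDerivAt_G (hK ht) x))).deriv
      refine this.trans ?_
      rw [s.spectral t (hK ht)]
      simp only [Pi.mul_apply]
      ring
    · have := (((hasDerivAt_of_smooth (cd t ht) x).pow 2).mul (s.hasDerivAt_G (hK ht) x)).deriv
      refine this.trans ?_
      rw [s.spectral t (hK ht)]
      simp only [Pi.pow_apply]
      ring

theorem bounded_bdtPot (s : Seed T u xi f) : BoundedAtNegInfty T (bdtPot f u) := by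
  intro K hK hKc p
  obtain ⟨hA, hB, -⟩ := s.bddUpTo hK hKc p
  have hu : BddUpTo K p u :=
    ⟨fun t ht => s.smooth_u.contDiff_x (hK ht), fun q _ => s.bounded_u K hK hKc q⟩
  -- In the notation of the closed system, `u[1] = u + 4B - 2A²`.
  have h : BddUpTo K p (bdtPot f u) := (hu.add (((BddUpTo.const 4).mul hB).add
    ((BddUpTo.const (-2)).mul (hA.mul hA)))).congr fun t ht => funext fun x => by
      rw [bdtPot, s.deriv_sq_mul_G (hK ht)]; ring
  exact h.2 p le_rfl

/-- The quotient `∂⁻¹(f g) ∂⁻¹(f h) / ∂⁻¹(f²)` vanishes at `-∞`. -/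
theorem tendsto_ratio (s : Seed T u xi f) (p : Partner T u f lam g) (q : Partner T u f mu h)
    (hd : ProductDecays T g h) {t : ℝ} (ht : t ∈ T) :
    Tendsto (fun x => (om (f t) (f t) x)⁻¹ * om (f t) (g t) x * om (f t) (h t) x) atBot (𝓝 0) := by
  by_cases hl : lam = xi
  · subst hl
    obtain ⟨a, ha⟩ := s.exists_ne_zero ht
    have e : (fun x => (om (f t) (f t) x)⁻¹ * om (f t) (g t) x * om (f t) (h t) x)
        = fun x => g t a / f t a * om (f t) (h t) x := by
      funext x
      have hF := s.ne_zero t ht x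
      rw [s.om_proportional p ht ha]
      field_simp
    rw [e]
    simpa using (Decay.tendsto_om (f t) (h t)).const_mul (g t a / f t a)
  · have hne : xi - lam ≠ 0 := sub_ne_zero.2 (Ne.symm hl)
    obtain ⟨C, hC0, hC⟩ := s.ratio_om q (singleton_subset_iff.2 ht) isCompact_singleton
    have D := hd.decay p.smooth q.smooth ht
    have t00 := (D.tendsto 0 0).abs
    have t01 := (D.tendsto 0 1).abs
    have t10 := (D.tendsto 1 0).abs
    have t11 := (D.tendsto 1 1).abs
    simp only [iteratedDeriv_zero, iteratedDeriv_one, abs_zero, abs_mul] at t00 t01 t10 t11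
    have hlim := ((t00.add t01).add (t10.add t11)).const_mul (|xi - lam|⁻¹ * C)
    simp only [add_zero, mul_zero] at hlim
    refine squeeze_zero_norm' ?_ hlim
    filter_upwards [Iic_mem_atBot 0] with x hx
    obtain ⟨c1, c2⟩ := hC t rfl x hx
    have hom : om (f t) (g t) x
        = (xi - lam)⁻¹ * (f t x * deriv (g t) x - deriv (f t) x * g t x) := by
      rw [s.wronskian p ht x]; field_simp
    have e : (om (f t) (f t) x)⁻¹ * om (f t) (g t) x * om (f t) (h t) x
        = (xi - lam)⁻¹ * ((f t x * (om (f t) (f t) x)⁻¹ * om (f t) (h t) x) * deriv (g t) x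
          - (deriv (f t) x * (om (f t) (f t) x)⁻¹ * om (f t) (h t) x) * g t x) := by
      rw [hom]; ring
    rw [Real.norm_eq_abs, e, abs_mul, abs_inv, mul_assoc |xi - lam|⁻¹ C]
    refine mul_le_mul_of_nonneg_left ?_ (inv_nonneg.2 (abs_nonneg _))
    refine (abs_sub _ _).trans ?_
    rw [abs_mul _ (deriv (g t) x), abs_mul _ (g t x)]
    have m1 := mul_le_mul_of_nonneg_right c1 (abs_nonneg (deriv (g t) x))
    have m2 := mul_le_mul_of_nonneg_right c2 (abs_nonneg (g t x))
    linarith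

end Seed

end KdV

namespace KdV

open Set Filter Topology MeasureTheory

/-! ### Time evolution and smoothness of `∂⁻¹(f g)` -/

/-- The time evolution of the linear problem, with decaying source products. -/
structure LaxFlow (n : ℕ) {N : ℕ} (α η : ℝ) (T : Set ℝ) (u : ℝ → ℝ → ℝ)
    (φ : Fin N → ℝ → ℝ → ℝ) (lam : ℝ) (g : ℝ → ℝ → ℝ) : Prop where
  evolution : ∀ t ∈ T, ∀ x, deriv (fun s => g s x) t
    = locA n (u t) lam (g t) x + η * g t x + α * ∑ j, φ j t x * om (φ j t) (g t) x
  decays : ∀ j, ProductDecays T (φ j) g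

theorem tendsto_bounded_mul {c h : ℝ → ℝ} {C : ℝ} (hc : ∀ x ≤ 0, |c x| ≤ C)
    (hh : Tendsto h atBot (𝓝 0)) : Tendsto (fun x => c x * h x) atBot (𝓝 0) := by
  have hlim := (hh.abs).const_mul C
  rw [abs_zero, mul_zero] at hlim
  refine squeeze_zero_norm' ?_ hlim
  filter_upwards [Iic_mem_atBot 0] with x hx
  rw [Real.norm_eq_abs, abs_mul]
  exact mul_le_mul_of_nonneg_right (hc x hx) (abs_nonneg _)

/-- Grouped as bounded differential polynomials times decaying products, so that the limit at `-∞`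
is visible. -/
theorem omegaF_eq (n : ℕ) (u f g : ℝ → ℝ) (lam xi : ℝ) (x : ℝ) :
    omegaF n u lam xi f g x
      = evf (MvPolynomial.C (1 / 2) * D (D (CP lam xi n))
          + (MvPolynomial.C lam + MvPolynomial.X 0) * CP lam xi n + BP xi n) u x * (f x * g x)
        + evf (-(MvPolynomial.C (1 / 2) * D (CP lam xi n))) u x
          * (f x * deriv g x + deriv f x * g x)
        + evf (CP lam xi n) u x * (deriv f x * deriv g x) := by
  rw [omegaF]
  simp only [evf, map_add, map_neg, map_mul, MvPolynomial.eval_C, MvPolynomial.eval_X,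
    iteratedDeriv_zero]
  ring

namespace Seed

variable {n N : ℕ} {α η : ℝ} {T : Set ℝ} {u f g h : ℝ → ℝ → ℝ} {φ : Fin N → ℝ → ℝ → ℝ}
  {lams : Fin N → ℝ} {xi lam : ℝ}

/-- For `λ ≠ ξ` the integral is a Wronskian, hence smooth outright; for `λ = ξ` it is a multiple of
`∂⁻¹ f²` and exactly as regular. The order `k` is left free for the bootstrap in `om_self_strip`. -/
theorem om_strip_of_le (s : Seed T u xi f) {k : WithTop ℕ∞} (hk : k ≤ ∞)
    (hF : StripC k T fun t x => om (f t) (f t) x) (p : Partner T u f lam g) :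
    StripC k T fun t x => om (f t) (g t) x := by
  by_cases hl : lam = xi
  · subst hl
    refine StripC.of_contDiffAt fun t ht x => ?_
    obtain ⟨a, ha⟩ := s.exists_ne_zero ht
    -- The point `a` is chosen at time `t`; `f` stays nonzero there for nearby times, so one formula
    -- serves a whole neighbourhood.
    have hc : ContDiffAt ℝ k (fun q : ℝ × ℝ => g q.1 a / f q.1 a * om (f q.1) (f q.1) q.2)
        (t, x) := by
      have e1 : ContDiffAt ℝ k (fun q : ℝ × ℝ => g q.1 a) (t, x) :=
        ContDiffAt.comp (t, x) ((p.smooth.contDiffAt_t s.isOpen ht a).of_le hk) contDiffAt_fst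
      have e2 : ContDiffAt ℝ k (fun q : ℝ × ℝ => f q.1 a) (t, x) :=
        ContDiffAt.comp (t, x) ((s.smooth.contDiffAt_t s.isOpen ht a).of_le hk) contDiffAt_fst
      exact (e1.div e2 ha).mul (hF.contDiffAt s.isOpen ht x)
    refine hc.congr_of_eventuallyEq ?_
    have h1 : ∀ᶠ r in 𝓝 t, f r a ≠ 0 :=
      (s.smooth.hasDerivAt_t s.isOpen ht a).continuousAt.eventually_ne ha
    have h2 : ∀ᶠ q : ℝ × ℝ in 𝓝 (t, x), f q.1 a ≠ 0 ∧ q.1 ∈ T :=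
      (continuousAt_fst (p := (t, x))).eventually (h1.and (s.isOpen.mem_nhds ht))
    filter_upwards [h2] with q hq
    exact s.om_proportional p hq.2 hq.1 q.2
  · have hd : xi - lam ≠ 0 := sub_ne_zero.2 (Ne.symm hl)
    have h1 : StripC ∞ T fun t x =>
        (xi - lam)⁻¹ * (f t x * deriv (g t) x - deriv (f t) x * g t x) :=
      (StripC.const _).mul ((s.smooth.mul (p.smooth.deriv_x s.isOpen)).sub
        ((s.smooth.deriv_x s.isOpen).mul p.smooth))
    refine (h1.of_le hk).congr fun t ht x => ?_
    rw [s.wronskian p ht x]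
    field_simp

/-- A time derivative multiplied by a function has an integrable majorant. -/
theorem _root_.KdV.LaxFlow.dominated (hL : LaxFlow n α η T u φ lam g)
    (hb : BoundedAtNegInfty T u) (hhg : ProductDecays T h g)
    (hhφ : ∀ j, ProductDecays T (φ j) h) {K : Set ℝ} (hK : K ⊆ T) (hKc : IsCompact K) :
    ∃ G : ℝ → ℝ, IntegrableOn G (Iic 0) ∧
      ∀ t ∈ K, ∀ x ≤ 0, |h t x * deriv (fun r => g r x) t| ≤ G x := by
  obtain ⟨A, hA0, hA⟩ := bounded_evf hb hK hKc (BP lam n)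
  obtain ⟨B, hB0, hB⟩ := bounded_evf hb hK hKc (D (BP lam n))
  obtain ⟨G0, i0, b0⟩ := hhg K hK hKc 0 0
  obtain ⟨G1, i1, b1⟩ := hhg K hK hKc 0 1
  have hc := fun j => hL.decays j K hK hKc 0 0
  choose Gc ic bc using hc
  have he := fun j => hhφ j K hK hKc 0 0
  choose Ge ie be using he
  refine ⟨fun x => A * G1 x + (B + |η|) * G0 x
      + |α| * ∑ j, Ge j x * ∫ y in Iic 0, Gc j y, ?_, fun t ht x hx => ?_⟩
  · refine ((i1.const_mul _).add (i0.const_mul _)).add (Integrable.const_mul ?_ _)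
    exact integrable_finsetSum _ fun j _ => (ie j).mul_const _
  · have c0 := b0 t ht x hx
    have c1 := b1 t ht x hx
    simp only [iteratedDeriv_zero, iteratedDeriv_one] at c0 c1
    -- In the source terms the integral factor is bounded by the total mass of a majorant, and `φ_j
    -- h` supplies the integrability.
    have hom : ∀ j, |om (φ j t) (g t) x| ≤ ∫ y in Iic 0, Gc j y := by
      intro j
      have h1 : ‖∫ y in Iic x, φ j t y * g t y‖ ≤ ∫ y in Iic x, Gc j y := by
        refine norm_integral_le_of_norm_le ((ic j).mono_set (Iic_subset_Iic.2 hx)) ?_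
        refine (ae_restrict_iff' measurableSet_Iic).2 (Eventually.of_forall fun y hy => ?_)
        have := bc j t ht y (le_trans hy hx)
        simpa using this
      refine h1.trans (setIntegral_mono_set (ic j) ?_ (Iic_subset_Iic.2 hx).eventuallyLE)
      refine (ae_restrict_iff' measurableSet_Iic).2 (Eventually.of_forall fun y hy => ?_)
      exact (abs_nonneg _).trans (bc j t ht y hy)
    rw [hL.evolution t (hK ht), locA]
    have e : h t x * (evf (BP lam n) (u t) x * deriv (g t) x
          - 1 / 2 * evf (D (BP lam n)) (u t) x * g t x + η * g t x
          + α * ∑ j, φ j t x * om (φ j t) (g t) x)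
        = evf (BP lam n) (u t) x * (h t x * deriv (g t) x)
          + (-(1 / 2) * evf (D (BP lam n)) (u t) x + η) * (h t x * g t x)
          + α * ∑ j, (φ j t x * h t x) * om (φ j t) (g t) x := by
      have : h t x * (α * ∑ j, φ j t x * om (φ j t) (g t) x)
          = α * ∑ j, (φ j t x * h t x) * om (φ j t) (g t) x := by
        rw [mul_left_comm, Finset.mul_sum]
        congr 1
        exact Finset.sum_congr rfl fun j _ => by ring
      rw [mul_add, this]
      ring
    rw [e]
    refine (abs_add_three _ _ _).trans (add_le_add (add_le_add ?_ ?_) ?_)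
    · rw [abs_mul]
      exact mul_le_mul (hA t ht x hx) c1 (abs_nonneg _) hA0
    · rw [abs_mul]
      refine mul_le_mul ?_ c0 (abs_nonneg _) (by positivity)
      refine (abs_add_le _ _).trans (add_le_add ?_ le_rfl)
      rw [abs_mul]
      have := hB t ht x hx
      rw [show |(-(1 / 2) : ℝ)| = 1 / 2 by norm_num]
      linarith [abs_nonneg (evf (D (BP lam n)) (u t) x)]
    · rw [abs_mul]
      refine mul_le_mul_of_nonneg_left ((Finset.abs_sum_le_sum_abs _ _).trans
        (Finset.sum_le_sum fun j _ => ?_)) (abs_nonneg _)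
      rw [abs_mul]
      have c2 := be j t ht x hx
      simp only [iteratedDeriv_zero] at c2
      exact mul_le_mul c2 (hom j) (abs_nonneg _) ((abs_nonneg _).trans c2)

/-- The time derivative of `∂⁻¹(f g)`. -/
theorem hasDerivAt_om_t (s : Seed T u xi f) (p : Partner T u f lam g)
    (hφ : ∀ j, Partner T u f (lams j) (φ j)) (hf : LaxFlow n α η T u φ xi f)
    (hg : LaxFlow n α η T u φ lam g) {t : ℝ} (ht : t ∈ T) (x : ℝ) :
    HasDerivAt (fun r => om (f r) (g r) x)
      (2 * η * om (f t) (g t) x + omegaF n (u t) lam xi (f t) (g t) x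
        + α * ∑ j, om (φ j t) (f t) x * om (φ j t) (g t) x) t := by
  obtain ⟨ε, hε, hball⟩ := Metric.isOpen_iff.1 s.isOpen t ht
  have hK : Metric.closedBall t (ε / 2) ⊆ T :=
    (Metric.closedBall_subset_ball (by linarith)).trans hball
  have hKc : IsCompact (Metric.closedBall t (ε / 2)) := isCompact_closedBall t (ε / 2)
  obtain ⟨G1, i1, b1⟩ := hg.dominated s.bounded_u p.decays hf.decays hK hKc
  obtain ⟨G2, i2, b2⟩ := hf.dominated s.bounded_u p.decays.symm hg.decays hK hKc
  set E : ℝ → ℝ → ℝ := fun r y =>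
    f r y * deriv (fun r => g r y) r + g r y * deriv (fun r => f r y) r with hE
  have hEs : StripC ∞ T E := (s.smooth.mul (p.smooth.deriv_t s.isOpen)).add
    (p.smooth.mul (s.smooth.deriv_t s.isOpen))
  obtain ⟨M, hM⟩ := (hKc.prod (isCompact_Icc (a := 0) (b := x))).exists_bound_of_continuousOn
    (hEs.continuousOn.mono (prod_mono hK (subset_univ _)))
  -- The majorant combines the decay estimates on `y ≤ 0` with a compactness bound on `[0, x]`.
  have hbound : ∀ y ∈ Iic x, ∀ r ∈ Metric.closedBall t (ε / 2), ‖E r y‖ ≤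
      (Iic 0).indicator (fun y => G1 y + G2 y) y + (Icc 0 x).indicator (fun _ => |M|) y := by
    intro y hy r hr
    rcases le_total y 0 with h0 | h0
    · rw [indicator_of_mem (show y ∈ Iic 0 from h0)]
      have h1 : 0 ≤ (Icc 0 x).indicator (fun _ => |M|) y :=
        indicator_nonneg (fun _ _ => abs_nonneg M) y
      have h2 := b1 r hr y h0
      have h3 := b2 r hr y h0
      rw [Real.norm_eq_abs]
      have h4 := abs_add_le (f r y * deriv (fun r => g r y) r) (g r y * deriv (fun r => f r y) r)
      simp only [hE]
      linarith
    · have h1 : 0 ≤ (Iic 0).indicator (fun y => G1 y + G2 y) y :=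
        indicator_nonneg (fun y hy => add_nonneg ((abs_nonneg _).trans (b1 r hr y hy))
          ((abs_nonneg _).trans (b2 r hr y hy))) y
      rw [indicator_of_mem (show y ∈ Icc 0 x from ⟨h0, hy⟩)]
      have h2 := (hM (r, y) ⟨hr, h0, hy⟩).trans (le_abs_self M)
      simp only at h2
      linarith
  have key := hasDerivAt_integral_of_dominated_loc_of_deriv_le (μ := volume.restrict (Iic x))
    (F := fun r y => f r y * g r y) (F' := E) (x₀ := t)
    (Metric.closedBall_mem_nhds t (by linarith : 0 < ε / 2))
    (by
      filter_upwards [s.isOpen.mem_nhds ht] with r hr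
      exact ((s.smooth.contDiff_x hr).continuous.mul
        (p.smooth.contDiff_x hr).continuous).aestronglyMeasurable)
    ((s.decay p ht).integrableOn_zero x) (hEs.contDiff_x ht).continuous.aestronglyMeasurable
    ((ae_restrict_iff' measurableSet_Iic).2 (Eventually.of_forall hbound))
    (((integrable_indicator_iff measurableSet_Iic).2 (i1.add i2)).integrableOn.add
      ((integrable_indicator_iff measurableSet_Icc).2
        (integrableOn_const (by simp))).integrableOn)
    ((ae_restrict_iff' measurableSet_Iic).2 (Eventually.of_forall fun y _ r hr => by
      refine ((s.smooth.hasDerivAt_t s.isOpen (hK hr) y).mul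
        (p.smooth.hasDerivAt_t s.isOpen (hK hr) y)).congr_deriv ?_
      simp only [hE]
      ring))
  refine key.2.congr_deriv ?_
  have hφf := fun j => (hf.decays j).decay (hφ j).smooth s.smooth ht
  have hφg := fun j => (hg.decays j).decay (hφ j).smooth p.smooth ht
  -- The differentiated integrand has an explicit antiderivative; it vanishes at `-∞` by `hlim`, so
  -- no constant of integration appears.
  have hder : ∀ y ∈ Iic x, HasDerivAt (fun y => 2 * η * om (f t) (g t) y
      + omegaF n (u t) lam xi (f t) (g t) y
      + α * ∑ j, om (φ j t) (f t) y * om (φ j t) (g t) y) (E t y) y := by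
    intro y _
    have d1 := ((s.decay p ht).hasDerivAt_om y).const_mul (2 * η)
    have d2 := hasDerivAt_omegaF (n := n) (s.smooth_u.contDiff_x ht) (s.smooth.contDiff_x ht)
      (p.smooth.contDiff_x ht) (s.spectral t ht) (p.spectral t ht) y
    have d3 := (HasDerivAt.fun_sum fun j (_ : j ∈ Finset.univ) =>
      ((hφf j).hasDerivAt_om y).mul ((hφg j).hasDerivAt_om y)).const_mul α
    refine ((d1.add d2).add d3).congr_deriv ?_
    simp only [hE]
    rw [hf.evolution t ht, hg.evolution t ht]
    have e : ∑ j, (φ j t y * f t y * om (φ j t) (g t) y + om (φ j t) (f t) y * (φ j t y * g t y))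
        = f t y * ∑ j, φ j t y * om (φ j t) (g t) y
          + g t y * ∑ j, φ j t y * om (φ j t) (f t) y := by
      rw [Finset.mul_sum, Finset.mul_sum, ← Finset.sum_add_distrib]
      exact Finset.sum_congr rfl fun j _ => by ring
    rw [e]
    ring
  have hlim : Tendsto (fun y => 2 * η * om (f t) (g t) y
      + omegaF n (u t) lam xi (f t) (g t) y
      + α * ∑ j, om (φ j t) (f t) y * om (φ j t) (g t) y) atBot (𝓝 0) := by
    have l1 := (Decay.tendsto_om (f t) (g t)).const_mul (2 * η)
    have l3 := (tendsto_finsetSum (Finset.univ) fun j (_ : j ∈ Finset.univ) =>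
      (Decay.tendsto_om (φ j t) (f t)).mul (Decay.tendsto_om (φ j t) (g t))).const_mul α
    have hsub : ({t} : Set ℝ) ⊆ T := singleton_subset_iff.2 ht
    have l2 : Tendsto (omegaF n (u t) lam xi (f t) (g t)) atBot (𝓝 0) := by
      rw [show omegaF n (u t) lam xi (f t) (g t) = _ from
        funext (omegaF_eq n (u t) (f t) (g t) lam xi)]
      have hD := s.decay p ht
      have t00 := hD.tendsto 0 0
      have t01 := hD.tendsto 0 1
      have t10 := hD.tendsto 1 0
      have t11 := hD.tendsto 1 1
      simp only [iteratedDeriv_zero, iteratedDeriv_one] at t00 t01 t10 t11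
      obtain ⟨C1, -, h1⟩ := bounded_evf s.bounded_u hsub isCompact_singleton
        (MvPolynomial.C (1 / 2) * D (D (CP lam xi n))
          + (MvPolynomial.C lam + MvPolynomial.X 0) * CP lam xi n + BP xi n)
      obtain ⟨C2, -, h2⟩ := bounded_evf s.bounded_u hsub isCompact_singleton
        (-(MvPolynomial.C (1 / 2) * D (CP lam xi n)))
      obtain ⟨C3, -, h3⟩ := bounded_evf s.bounded_u hsub isCompact_singleton (CP lam xi n)
      have m1 := tendsto_bounded_mul (h1 t rfl) t00
      have m2 := tendsto_bounded_mul (h2 t rfl) (by simpa using t01.add t10)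
      have m3 := tendsto_bounded_mul (h3 t rfl) t11
      simpa using (m1.add m2).add m3
    simpa using (l1.add l2).add l3
  have := integral_Iic_of_hasDerivAt_of_tendsto' hder key.1 hlim
  rw [sub_zero] at this
  exact this

/-- `∂⁻¹ f²` is smooth on the strip. -/
theorem om_self_strip (s : Seed T u xi f) (hφ : ∀ j, Partner T u f (lams j) (φ j))
    (hf : LaxFlow n α η T u φ xi f) : StripC ∞ T fun t x => om (f t) (f t) x := by
  have hQ : StripC ∞ T fun t x => f t x * f t x := s.smooth.mul s.smooth
  have hx : ∀ t ∈ T, ∀ x, HasDerivAt (fun x => om (f t) (f t) x) (f t x * f t x) x :=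
    fun t ht x => (s.decay s.partner ht).hasDerivAt_om x
  -- Bootstrap: the `x`-derivative `f²` is smooth, and the `t`-derivative involves, besides smooth
  -- terms, only `∂⁻¹ f²` and the `∂⁻¹(φ_j f)`, which are as regular as `∂⁻¹ f²`.
  have key : ∀ k : ℕ, StripC k T fun t x => om (f t) (f t) x := by
    intro k
    induction k with
    | zero =>
      exact StripC.zero_of_partial s.isOpen
        (fun t ht x => (s.hasDerivAt_om_t s.partner hφ hf hf ht x).continuousAt) hx
        (hQ.of_le (by simp))
    | succ k ih =>
      have hk : (k : WithTop ℕ∞) ≤ ∞ := by exact_mod_cast le_top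
      refine StripC.succ_of_partial s.isOpen
        (fun t ht x => s.hasDerivAt_om_t s.partner hφ hf hf ht x) hx ?_ (hQ.of_le hk)
      have hσ : ∀ j, StripC k T fun t x => om (φ j t) (f t) x := fun j =>
        (s.om_strip_of_le hk ih (hφ j)).congr fun t _ x => by rw [om_comm]
      exact (((StripC.const (2 * η)).mul ih).add ((StripC.omegaF n xi xi s.smooth_u s.smooth
        s.smooth s.isOpen).of_le hk)).add ((StripC.const α).mul
          (StripC.sum fun j _ => (hσ j).mul (hσ j)))
  exact contDiffOn_infty.2 key

end Seed

end KdV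

/-! ### One step: transformed integrals, linear problem and KdV equation -/

namespace KdV

open Set Filter Topology MeasureTheory

namespace Seed

variable {n N : ℕ} {α η : ℝ} {T : Set ℝ} {u f g h : ℝ → ℝ → ℝ} {φ : Fin N → ℝ → ℝ → ℝ}
  {lams : Fin N → ℝ} {xi lam mu : ℝ}

theorem smooth_bdt (s : Seed T u xi f) (hF : StripC ∞ T fun t x => om (f t) (f t) x)
    (p : Partner T u f lam g) : StripC ∞ T (bdt f g) :=
  p.smooth.sub ((s.smooth.mul (hF.inv s.ne_zero)).mul (s.om_strip_of_le le_rfl hF p))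

theorem smooth_sq_mul_G (s : Seed T u xi f) (hF : StripC ∞ T fun t x => om (f t) (f t) x) :
    StripC ∞ T fun t x => f t x ^ 2 * (om (f t) (f t) x)⁻¹ :=
  (s.smooth.pow 2).mul (hF.inv s.ne_zero)

theorem smooth_bdtPot (s : Seed T u xi f) (hF : StripC ∞ T fun t x => om (f t) (f t) x) :
    StripC ∞ T (bdtPot f u) :=
  s.smooth_u.add ((StripC.const 2).mul ((s.smooth_sq_mul_G hF).deriv_x s.isOpen))

theorem decays_bdt (s : Seed T u xi f) (hF : StripC ∞ T fun t x => om (f t) (f t) x)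
    (p : Partner T u f lam g) (q : Partner T u f mu h) (hd : ProductDecays T g h) :
    ProductDecays T (bdt f g) (bdt f h) :=
  hd.of_dominated (s.smooth_bdtPot hF) s.bounded_bdtPot (s.smooth_bdt hF p) (s.spectral_bdt p)
    (s.smooth_bdt hF q) (s.spectral_bdt q) (fun _ hK hKc => s.bdt_le p hK hKc)
    (fun _ hK hKc => s.bdt_le q hK hKc)

/-- The transformed integrals of products. -/
theorem om_bdt (s : Seed T u xi f) (hF : StripC ∞ T fun t x => om (f t) (f t) x)
    (p : Partner T u f lam g) (q : Partner T u f mu h) (hd : ProductDecays T g h) {t : ℝ}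
    (ht : t ∈ T) (x : ℝ) :
    om (bdt f g t) (bdt f h t) x = om (g t) (h t) x
      - (om (f t) (f t) x)⁻¹ * om (f t) (g t) x * om (f t) (h t) x := by
  have hder : ∀ y ∈ Iic x, HasDerivAt (fun y => om (g t) (h t) y
      - (om (f t) (f t) y)⁻¹ * om (f t) (g t) y * om (f t) (h t) y)
      (bdt f g t y * bdt f h t y) y := by
    intro y _
    refine (((hd.decay p.smooth q.smooth ht).hasDerivAt_om y).sub
      (((s.hasDerivAt_G ht y).mul ((s.decay p ht).hasDerivAt_om y)).mul
        ((s.decay q ht).hasDerivAt_om y))).congr_deriv ?_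
    simp only [bdt, Pi.mul_apply]
    ring
  have hint := ((s.decays_bdt hF p q hd).decay (s.smooth_bdt hF p)
    (s.smooth_bdt hF q) ht).integrableOn_zero x
  -- The proposed antiderivative vanishes at `-∞`; for the quotient this needs `tendsto_ratio`,
  -- since its denominator tends to 0 as well.
  have hlim := (Decay.tendsto_om (g t) (h t)).sub (s.tendsto_ratio p q hd ht)
  rw [sub_zero] at hlim
  have := integral_Iic_of_hasDerivAt_of_tendsto' hder hint hlim
  rw [sub_zero] at this
  exact this

/-- Product rule for `g - f w / F`. The `Ω` terms are those of `locA_binary`, the source terms those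
of the expansion of `om_bdt`, and in the correction term the `η` contributions add up to `1 - 2 + 2
= 1`. -/
theorem flow_bdt (s : Seed T u xi f) (hφ : ∀ j, Partner T u f (lams j) (φ j))
    (hf : LaxFlow n α η T u φ xi f) (p : Partner T u f lam g)
    (hg : LaxFlow n α η T u φ lam g) :
    LaxFlow n α η T (bdtPot f u) (fun j => bdt f (φ j)) lam (bdt f g) := by
  have hF := s.om_self_strip hφ hf
  refine ⟨fun t ht x => ?_, fun j => s.decays_bdt hF (hφ j) p (hg.decays j)⟩
  have d1 := p.smooth.hasDerivAt_t s.isOpen ht x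
  have d2 := s.smooth.hasDerivAt_t s.isOpen ht x
  have d3 := (s.hasDerivAt_om_t s.partner hφ hf hf ht x).inv (s.ne_zero t ht x)
  have d4 := s.hasDerivAt_om_t p hφ hf hg ht x
  refine ((d1.sub ((d2.mul d3).mul d4)).deriv).trans ?_
  have hloc := locA_binary (n := n) (lam := lam) (s.smooth_u.contDiff_x ht)
    (s.smooth.contDiff_x ht) (s.contDiff_G ht) (p.smooth.contDiff_x ht) (s.decay p ht).contDiff_om
    (s.spectral t ht) (s.deriv_G ht) (fun y => ((s.decay p ht).hasDerivAt_om y).deriv)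
    (s.wronskian p ht) x
  change locA n (bdtPot f u t) lam (bdt f g t) x = _ at hloc
  rw [hloc, hg.evolution t ht, hf.evolution t ht]
  have e : ∑ j, bdt f (φ j) t x * om (bdt f (φ j) t) (bdt f g t) x
      = ∑ j, φ j t x * om (φ j t) (g t) x
        - (om (f t) (f t) x)⁻¹ * om (f t) (g t) x * ∑ j, φ j t x * om (φ j t) (f t) x
        - f t x * (om (f t) (f t) x)⁻¹ * ∑ j, om (φ j t) (f t) x * om (φ j t) (g t) x
        + f t x * (om (f t) (f t) x)⁻¹ ^ 2 * om (f t) (g t) x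
          * ∑ j, om (φ j t) (f t) x * om (φ j t) (f t) x := by
    simp only [Finset.mul_sum]
    rw [← Finset.sum_sub_distrib, ← Finset.sum_sub_distrib, ← Finset.sum_add_distrib]
    refine Finset.sum_congr rfl fun j _ => ?_
    rw [s.om_bdt hF (hφ j) p (hg.decays j) ht, bdt, om_comm (φ j t) (f t)]
    ring
  rw [e, bdt]
  have hne := s.ne_zero t ht x
  -- With the local and source expressions made opaque, a rational identity remains.
  generalize locA n (u t) lam (g t) x = a1
  generalize locA n (u t) xi (f t) x = a2
  generalize omegaF n (u t) lam xi (f t) (g t) x = a3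
  generalize omegaF n (u t) xi xi (f t) (f t) x = a4
  generalize ∑ j, φ j t x * om (φ j t) (g t) x = a5
  generalize ∑ j, φ j t x * om (φ j t) (f t) x = a6
  generalize ∑ j, om (φ j t) (f t) x * om (φ j t) (g t) x = a7
  generalize ∑ j, om (φ j t) (f t) x * om (φ j t) (f t) x = a8
  simp only [Pi.mul_apply, Pi.inv_apply]
  field_simp
  ring

/-- Here `(ln F)_t = 2 η + B` with `B = (Ω(f, f) + α ∑ (∂⁻¹(φ_j f))²)/F`, so `u[1]_t = u_t + 2
B_xx`. The flux changes by `2 B_x` as well: the `Ω` part comes from `b_{n+2}(u[1])`, the rest from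
`φ_j[1]² = φ_j² - ∂((∂⁻¹(φ_j f))²/F)`. -/
theorem evolution_bdtPot (s : Seed T u xi f) (hφ : ∀ j, Partner T u f (lams j) (φ j))
    (hf : LaxFlow n α η T u φ xi f)
    (hev : ∀ t ∈ T, ∀ x, deriv (fun r => u r x) t
      = deriv (fun y => -2 * evf (b (n + 2)) (u t) y - 2 * α * ∑ j, φ j t y ^ 2) x)
    {t : ℝ} (ht : t ∈ T) (x : ℝ) : deriv (fun r => bdtPot f u r x) t
      = deriv (fun y => -2 * evf (b (n + 2)) (bdtPot f u t) y
        - 2 * α * ∑ j, bdt f (φ j) t y ^ 2) x := by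
  have hF := s.om_self_strip hφ hf
  have hl := s.smooth_sq_mul_G hF
  have cu := s.smooth_u.contDiff_x ht
  have cf := s.smooth.contDiff_x ht
  have hφf := fun j => (hf.decays j).decay (hφ j).smooth s.smooth ht
  -- the flux of `∂⁻¹ f²`, divided by `∂⁻¹ f²`
  set B : ℝ → ℝ := fun y => (omegaF n (u t) xi xi (f t) (f t) y
    + α * ∑ j, om (φ j t) (f t) y * om (φ j t) (f t) y) * (om (f t) (f t) y)⁻¹ with hB
  have cB : ContDiff ℝ ∞ B :=
    ((contDiff_omegaF cu cf cf).add (contDiff_const.mul (ContDiff.sum fun j _ =>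
      (hφf j).contDiff_om.mul (hφf j).contDiff_om))).mul (s.contDiff_G ht)
  have hBd : ∀ y, HasDerivAt B ((2 * f t y * locA n (u t) xi (f t) y
      + 2 * α * f t y * ∑ j, φ j t y * om (φ j t) (f t) y) * (om (f t) (f t) y)⁻¹
      - (omegaF n (u t) xi xi (f t) (f t) y
        + α * ∑ j, om (φ j t) (f t) y * om (φ j t) (f t) y)
        * (f t y ^ 2 * (om (f t) (f t) y)⁻¹ ^ 2)) y := by
    intro y
    have d2 := hasDerivAt_omegaF (n := n) cu cf cf (s.spectral t ht) (s.spectral t ht) y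
    have d3 := (HasDerivAt.fun_sum fun j (_ : j ∈ Finset.univ) =>
      ((hφf j).hasDerivAt_om y).mul ((hφf j).hasDerivAt_om y)).const_mul α
    refine ((d2.add d3).mul (s.hasDerivAt_G ht y)).congr_deriv ?_
    have e : ∑ j, (φ j t y * f t y * om (φ j t) (f t) y + om (φ j t) (f t) y * (φ j t y * f t y))
        = 2 * f t y * ∑ j, φ j t y * om (φ j t) (f t) y := by
      rw [Finset.mul_sum]
      exact Finset.sum_congr rfl fun j _ => by ring
    simp only [Pi.add_apply, Pi.mul_apply]
    rw [e]
    ring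
  -- This is `∂_t ∂ ln F = ∂ B`; the contribution `2 η` of the normalisation is constant in `x` and
  -- drops out.
  have hlt : ∀ y, deriv (fun r => f r y ^ 2 * (om (f r) (f r) y)⁻¹) t = deriv B y := by
    intro y
    rw [(hBd y).deriv]
    have d3 := (s.hasDerivAt_om_t s.partner hφ hf hf ht y).inv (s.ne_zero t ht y)
    refine ((((s.smooth.hasDerivAt_t s.isOpen ht y).pow 2).mul d3).deriv).trans ?_
    rw [hf.evolution t ht]
    have hne := s.ne_zero t ht y
    generalize locA n (u t) xi (f t) y = a2
    generalize omegaF n (u t) xi xi (f t) (f t) y = a4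
    generalize ∑ j, φ j t y * om (φ j t) (f t) y = a6
    generalize ∑ j, om (φ j t) (f t) y * om (φ j t) (f t) y = a8
    simp only [Pi.pow_apply, Pi.inv_apply]
    field_simp
    push_cast
    ring
  have hlhs : deriv (fun r => bdtPot f u r x) t
      = deriv (fun r => u r x) t + 2 * deriv (deriv B) x := by
    have d1 := s.smooth_u.hasDerivAt_t s.isOpen ht x
    have d2 := (hl.deriv_x s.isOpen).hasDerivAt_t s.isOpen ht x
    refine (d1.add (d2.const_mul 2)).deriv.trans ?_
    rw [hl.deriv_comm s.isOpen ht x, show (fun y => deriv (fun r => f r y ^ 2 *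
      (om (f r) (f r) y)⁻¹) t) = deriv B from funext hlt]
  have hrhs : (fun y => -2 * evf (b (n + 2)) (bdtPot f u t) y
        - 2 * α * ∑ j, bdt f (φ j) t y ^ 2)
      = fun y => (-2 * evf (b (n + 2)) (u t) y - 2 * α * ∑ j, φ j t y ^ 2) + 2 * deriv B y := by
    funext y
    have h1 := evf_b_binary (n := n) cu cf (s.contDiff_G ht) (s.spectral t ht) (s.deriv_G ht) y
    change evf (b (n + 2)) (bdtPot f u t) y = _ at h1
    have d2 := (hasDerivAt_omegaF (n := n) cu cf cf (s.spectral t ht) (s.spectral t ht) y).mul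
      (s.hasDerivAt_G ht y)
    rw [h1, (hBd y).deriv, show deriv (fun y => omegaF n (u t) xi xi (f t) (f t) y
      * (om (f t) (f t) y)⁻¹) y = _ from d2.deriv]
    have e : ∑ j, bdt f (φ j) t y ^ 2 = ∑ j, φ j t y ^ 2
        - 2 * f t y * (om (f t) (f t) y)⁻¹ * ∑ j, φ j t y * om (φ j t) (f t) y
        + f t y ^ 2 * (om (f t) (f t) y)⁻¹ ^ 2
          * ∑ j, om (φ j t) (f t) y * om (φ j t) (f t) y := by
      simp only [Finset.mul_sum]
      rw [← Finset.sum_sub_distrib, ← Finset.sum_add_distrib]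
      refine Finset.sum_congr rfl fun j _ => ?_
      rw [bdt, om_comm (φ j t) (f t)]
      ring
    rw [e]
    ring
  rw [hlhs, hrhs, hev t ht]
  have c1 : ContDiff ℝ ∞ fun y => -2 * evf (b (n + 2)) (u t) y - 2 * α * ∑ j, φ j t y ^ 2 :=
    (contDiff_const.mul (contDiff_evf cu _)).sub (contDiff_const.mul
      (ContDiff.sum fun j _ => ((hφ j).smooth.contDiff_x ht).pow 2))
  exact ((hasDerivAt_of_smooth c1 x).add
    ((hasDerivAt_of_smooth (contDiff_deriv_infty cB) x).const_mul 2)).deriv.symm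

end Seed

end KdV

namespace KdV

open Set Filter Topology MeasureTheory

/-! ### Determinants -/

/-- Subtracting multiples of the first row clears the first column below the pivot; expanding along
that column leaves the Schur complement. -/
theorem det_schur {k : ℕ} (M : Matrix (Fin (k + 1)) (Fin (k + 1)) ℝ) (h : M 0 0 ≠ 0) :
    M.det = M 0 0 * (Matrix.of fun i j : Fin k =>
      M i.succ j.succ - M i.succ 0 * (M 0 0)⁻¹ * M 0 j.succ).det := by
  set B : Matrix (Fin (k + 1)) (Fin (k + 1)) ℝ :=
    Matrix.of fun i j => M i j - (if i = 0 then 0 else M i 0 * (M 0 0)⁻¹) * M 0 j with hB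
  have hMB : M.det = B.det := by
    refine Matrix.det_eq_of_forall_row_eq_smul_add_const
      (fun i => if i = 0 then 0 else M i 0 * (M 0 0)⁻¹) 0 (if_pos rfl) fun i j => ?_
    simp only [hB, Matrix.of_apply, if_true, zero_mul, sub_zero, sub_add_cancel]
  rw [hMB, Matrix.det_succ_column_zero, Fin.sum_univ_succ, Finset.sum_eq_zero, add_zero]
  · have e0 : B 0 0 = M 0 0 := by simp [hB]
    rw [e0, Fin.val_zero, pow_zero, one_mul]
    congr 2
  · intro i _
    have : B i.succ 0 = 0 := by simp [hB, Fin.succ_ne_zero, h]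
    rw [this, mul_zero, zero_mul]

theorem W1_eq {k : ℕ} (g : Fin k → ℝ → ℝ → ℝ) (t x : ℝ) :
    W1 g t x = (Matrix.of fun i j : Fin k => om (g i t) (g j t) x).det := rfl

theorem W2_eq {k : ℕ} (g : Fin (k + 1) → ℝ → ℝ → ℝ) (t x : ℝ) :
    W2 g t x = (Matrix.of fun i j : Fin (k + 1) =>
      if i = Fin.last k then g j t x else om (g i t) (g j t) x).det := rfl

theorem contDiff_W1 {k : ℕ} {g : Fin k → ℝ → ℝ → ℝ} {t : ℝ}
    (h : ∀ i j, ContDiff ℝ ∞ (om (g i t) (g j t))) : ContDiff ℝ ∞ (W1 g t) := by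
  have e : W1 g t = fun x => (Matrix.of fun i j : Fin k => om (g i t) (g j t) x).det := rfl
  rw [e]
  simp only [Matrix.det_apply, Matrix.of_apply]
  exact ContDiff.sum fun σ _ => (contDiff_prod fun i _ => h _ _).const_smul (Equiv.Perm.sign σ)

theorem W1_succ {k : ℕ} {g : Fin (k + 1) → ℝ → ℝ → ℝ} {g' : Fin k → ℝ → ℝ → ℝ} {t x : ℝ}
    (h0 : om (g 0 t) (g 0 t) x ≠ 0)
    (H : ∀ i j, om (g' i t) (g' j t) x = om (g i.succ t) (g j.succ t) x
      - (om (g 0 t) (g 0 t) x)⁻¹ * om (g 0 t) (g i.succ t) x * om (g 0 t) (g j.succ t) x) :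
    W1 g t x = om (g 0 t) (g 0 t) x * W1 g' t x := by
  rw [W1_eq, W1_eq, det_schur _ h0]
  congr 2
  ext i j
  simp only [Matrix.of_apply]
  rw [H, om_comm (g i.succ t) (g 0 t)]
  ring

/-- In the last row the Schur complement is the transformation itself. That row contains no
integrals, so the relation for integrals is required only for the other rows. -/
theorem W2_succ {k : ℕ} {g : Fin (k + 2) → ℝ → ℝ → ℝ} {g' : Fin (k + 1) → ℝ → ℝ → ℝ} {t x : ℝ}
    (h0 : om (g 0 t) (g 0 t) x ≠ 0)
    (H : ∀ i j, i ≠ Fin.last k → om (g' i t) (g' j t) x = om (g i.succ t) (g j.succ t) x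
      - (om (g 0 t) (g 0 t) x)⁻¹ * om (g 0 t) (g i.succ t) x * om (g 0 t) (g j.succ t) x)
    (H' : ∀ j, g' j t x = bdt (g 0) (g j.succ) t x) :
    W2 g t x = om (g 0 t) (g 0 t) x * W2 g' t x := by
  have hl : (0 : Fin (k + 2)) ≠ Fin.last (k + 1) := (Fin.last_pos).ne
  have h0' : (Matrix.of fun i j : Fin (k + 2) =>
      if i = Fin.last (k + 1) then g j t x else om (g i t) (g j t) x) 0 0
      = om (g 0 t) (g 0 t) x := by simp only [Matrix.of_apply, if_neg hl]
  rw [W2_eq, W2_eq, det_schur _ (by rw [h0']; exact h0), h0']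
  congr 2
  ext i j
  simp only [Matrix.of_apply, if_neg hl]
  by_cases hi : i = Fin.last k
  · have hi' : i.succ = Fin.last (k + 1) := by rw [hi, Fin.succ_last]
    rw [if_pos hi, if_pos hi', if_pos hi', H', bdt]
  · have hi' : i.succ ≠ Fin.last (k + 1) := by
      rw [← Fin.succ_last]
      exact fun h => hi (Fin.succ_injective _ h)
    rw [if_neg hi, if_neg hi', if_neg hi', H i j hi, om_comm (g i.succ t) (g 0 t)]
    ring

/-! ### One step of the iteration -/

theorem Dinv_sq (f : ℝ → ℝ → ℝ) (t : ℝ) : Dinv (fun s y => f s y ^ 2) t = om (f t) (f t) := by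
  funext x
  simp only [Dinv, om, pow_two]

theorem binaryDT_eq (f g : ℝ → ℝ → ℝ) : binaryDT f g = bdt f g := by
  funext t x
  rw [binaryDT, bdt, Dinv_sq, div_eq_mul_inv]
  rfl

/-- The definition adds the last step, the induction removes the first. The function `g` is
generalized because the induction hypothesis is also applied to the seed of the last step. -/
theorem iter_succ_eq (f : ℕ → ℝ → ℝ → ℝ) (i : ℕ) (g : ℝ → ℝ → ℝ) :
    iter f (i + 1) g = iter (fun j => bdt (f 0) (f (j + 1))) i (bdt (f 0) g) := by
  induction i generalizing g with
  | zero => exact binaryDT_eq _ _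
  | succ i ih => rw [iter, ih, ih]; rfl

/-- Stated at a single time, because the logarithmic and rational forms of the new potential are
identified only for `t ∈ T`. -/
theorem iterPotential_succ_eq {f : ℕ → ℝ → ℝ → ℝ} {u : ℝ → ℝ → ℝ} {t : ℝ}
    (h : binaryDTPotential (f 0) u t = bdtPot (f 0) u t) (i : ℕ) :
    iterPotential f u (i + 1) t
      = iterPotential (fun j => bdt (f 0) (f (j + 1))) (bdtPot (f 0) u) i t := by
  induction i with
  | zero => exact h
  | succ i ih =>
    funext x
    rw [iterPotential, binaryDTPotential, ih, iter_succ_eq]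
    rfl

variable {n N : ℕ} {α η : ℝ} {T : Set ℝ} {u u' f g : ℝ → ℝ → ℝ} {φ : Fin N → ℝ → ℝ → ℝ}
  {lams : Fin N → ℝ} {xi lam : ℝ}

namespace Seed

theorem deriv_log_om (s : Seed T u xi f) {t : ℝ} (ht : t ∈ T) :
    deriv (fun y => Real.log (om (f t) (f t) y))
      = fun y => f t y ^ 2 * (om (f t) (f t) y)⁻¹ := by
  funext y
  rw [(((s.decay s.partner ht).hasDerivAt_om y).log (s.ne_zero t ht y)).deriv, div_eq_mul_inv,
    pow_two]

theorem contDiff_log_om (s : Seed T u xi f) {t : ℝ} (ht : t ∈ T) :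
    ContDiff ℝ ∞ fun y => Real.log (om (f t) (f t) y) :=
  (s.decay s.partner ht).contDiff_om.log (s.ne_zero t ht)

theorem bdtPot_eq (s : Seed T u xi f) {t : ℝ} (ht : t ∈ T) (x : ℝ) :
    bdtPot f u t x
      = u t x + 2 * iteratedDeriv 2 (fun y => Real.log (om (f t) (f t) y)) x := by
  rw [bdtPot, iteratedDeriv_succ, iteratedDeriv_one, s.deriv_log_om ht]

theorem binaryDTPotential_eq (s : Seed T u xi f) {t : ℝ} (ht : t ∈ T) :
    binaryDTPotential f u t = bdtPot f u t := by
  funext x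
  rw [s.bdtPot_eq ht, binaryDTPotential, Dinv_sq]

end Seed

/-- Agreement on `T` suffices: `T` is open, so it also determines the time derivatives there. -/
theorem IsSolution.congr (h : IsSolution n α lams T u φ) (hT : IsOpen T)
    (e : ∀ t ∈ T, u' t = u t) : IsSolution n α lams T u' φ where
  smooth_u := StripC.congr (k := ∞) (g := u) h.smooth_u fun t ht x => congrFun (e t ht) x
  smooth_φ := h.smooth_φ
  evolution t ht x := by
    have e1 : (fun s => u' s x) =ᶠ[𝓝 t] fun s => u s x :=
      (hT.eventually_mem ht).mono fun s hs => congrFun (e s hs) x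
    rw [e1.deriv_eq, h.evolution t ht]
    simp only [ev, e t ht]
  spectral j t ht x := by rw [e t ht]; exact h.spectral j t ht x

theorem IsLaxSolution.congr (h : IsLaxSolution n α η T u φ lam g)
    (e : ∀ t ∈ T, u' t = u t) : IsLaxSolution n α η T u' φ lam g where
  smooth := h.smooth
  spectral t ht x := by rw [e t ht]; exact h.spectral t ht x
  integrable := h.integrable
  evolution t ht x := by
    rw [h.evolution t ht, Q, Q, A_eq_locA, A_eq_locA, e t ht]

theorem IsLaxSolution.flow (h : IsLaxSolution n α η T u φ lam g)
    (hd : ∀ j, ProductDecays T (φ j) g) : LaxFlow n α η T u φ lam g where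
  evolution t ht x := by rw [h.evolution t ht, Q, A_eq_locA]; rfl
  decays := hd

theorem LaxFlow.isLaxSolution (h : LaxFlow n α η T u φ lam g) (hφ : ∀ j, StripC ∞ T (φ j))
    (hg : StripC ∞ T g) (hs : Spectral T u lam g) : IsLaxSolution n α η T u φ lam g where
  smooth := hg
  spectral := schrodinger_iff.2 hs
  integrable j _ ht x := ((h.decays j).decay (hφ j) hg ht).integrableOn_zero x
  evolution t ht x := by rw [h.evolution t ht, Q, A_eq_locA]; rfl

theorem IsLaxSolution.partner (h : IsLaxSolution n α η T u φ lam g) (hd : ProductDecays T f g) :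
    Partner T u f lam g := ⟨h.smooth, schrodinger_iff.1 h.spectral, hd⟩

theorem snoc_succ (f : ℕ → ℝ → ℝ → ℝ) (m : ℕ) (g : ℝ → ℝ → ℝ) (i : Fin (m + 1)) :
    (Fin.snoc (α := fun _ => ℝ → ℝ → ℝ) (fun i : Fin (m + 1) => f i) g : Fin (m + 2) → _) i.succ
      = (Fin.snoc (α := fun _ => ℝ → ℝ → ℝ) (fun i : Fin m => f (i + 1)) g : Fin (m + 1) → _) i := by
  refine Fin.lastCases ?_ (fun i => ?_) i
  · rw [Fin.succ_last, Fin.snoc_last, Fin.snoc_last]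
  · rw [Fin.snoc_castSucc, Fin.succ_castSucc, Fin.snoc_castSucc, Fin.val_succ]

/-- The determinant in the denominator loses a factor in each step. -/
theorem Seed.seedW1_succ {f : ℕ → ℝ → ℝ → ℝ} {ξ : ℕ → ℝ} {m : ℕ} (s : Seed T u xi (f 0))
    (hF : StripC ∞ T fun t x => om (f 0 t) (f 0 t) x)
    (p : ∀ i < m, Partner T u (f 0) (ξ i) (f (i + 1)))
    (hd : ∀ i < m, ∀ j < m, ProductDecays T (f (i + 1)) (f (j + 1))) {t : ℝ} (ht : t ∈ T) (x : ℝ) :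
    seedW1 f (m + 1) t x
      = om (f 0 t) (f 0 t) x * seedW1 (fun j => bdt (f 0) (f (j + 1))) m t x :=
  W1_succ (s.ne_zero t ht x) fun i j =>
    s.om_bdt hF (p i i.2) (p j j.2) (hd i i.2 j j.2) ht x

/-- The determinant in the numerator loses a factor in each step. -/
theorem Seed.seedW2_succ {f : ℕ → ℝ → ℝ → ℝ} {ξ : ℕ → ℝ} {m : ℕ} (s : Seed T u xi (f 0))
    (hF : StripC ∞ T fun t x => om (f 0 t) (f 0 t) x)
    (p : ∀ i < m, Partner T u (f 0) (ξ i) (f (i + 1)))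
    (hd : ∀ i < m, ∀ j < m, ProductDecays T (f (i + 1)) (f (j + 1)))
    (q : Partner T u (f 0) lam g) (hg : ∀ i < m, ProductDecays T (f (i + 1)) g)
    {t : ℝ} (ht : t ∈ T) (x : ℝ) :
    seedW2 f (m + 1) g t x = om (f 0 t) (f 0 t) x
      * seedW2 (fun j => bdt (f 0) (f (j + 1))) m (bdt (f 0) g) t x := by
  have h0 : (Fin.snoc (α := fun _ => ℝ → ℝ → ℝ) (fun i : Fin (m + 1) => f i) g :
      Fin (m + 2) → _) 0 = f 0 := by
    rw [← Fin.castSucc_zero, Fin.snoc_castSucc]; rfl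
  have e : ∀ j, (Fin.snoc (α := fun _ => ℝ → ℝ → ℝ) (fun i : Fin m => bdt (f 0) (f (i + 1)))
      (bdt (f 0) g) : Fin (m + 1) → _) j = bdt (f 0)
      ((Fin.snoc (α := fun _ => ℝ → ℝ → ℝ) (fun i : Fin m => f (i + 1)) g :
        Fin (m + 1) → _) j) := fun j => by
    refine Fin.lastCases ?_ (fun i => ?_) j
    · rw [Fin.snoc_last, Fin.snoc_last]
    · rw [Fin.snoc_castSucc, Fin.snoc_castSucc]
  rw [seedW2, seedW2, ← h0]
  refine W2_succ (by rw [h0]; exact s.ne_zero t ht x) (fun i j hi => ?_) fun j => ?_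
  · rw [h0, snoc_succ, snoc_succ, e, e]
    obtain ⟨i, rfl⟩ := Fin.exists_castSucc_eq.2 hi
    rw [Fin.snoc_castSucc]
    refine Fin.lastCases ?_ (fun j => ?_) j
    · rw [Fin.snoc_last]
      exact s.om_bdt hF (p i i.2) q (hg i i.2) ht x
    · rw [Fin.snoc_castSucc]
      exact s.om_bdt hF (p i i.2) (p j j.2) (hd i i.2 j j.2) ht x
  · rw [h0, snoc_succ, e]

end KdV

/-! ### The induction on the number of transformations -/

open KdV in
theorem theorem5p2
    (n N m : ℕ) (α η : ℝ) (T : Set ℝ) (hT : IsOpen T)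
    (lams : Fin N → ℝ) (u : ℝ → ℝ → ℝ) (φ : Fin N → ℝ → ℝ → ℝ)
    (ξ : ℕ → ℝ) (f : ℕ → ℝ → ℝ → ℝ)
    -- `u, φ_1, …, φ_N` solve the `n`-th KdV equation with `N` sources
    (hsol : KdV.IsSolution n α lams T u φ)
    -- the seeds `f_1, …, f_m` solve the linear problem with `λ = ξ_1, …, ξ_m`
    (hf : ∀ i < m, KdV.IsLaxSolution n α η T u φ (ξ i) (f i))
    -- behaviour as `x → -∞`
    (hu : KdV.BoundedAtNegInfty T u)
    (hff : ∀ i < m, ∀ j < m, KdV.ProductDecays T (f i) (f j))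
    (hfφ : ∀ i < m, ∀ j, KdV.ProductDecays T (f i) (φ j))
    -- each of the `m` transformations is defined
    (hdef : ∀ i < m, ∀ t ∈ T, ∀ x,
      KdV.Dinv (fun s y => KdV.iter f i (f i) s y ^ 2) t x ≠ 0) :
    (∀ t ∈ T, ∀ x, 0 < KdV.seedW1 f m t x) ∧
    (∀ t ∈ T, ∀ x, KdV.iterPotential f u m t x
      = u t x + 2 * iteratedDeriv 2 (fun y => Real.log (KdV.seedW1 f m t y)) x) ∧
    (∀ j, ∀ t ∈ T, ∀ x,
      KdV.iter f m (φ j) t x = KdV.seedW2 f m (φ j) t x / KdV.seedW1 f m t x) ∧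
    KdV.IsSolution n α lams T (KdV.iterPotential f u m) (fun j => KdV.iter f m (φ j)) ∧
    (∀ (lam : ℝ) (ψ : ℝ → ℝ → ℝ), KdV.IsLaxSolution n α η T u φ lam ψ →
      (∀ i < m, KdV.ProductDecays T (f i) ψ) → (∀ j, KdV.ProductDecays T (φ j) ψ) →
      (∀ t ∈ T, ∀ x,
        KdV.iter f m ψ t x = KdV.seedW2 f m ψ t x / KdV.seedW1 f m t x) ∧
      KdV.IsLaxSolution n α η T (KdV.iterPotential f u m) (fun j => KdV.iter f m (φ j))
        lam (KdV.iter f m ψ)) := by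
  -- The solution and the seeds vary, since the induction hypothesis is used for the data
  -- transformed by the first seed.
  induction m generalizing u φ ξ f with
  | zero =>
    have h1 : ∀ t x, seedW1 f 0 t x = 1 := fun t x => Matrix.det_fin_zero
    have h2 : ∀ g t x, seedW2 f 0 g t x = g t x := fun g t x => by
      simp [seedW2, W2, Fin.snoc]
    simp only [h1, h2, div_one, Real.log_one]
    refine ⟨fun _ _ _ => one_pos, fun t _ x => ?_, fun _ _ _ _ => rfl, hsol,
      fun lam ψ hψ _ _ => ⟨fun _ _ _ => rfl, hψ⟩⟩
    simp [iterPotential]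
  | succ m ih =>
    have h0 := hf 0 m.succ_pos
    have hlt : ∀ i < m, i + 1 < m + 1 := fun i hi => Nat.succ_lt_succ hi
    have s : Seed T u (ξ 0) (f 0) := ⟨hT, hsol.smooth_u, hu, h0.smooth,
      schrodinger_iff.1 h0.spectral, hff 0 m.succ_pos 0 m.succ_pos, fun t ht x => by
        have := hdef 0 m.succ_pos t ht x
        rwa [iter, Dinv_sq] at this⟩
    have hφ : ∀ j, Partner T u (f 0) (lams j) (φ j) := fun j =>
      ⟨hsol.smooth_φ j, schrodinger_iff.1 (hsol.spectral j), hfφ 0 m.succ_pos j⟩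
    have hfl : ∀ i < m + 1, LaxFlow n α η T u φ (ξ i) (f i) := fun i hi =>
      (hf i hi).flow fun j => (hfφ i hi j).symm
    have hF := s.om_self_strip hφ (hfl 0 m.succ_pos)
    have hp : ∀ i < m, Partner T u (f 0) (ξ (i + 1)) (f (i + 1)) := fun i hi =>
      (hf _ (hlt i hi)).partner (hff 0 m.succ_pos _ (hlt i hi))
    have hd : ∀ i < m, ∀ j < m, ProductDecays T (f (i + 1)) (f (j + 1)) := fun i hi j hj =>
      hff _ (hlt i hi) _ (hlt j hj)
    have lax : ∀ {lam : ℝ} {g : ℝ → ℝ → ℝ}, Partner T u (f 0) lam g →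
        LaxFlow n α η T u φ lam g →
        IsLaxSolution n α η T (bdtPot (f 0) u) (fun j => bdt (f 0) (φ j)) lam (bdt (f 0) g) :=
      fun p hg => (s.flow_bdt hφ (hfl 0 m.succ_pos) p hg).isLaxSolution
        (fun j => s.smooth_bdt hF (hφ j)) (s.smooth_bdt hF p) (s.spectral_bdt p)
    have hpot : ∀ t ∈ T, iterPotential f u (m + 1) t
        = iterPotential (fun j => bdt (f 0) (f (j + 1))) (bdtPot (f 0) u) m t := fun t ht =>
      iterPotential_succ_eq (s.binaryDTPotential_eq ht) m
    obtain ⟨c1, c2, c3, c4, c5⟩ := ih (bdtPot (f 0) u) (fun j => bdt (f 0) (φ j))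
      (fun i => ξ (i + 1)) (fun i => bdt (f 0) (f (i + 1)))
      ⟨s.smooth_bdtPot hF, fun j => s.smooth_bdt hF (hφ j),
        fun t ht x => s.evolution_bdtPot hφ (hfl 0 m.succ_pos) hsol.evolution ht x,
        fun j => schrodinger_iff.2 (s.spectral_bdt (hφ j))⟩
      (fun i hi => lax (hp i hi) (hfl _ (hlt i hi)))
      s.bounded_bdtPot
      (fun i hi j hj => s.decays_bdt hF (hp i hi) (hp j hj) (hd i hi j hj))
      (fun i hi j => s.decays_bdt hF (hp i hi) (hφ j) (hfφ _ (hlt i hi) j))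
      (fun i hi t ht x => by
        have := hdef _ (hlt i hi) t ht x
        rwa [iter_succ_eq] at this)
    have hW : ∀ t ∈ T, ∀ x, seedW1 f (m + 1) t x
        = om (f 0 t) (f 0 t) x * seedW1 (fun j => bdt (f 0) (f (j + 1))) m t x :=
      fun t ht x => s.seedW1_succ (ξ := fun i => ξ (i + 1)) hF hp hd ht x
    have quot : ∀ {lam : ℝ} {g : ℝ → ℝ → ℝ}, Partner T u (f 0) lam g →
        (∀ i < m, ProductDecays T (f (i + 1)) g) → ∀ t ∈ T, ∀ x,
        seedW2 f (m + 1) g t x / seedW1 f (m + 1) t x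
          = seedW2 (fun j => bdt (f 0) (f (j + 1))) m (bdt (f 0) g) t x
            / seedW1 (fun j => bdt (f 0) (f (j + 1))) m t x := fun q hg t ht x => by
      rw [hW t ht, s.seedW2_succ (ξ := fun i => ξ (i + 1)) hF hp hd q hg ht,
        mul_div_mul_left _ _ (s.ne_zero t ht x)]
    simp only [iter_succ_eq]
    refine ⟨fun t ht x => ?_, fun t ht x => ?_, fun j t ht x => ?_, c4.congr hT hpot,
      fun lam ψ hψ hfψ hφψ => ?_⟩
    · rw [hW t ht]
      exact mul_pos (s.pos ht x) (c1 t ht x)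
    -- `ln W_1` is the sum of `ln ∂⁻¹ f_1²`, which accounts for the first step of the potential, and
    -- the logarithm of the smaller determinant, which accounts for the others.
    · have hlog : (fun y => Real.log (seedW1 f (m + 1) t y))
          = (fun y => Real.log (om (f 0 t) (f 0 t) y))
            + fun y => Real.log (seedW1 (fun j => bdt (f 0) (f (j + 1))) m t y) := by
        funext y
        rw [Pi.add_apply, hW t ht, Real.log_mul (s.ne_zero t ht y) (c1 t ht y).ne']
      have hsm : ContDiff ℝ ∞ (seedW1 (fun j => bdt (f 0) (f (j + 1))) m t) :=
        contDiff_W1 fun i j => ((s.decays_bdt hF (hp i i.2) (hp j j.2)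
          (hd i i.2 j j.2)).decay (s.smooth_bdt hF (hp i i.2))
          (s.smooth_bdt hF (hp j j.2)) ht).contDiff_om
      have hs2 : ContDiff ℝ ∞ fun y =>
          Real.log (seedW1 (fun j => bdt (f 0) (f (j + 1))) m t y) :=
        hsm.log fun y => (c1 t ht y).ne'
      have h2 : ((2 : ℕ) : WithTop ℕ∞) ≤ ∞ := WithTop.coe_le_coe.2 le_top
      rw [hpot t ht, c2 t ht, s.bdtPot_eq ht, hlog,
        iteratedDeriv_add ((s.contDiff_log_om ht).of_le h2).contDiffAt
          (hs2.of_le h2).contDiffAt]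
      ring
    · rw [c3 j t ht x, quot (hφ j) (fun i hi => hfφ _ (hlt i hi) j) t ht x]
    · have q := hψ.partner (hfψ 0 m.succ_pos)
      have hfψ' : ∀ i < m, ProductDecays T (f (i + 1)) ψ := fun i hi => hfψ _ (hlt i hi)
      obtain ⟨d1, d2⟩ := c5 lam (bdt (f 0) ψ) (lax q (hψ.flow hφψ))
        (fun i hi => s.decays_bdt hF (hp i hi) q (hfψ' i hi))
        (fun j => s.decays_bdt hF (hφ j) q (hφψ j))
      exact ⟨fun t ht x => by rw [d1 t ht x, quot q hfψ' t ht x], d2.congr hpot⟩
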